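/- Let $(M,g)$ be a spacetime: a smooth four-dimensional manifold $M$ with a smooth Lorentzian metric $g$ of signature $(+,-,-,-)$, equipped with a spin structure. Let $DM$ be the Dirac bundle, i.e. the $\mathbb C^4$-bundle associated with the spin structure by the Dirac representation of $SL(2,\mathbb C)$, let $D^*M$ be its dual, and let $\nabla$ denote the spin connection on both. Let $\gamma$ denote the Dirac matrices, $\{\gamma^\mu,\gamma^\nu\}=2g^{\mu\nu}$, write $\not\xi=\xi_\mu\gamma^\mu$ for a covector $\xi$, and for $m\in\mathbb R$ consider the Dirac operators $$P=-i\not\nabla+m\ \text{ on } DM,\quad \not\nabla\psi=\gamma^\mu\nabla_\mu\psi,\qquad P^*=i\not\nabla+m\ \text{ on } D^*M,\quad \not\nabla v=(\nabla_\mu v)\gamma^\mu .$$ Definitions. In local coordinates $x^\mu$ and a local frame, a first order system $\sum_\mu a^\mu\partial_\mu+b$ has principal symbol $p(x,\xi)=i\sum_\mu a^\mu(x)\xi_\mu$ and subprincipal symbol $p^s=b-\frac1{2i}\sum_\mu\partial^2p/\partial x^\mu\partial\xi_\mu$. A real scalar symbol $q$ is of real principal type if at every point where $q=0$ its Hamiltonian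 vector field $H_q=\sum_\mu\bigl(\partial_{\xi_\mu}q\,\partial_{x^\mu}-\partial_{x^\mu}q\,\partial_{\xi_\mu}\bigr)$ has a nonzero $\partial_x$-component. The system is of real principal type if, in a neighbourhood of each point of $T^*M\setminus 0$, there are a matrix symbol $\tilde p$ and a real scalar symbol $q$ of real principal type with $\tilde p\,p=q\cdot\mathbf 1$. Given such $\tilde p,q$, Dencker's connection is $D_Pw=H_qw+\frac12\{\tilde p,p\}w+i\tilde p\,p^sw$, where $\{\tilde p,p\}=\sum_\mu(\partial_{\xi_\mu}\tilde p\,\partial_{x^\mu}p-\partial_{x^\mu}\tilde p\,\partial_{\xi_\mu}p)$; it acts on sections $w$ with values in $\ker p$ over the null bicharacteristics of $q$, that is, over the integral curves of $H_q$ in $\{q=0\}\subset T^*M\setminus 0$. Theorem. (1) For every $m$ the operators $P$ and $P^*$ are of real principal type on $T^*M\setminus 0$. In any local coordinates and any local frame of $DM$, $P$ has principal symbol $p=\not\xi$, and $\tilde p=\sqrt{-g}\,\not\xi$, $q=\sqrt{-g}\,g^{\mu\nu}\xi_\mu\xi_\nu$ satisfy $\tilde p\,p=q\cdot\mathbf 1$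 with $q$ of real principal type; moreover $\det p(x,\xi)=0$ if and only if $q(x,\xi)=0$. For $P^*$ and any local frame of $D^*M$ the same holds with $p$ given by $v\mapsto-v\not\xi$, $\tilde p$ given by $v\mapsto-\sqrt{-g}\,v\not\xi$, and the same $q$. (2) Along every null bicharacteristic $(x(\tau),\xi(\tau))$ of $q$ one has $\dot x^\mu=2\sqrt{-g}\,g^{\mu\nu}\xi_\nu$, and $x(\tau)$ is a (not necessarily affinely parametrized) null geodesic. Conversely, every null geodesic is, up to reparametrization, the projection of a null bicharacteristic of $q$. (3) With these choices of $\tilde p$ and $q$, Dencker's connection for $P$ is the spin connection lifted to $\pi^*DM$ and restricted to the null bicharacteristics: if $\nabla_\mu=\partial_\mu+\sigma_\mu$ in the chosen local frame, then at every $(x,\xi)$ with $\xi\ne0$ and $q(x,\xi)=0$, and for every section $w$ of $\pi^*DM$ with $p(x,\xi)w(x,\xi)=0$, $$D_Pw=(\pi^*\nabla)_{H_q}w ,$$ and for every section $w(\tau)$ along a null bicharacteristic with $p\,w=0$, $$D_Pw=\Bigl(\frac{d}{d\tau}+\dot x^\mu\sigma_\mu\Bigr)w=\nabla_\tau w .$$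 The same holds for $P^*$ and the spin connection on $D^*M$. (4) In both cases the principal symbol does not depend on $m$, and Dencker's connection on $\ker p$ does not depend on $m$. -/

import Mathlib

open scoped Manifold ContDiff Bundle Topology

noncomputable section

/-! ## Linear algebra: Minkowski space, Dirac matrices, the covering `SL(2,ℂ) → SO⁺(1,3)` -/

/-- The model space `ℝ⁴`. -/
abbrev R4 : Type := EuclideanSpace ℝ (Fin 4)

/-- Index set of the four spinor components (two chiral blocks). -/
abbrev SpinIdx : Type := Fin 2 ⊕ Fin 2

/-- The model fibre `ℂ⁴` of the Dirac bundle. -/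
abbrev Spinor : Type := SpinIdx → ℂ

/-- Complex `4 × 4` matrices acting on spinors. -/
abbrev SpinMat : Type := Matrix SpinIdx SpinIdx ℂ

/-- Standard basis vectors of `ℝ⁴`. -/
def stdVec (μ : Fin 4) : R4 := EuclideanSpace.single μ 1

/-- Minkowski metric of signature `(+ - - -)`. -/
def minkowski (a b : Fin 4) : ℝ := if a = b then (if a = 0 then 1 else -1) else 0

/-- `σ₀ = 1` and the Pauli matrices `σ₁, σ₂, σ₃`. -/
def pauli : Fin 4 → Matrix (Fin 2) (Fin 2) ℂ
  | 0 => !![1, 0; 0, 1]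
  | 1 => !![0, 1; 1, 0]
  | 2 => !![0, -Complex.I; Complex.I, 0]
  | 3 => !![1, 0; 0, -1]

/-- Dirac matrices (chiral representation)
`γ⁰ = [[0, 1], [1, 0]]`, `γⁱ = [[0, σᵢ], [-σᵢ, 0]]`. -/
def diracGamma (a : Fin 4) : SpinMat :=
  Matrix.fromBlocks 0 (pauli a) (if a = 0 then pauli a else -pauli a) 0

/-- The covering homomorphism `Λ : SL(2,ℂ) → SO⁺(1,3)`, `S σ_b S* = ∑ₐ Λ(S)ᵃ_b σₐ`,
that is `Λ(S)ᵃ_b = ½ tr (σₐ S σ_b S*)`. -/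
def lorentzOf (A : Matrix.SpecialLinearGroup (Fin 2) ℂ) : Matrix (Fin 4) (Fin 4) ℝ :=
  Matrix.of fun a b =>
    ((pauli a * A.1 * pauli b * A.1.conjTranspose).trace).re / 2

/-- The Dirac spinor representation `S ↦ (S*)⁻¹ ⊕ S` of `SL(2,ℂ)` on `ℂ⁴`. -/
def spinRep (A : Matrix.SpecialLinearGroup (Fin 2) ℂ) : SpinMat :=
  Matrix.fromBlocks (A⁻¹).1.conjTranspose 0 0 A.1

lemma spinRep_one : spinRep 1 = 1 := by
  simp [spinRep]

lemma spinRep_mul (A B : Matrix.SpecialLinearGroup (Fin 2) ℂ) :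
    spinRep (A * B) = spinRep A * spinRep B := by
  simp only [spinRep, mul_inv_rev, Matrix.SpecialLinearGroup.coe_mul, Matrix.conjTranspose_mul,
    Matrix.fromBlocks_multiply]
  simp

/-! ## Spacetimes and spin structures -/

section Spacetime

variable {M : Type*} [TopologicalSpace M] [ChartedSpace R4 M] [IsManifold (𝓡 4) ∞ M]

variable (M) in
/-- A smooth Lorentzian metric of signature `(+ - - -)` on the four-dimensional manifold `M`. -/
structure LorentzMetric where
  /-- the bilinear form on each tangent space -/
  val (x : M) : TangentSpace (𝓡 4) x →L[ℝ] TangentSpace (𝓡 4) x →L[ℝ] ℝ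
  symm (x : M) (v w : TangentSpace (𝓡 4) x) : val x v w = val x w v
  signature (x : M) : ∃ b : Module.Basis (Fin 4) ℝ (TangentSpace (𝓡 4) x),
    ∀ a c, val x (b a) (b c) = minkowski a c
  contMDiff : ContMDiff (𝓡 4) ((𝓡 4).prod 𝓘(ℝ, R4 →L[ℝ] R4 →L[ℝ] ℝ)) ∞
    (fun x => Bundle.TotalSpace.mk' (R4 →L[ℝ] R4 →L[ℝ] ℝ)
      (E := fun x : M => TangentSpace (𝓡 4) x →L[ℝ] TangentSpace (𝓡 4) x →L[ℝ] ℝ) x (val x))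

/-- A spin structure on `(M, g)`, given by local data: an open cover, a smooth orthonormal frame on
each member of the cover, and a smooth `SL(2,ℂ)`-valued cocycle which lifts the transition functions
of the frames.  (As `Λ` takes values in `SO⁺(1,3)`, the frames define an orientation and a time
orientation of `M`.) -/
structure SpinStructure (g : LorentzMetric M) where
  /-- index set of the cover -/
  ι : Type*
  /-- the members of the cover -/
  baseSet : ι → Set M
  isOpen_baseSet : ∀ i, IsOpen (baseSet i)
  /-- a choice, for each point, of a member of the cover which contains it -/
  indexAt : M → ι
  mem_baseSet_at : ∀ x, x ∈ baseSet (indexAt x)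
  /-- the orthonormal frame `(e_0, e_1, e_2, e_3)` on `baseSet i` -/
  frame : ι → Fin 4 → (x : M) → TangentSpace (𝓡 4) x
  contMDiffOn_frame : ∀ i a, ContMDiffOn (𝓡 4) (𝓡 4).tangent ∞
    (fun x => (⟨x, frame i a x⟩ : TangentBundle (𝓡 4) M)) (baseSet i)
  orthonormal : ∀ i, ∀ x ∈ baseSet i, ∀ a b,
    g.val x (frame i a x) (frame i b x) = minkowski a b
  /-- the lifted transition functions -/
  lift : ι → ι → M → Matrix.SpecialLinearGroup (Fin 2) ℂ
  contMDiffOn_lift : ∀ i j (k l : Fin 2), ContMDiffOn (𝓡 4) 𝓘(ℝ, ℂ) ∞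
    (fun x => (lift i j x).1 k l) (baseSet i ∩ baseSet j)
  lift_comp : ∀ i j k, ∀ x ∈ baseSet i ∩ baseSet j ∩ baseSet k,
    lift i j x * lift j k x = lift i k x
  frame_eq : ∀ i j, ∀ x ∈ baseSet i ∩ baseSet j, ∀ b,
    frame j b x = ∑ a, lorentzOf (lift i j x) a b • frame i a x

variable {g : LorentzMetric M}

namespace SpinStructure

variable (S : SpinStructure g)

lemma lift_self (i : S.ι) (x : M) (hx : x ∈ S.baseSet i) : S.lift i i x = 1 := by
  have h := S.lift_comp i i i x ⟨⟨hx, hx⟩, hx⟩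
  simpa using h

lemma continuousOn_spinRep (i j : S.ι) :
    ContinuousOn (fun x => spinRep (S.lift i j x)) (S.baseSet i ∩ S.baseSet j) := by
  have h : ContinuousOn (fun x => (S.lift i j x).1) (S.baseSet i ∩ S.baseSet j) :=
    continuousOn_pi.2 fun k => continuousOn_pi.2 fun l => (S.contMDiffOn_lift i j k l).continuousOn
  have h' : ContinuousOn (fun x => ((S.lift i j x)⁻¹).1) (S.baseSet i ∩ S.baseSet j) := by
    simp only [Matrix.SpecialLinearGroup.coe_inv]
    exact (Continuous.matrix_adjugate continuous_id).comp_continuousOn h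
  have hc : Continuous fun p : Matrix (Fin 2) (Fin 2) ℂ × Matrix (Fin 2) (Fin 2) ℂ =>
      (Matrix.fromBlocks p.1.conjTranspose 0 0 p.2 : SpinMat) :=
    Continuous.matrix_fromBlocks continuous_fst.matrix_conjTranspose continuous_const
      continuous_const continuous_snd
  have hf : (fun x => spinRep (S.lift i j x)) =
      (fun p : Matrix (Fin 2) (Fin 2) ℂ × Matrix (Fin 2) (Fin 2) ℂ =>
        (Matrix.fromBlocks p.1.conjTranspose 0 0 p.2 : SpinMat)) ∘
        (fun x => (((S.lift i j x)⁻¹).1, (S.lift i j x).1)) := rfl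
  rw [hf]
  exact hc.comp_continuousOn (h'.prodMk h)

/-- The Dirac bundle `DM`: the `ℂ⁴`-bundle associated with the spin structure by the Dirac
representation. Components of a spinor transform as `ψ_j = ρ(S_ji) ψ_i`. -/
def diracBundle : VectorBundleCore ℂ M Spinor S.ι where
  baseSet := S.baseSet
  isOpen_baseSet := S.isOpen_baseSet
  indexAt := S.indexAt
  mem_baseSet_at := S.mem_baseSet_at
  coordChange i j x := LinearMap.toContinuousLinearMap (Matrix.mulVecLin (spinRep (S.lift j i x)))
  coordChange_self i x hx v := by
    have h := S.lift_self i x hx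
    change (spinRep (S.lift i i x)).mulVec v = v
    rw [h, spinRep_one, Matrix.one_mulVec]
  continuousOn_coordChange i j := by
    have hc : Continuous fun A : SpinMat => LinearMap.toContinuousLinearMap (Matrix.mulVecLin A) :=
      LinearMap.continuous_of_finiteDimensional
        ((LinearMap.toContinuousLinearMap (𝕜 := ℂ) (E := Spinor) (F' := Spinor)).toLinearMap ∘ₗ
          (Matrix.toLin' (R := ℂ) (m := SpinIdx) (n := SpinIdx)).toLinearMap)
    refine hc.comp_continuousOn ((S.continuousOn_spinRep j i).mono ?_)
    exact fun x hx => ⟨hx.2, hx.1⟩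
  coordChange_comp i j k x hx v := by
    have h := S.lift_comp k j i x ⟨⟨hx.2, hx.1.2⟩, hx.1.1⟩
    simp [← h, spinRep_mul]

/-- The dual Dirac bundle `D*M`. Components of a cospinor (row vectors) transform as
`v_j = v_i ρ(S_ij)`. -/
def codiracBundle : VectorBundleCore ℂ M Spinor S.ι where
  baseSet := S.baseSet
  isOpen_baseSet := S.isOpen_baseSet
  indexAt := S.indexAt
  mem_baseSet_at := S.mem_baseSet_at
  coordChange i j x := LinearMap.toContinuousLinearMap (Matrix.vecMulLinear (spinRep (S.lift i j x)))
  coordChange_self i x hx v := by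
    have h := S.lift_self i x hx
    change Matrix.vecMul v (spinRep (S.lift i i x)) = v
    rw [h, spinRep_one, Matrix.vecMul_one]
  continuousOn_coordChange i j := by
    have hc : Continuous fun A : SpinMat =>
        LinearMap.toContinuousLinearMap (Matrix.mulVecLin A.transpose) :=
      (LinearMap.continuous_of_finiteDimensional
        ((LinearMap.toContinuousLinearMap (𝕜 := ℂ) (E := Spinor) (F' := Spinor)).toLinearMap ∘ₗ
          (Matrix.toLin' (R := ℂ) (m := SpinIdx) (n := SpinIdx)).toLinearMap)).comp
        continuous_id.matrix_transpose
    have he : ∀ A : SpinMat, Matrix.vecMulLinear A = Matrix.mulVecLin A.transpose := by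
      intro A; ext v; simp
    simp only [he]
    exact hc.comp_continuousOn (S.continuousOn_spinRep i j)
  coordChange_comp i j k x hx v := by
    have h := S.lift_comp i j k x hx
    simp [← h, spinRep_mul]

end SpinStructure

/-! ## Levi-Civita connection, spin connection, Dirac operators -/

/-- The Levi-Civita connection in the form of the Koszul formula:
`g(∇_X Y, Z)` at the point `x`. -/
def leviCivita (g : LorentzMetric M) (X Y Z : (x : M) → TangentSpace (𝓡 4) x) (x : M) : ℝ :=
  (mvfderiv (𝓡 4) (fun y => g.val y (Y y) (Z y)) x (X x)
    + mvfderiv (𝓡 4) (fun y => g.val y (X y) (Z y)) x (Y x)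
    - mvfderiv (𝓡 4) (fun y => g.val y (X y) (Y y)) x (Z x)
    + g.val x (VectorField.mlieBracket (𝓡 4) X Y x) (Z x)
    - g.val x (VectorField.mlieBracket (𝓡 4) X Z x) (Y x)
    - g.val x (VectorField.mlieBracket (𝓡 4) Y Z x) (X x)) / 2

/-- Sections of a bundle (no regularity imposed). -/
abbrev Sec {ι : Type*} (Z : VectorBundleCore ℂ M Spinor ι) : Type _ := (x : M) → Z.Fiber x

/-- The components of a section in the `i`-th trivialization. -/
def inTriv {ι : Type*} (Z : VectorBundleCore ℂ M Spinor ι) (i : ι) (ψ : Sec Z) (x : M) : Spinor :=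
  (Z.localTriv i ⟨x, ψ x⟩).2

/-- The components of an element of the fibre over `x` in the preferred trivialization around `x`. -/
def comps {ι : Type*} (Z : VectorBundleCore ℂ M Spinor ι) (x : M) (v : Z.Fiber x) : Spinor := v

/-- The element of the fibre over `x` with given components in the preferred trivialization
around `x`. -/
def ofComps {ι : Type*} (Z : VectorBundleCore ℂ M Spinor ι) (x : M) (v : Spinor) : Z.Fiber x := v

namespace SpinStructure

variable (S : SpinStructure g)

/-- The spin connection form in the `i`-th spin frame:
`Ω(X) = ¼ ∑ g(∇_X e_b, e_a) γᵃ γᵇ`, with `X = ∑ X^c e_c`, `X^c = η_cc g(e_c, X)`. -/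
def connForm (i : S.ι) (x : M) (X : TangentSpace (𝓡 4) x) : SpinMat :=
  ∑ a, ∑ b, ∑ c, (((minkowski c c * g.val x (S.frame i c x) X *
    leviCivita g (S.frame i c) (S.frame i b) (S.frame i a) x / 4 : ℝ)) : ℂ) •
      (diracGamma a * diracGamma b)

/-- Clifford multiplication by a covector in the `i`-th spin frame, `ξ̸ = ∑ₐ ξ(eₐ) γᵃ`. -/
def slash (i : S.ι) (x : M) (ξ : TangentSpace (𝓡 4) x →L[ℝ] ℝ) : SpinMat :=
  ∑ a, ((ξ (S.frame i a x) : ℝ) : ℂ) • diracGamma a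

/-- The spin connection `∇_X ψ` on the Dirac bundle, computed at `x` in the preferred spin frame
around `x`: `∇_X ψ = dψ(X) + Ω(X) ψ`. (It does not depend on the choice of the spin frame.) -/
def spinConn (ψ : Sec S.diracBundle) (x : M) (X : TangentSpace (𝓡 4) x) :
    S.diracBundle.Fiber x :=
  ofComps S.diracBundle x (mvfderiv (𝓡 4) (inTriv S.diracBundle (S.indexAt x) ψ) x X
    + (S.connForm (S.indexAt x) x X).mulVec (comps S.diracBundle x (ψ x)))

/-- The spin connection on the dual bundle, `∇_X v = dv(X) - v Ω(X)`. -/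
def cospinConn (v : Sec S.codiracBundle) (x : M) (X : TangentSpace (𝓡 4) x) :
    S.codiracBundle.Fiber x :=
  ofComps S.codiracBundle x (mvfderiv (𝓡 4) (inTriv S.codiracBundle (S.indexAt x) v) x X
    - Matrix.vecMul (comps S.codiracBundle x (v x)) (S.connForm (S.indexAt x) x X))

/-- The Dirac operator `-i ∇̸ + m` on the Dirac bundle, `∇̸ψ = ∑ₐ γᵃ ∇_{eₐ} ψ`. -/
def diracOp (m : ℝ) (ψ : Sec S.diracBundle) : Sec S.diracBundle := fun x =>
  ofComps S.diracBundle x (-Complex.I • ∑ a, (diracGamma a).mulVec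
      (comps S.diracBundle x (S.spinConn ψ x (S.frame (S.indexAt x) a x)))
    + (m : ℂ) • comps S.diracBundle x (ψ x))

/-- The Dirac operator `i ∇̸ + m` on the dual bundle, `∇̸v = ∑ₐ (∇_{eₐ} v) γᵃ`. -/
def codiracOp (m : ℝ) (v : Sec S.codiracBundle) : Sec S.codiracBundle := fun x =>
  ofComps S.codiracBundle x (Complex.I • ∑ a, Matrix.vecMul
      (comps S.codiracBundle x (S.cospinConn v x (S.frame (S.indexAt x) a x))) (diracGamma a)
    + (m : ℂ) • comps S.codiracBundle x (v x))

end SpinStructure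

/-! ## Local coordinates and local frames -/

/-- Charts (local coordinates) of `M`. -/
abbrev Chart (M : Type*) [TopologicalSpace M] : Type _ := OpenPartialHomeomorph M R4

/-- The coordinate vector field `∂_μ` of a chart. -/
def coordVec (φ : Chart M) (μ : Fin 4) (x : M) : TangentSpace (𝓡 4) x :=
  (mvfderiv (𝓡 4) φ x).inverse (stdVec μ)

/-- The coordinate differential `dx^μ` of a chart. -/
def coordCovec (φ : Chart M) (μ : Fin 4) (x : M) : TangentSpace (𝓡 4) x →L[ℝ] ℝ :=
  (EuclideanSpace.proj μ : R4 →L[ℝ] ℝ).comp (mvfderiv (𝓡 4) φ x)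

/-- The matrix `g_{μν}` of the metric in local coordinates. -/
def metricMat (g : LorentzMetric M) (φ : Chart M) (y : R4) : Matrix (Fin 4) (Fin 4) ℝ :=
  Matrix.of fun μ ν => g.val (φ.symm y) (coordVec φ μ (φ.symm y)) (coordVec φ ν (φ.symm y))

/-- `√(-det g)` in local coordinates. -/
def sqrtNegDet (g : LorentzMetric M) (φ : Chart M) (y : R4) : ℝ :=
  Real.sqrt (-(metricMat g φ y).det)

/-- Christoffel symbols `Γ^κ_{μν}` in local coordinates. -/
def christoffel (g : LorentzMetric M) (φ : Chart M) (y : R4) (κ μ ν : Fin 4) : ℝ :=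
  ∑ ρ, (metricMat g φ y)⁻¹ κ ρ *
    (fderiv ℝ (fun z => metricMat g φ z ρ ν) y (stdVec μ)
      + fderiv ℝ (fun z => metricMat g φ z ρ μ) y (stdVec ν)
      - fderiv ℝ (fun z => metricMat g φ z μ ν) y (stdVec ρ)) / 2

/-- In the chart `φ`, the curve `x : I → φ(U)` is a null geodesic with an arbitrary regular
parametrization: its velocity is nonzero and lightlike and `∇_ẋ ẋ` is proportional to `ẋ`. -/
structure IsNullGeodesic (g : LorentzMetric M) (φ : Chart M) (U : Set M) (x : ℝ → R4)
    (I : Set ℝ) : Prop where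
  contDiffOn : ContDiffOn ℝ 2 x I
  mem : ∀ t ∈ I, x t ∈ φ '' U
  ne_zero : ∀ t ∈ I, deriv x t ≠ 0
  null : ∀ t ∈ I, ∑ μ, ∑ ν, metricMat g φ (x t) μ ν * deriv x t μ * deriv x t ν = 0
  geodesic : ∀ t ∈ I, ∃ k : ℝ, ∀ κ, deriv (deriv x) t κ
    + ∑ μ, ∑ ν, christoffel g φ (x t) κ μ ν * deriv x t μ * deriv x t ν = k * deriv x t κ

section Frames

variable {ι : Type*} {Z : VectorBundleCore ℂ M Spinor ι}

/-- The matrix whose columns are the vectors of a local frame of the bundle (in the preferred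
trivialization at the point). -/
def frameMat (s : SpinIdx → Sec Z) (x : M) : SpinMat :=
  Matrix.of fun c b => comps Z x (s b x) c

/-- `s` is a smooth local frame of the complex vector bundle on the open set `U`. -/
structure IsFrameOn (s : SpinIdx → Sec Z) (U : Set M) : Prop where
  isOpen : IsOpen U
  contMDiffOn : ∀ b i, ContMDiffOn (𝓡 4) 𝓘(ℝ, Spinor) ∞ (inTriv Z i (s b)) (U ∩ Z.baseSet i)
  isUnit : ∀ x ∈ U, IsUnit (frameMat s x).det

/-- The matrix, with respect to a local frame, of a fibre endomorphism which is given by the matrix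
`T` in the preferred trivialization. -/
def inFrame (s : SpinIdx → Sec Z) (x : M) (T : SpinMat) : SpinMat :=
  (frameMat s x)⁻¹ * T * frameMat s x

/-- The connection matrices `σ_μ` of a covariant derivative in local coordinates and a local frame:
`∇_μ s_b = ∑_c (σ_μ)_{cb} s_c`, so that `∇_μ = ∂_μ + σ_μ` on components. -/
def connMat (D : Sec Z → (x : M) → TangentSpace (𝓡 4) x → Z.Fiber x) (φ : Chart M)
    (s : SpinIdx → Sec Z) (μ : Fin 4) (y : R4) : SpinMat :=
  (frameMat s (φ.symm y))⁻¹ *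
    Matrix.of fun c b => comps Z (φ.symm y) (D (s b) (φ.symm y) (coordVec φ μ (φ.symm y))) c

/-- The section with components `f`, as functions of the coordinates, in the local frame `s`. -/
def ofComponents (φ : Chart M) (s : SpinIdx → Sec Z) (f : R4 → Spinor) : Sec Z :=
  fun x => ofComps Z x ((frameMat s x).mulVec (f (φ x)))

/-- In the coordinates `φ` and the local frame `s` over `U`, the operator `P` is the first order
differential operator `∑_μ a^μ ∂_μ + b` with smooth matrix coefficients. -/
structure HasLocalForm (P : Sec Z → Sec Z) (φ : Chart M) (s : SpinIdx → Sec Z) (U : Set M)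
    (a : Fin 4 → R4 → SpinMat) (b : R4 → SpinMat) : Prop where
  smooth_a : ∀ μ c d, ContDiffOn ℝ ∞ (fun y => a μ y c d) (φ '' U)
  smooth_b : ∀ c d, ContDiffOn ℝ ∞ (fun y => b y c d) (φ '' U)
  apply_eq : ∀ f : R4 → Spinor, ContDiffOn ℝ ∞ f (φ '' U) → ∀ x ∈ U,
    P (ofComponents φ s f) x = ofComponents φ s (fun y =>
      ∑ μ, (a μ y).mulVec (fderiv ℝ f y (stdVec μ)) + (b y).mulVec (f y)) x

end Frames

end Spacetime

/-! ## Symbols, real principal type, Dencker's connection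

Points of the cotangent bundle over a chart are pairs `(x, ξ)` in `ℝ⁴ × ℝ⁴`. -/

/-- The coordinate phase space `T*ℝ⁴`. -/
abbrev Phase : Type := R4 × R4

section Symbols

/-- `∂/∂x^μ` of a function on phase space. -/
def partX {F : Type*} [NormedAddCommGroup F] [NormedSpace ℝ F] (μ : Fin 4) (f : Phase → F)
    (z : Phase) : F := fderiv ℝ f z (stdVec μ, 0)

/-- `∂/∂ξ_μ` of a function on phase space. -/
def partXi {F : Type*} [NormedAddCommGroup F] [NormedSpace ℝ F] (μ : Fin 4) (f : Phase → F)
    (z : Phase) : F := fderiv ℝ f z (0, stdVec μ)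

/-- `∂/∂x^μ` of a matrix-valued function, entry by entry. -/
def matX (μ : Fin 4) (p : Phase → SpinMat) (z : Phase) : SpinMat :=
  Matrix.of fun c d => partX μ (fun z' => p z' c d) z

/-- `∂/∂ξ_μ` of a matrix-valued function, entry by entry. -/
def matXi (μ : Fin 4) (p : Phase → SpinMat) (z : Phase) : SpinMat :=
  Matrix.of fun c d => partXi μ (fun z' => p z' c d) z

/-- The Hamiltonian vector field `H_q = ∑ ∂q/∂ξ_μ ∂/∂x^μ - ∑ ∂q/∂x^μ ∂/∂ξ_μ`, as the pair of its
`x`- and `ξ`-components. -/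
def hamVec (q : Phase → ℝ) (z : Phase) : Phase :=
  (∑ μ, partXi μ q z • stdVec μ, -∑ μ, partX μ q z • stdVec μ)

/-- The Poisson bracket `{p̃, p} = ∑ ∂p̃/∂ξ_μ ∂p/∂x^μ - ∑ ∂p̃/∂x^μ ∂p/∂ξ_μ` of matrix symbols. -/
def poisson (pt p : Phase → SpinMat) (z : Phase) : SpinMat :=
  ∑ μ, matXi μ pt z * matX μ p z - ∑ μ, matX μ pt z * matXi μ p z

/-- The principal symbol `∑ a^μ (i ξ_μ)` of `∑ a^μ ∂_μ + b`; the full symbol is this plus `b`. -/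
def principalSymbol (a : Fin 4 → R4 → SpinMat) (z : Phase) : SpinMat :=
  ∑ μ, (Complex.I * ((z.2 μ : ℝ) : ℂ)) • a μ z.1

/-- The subprincipal symbol `p^s = p_{m-1} - (1/2i) ∑ ∂²p/∂x^μ∂ξ_μ`. -/
def subprincipal (p pLow : Phase → SpinMat) (z : Phase) : SpinMat :=
  pLow z - (1 / (2 * Complex.I)) • ∑ μ, matX μ (matXi μ p) z

/-- The subprincipal symbol of the operator `∑ a^μ ∂_μ + b`. -/
def subprincipalSymbol (a : Fin 4 → R4 → SpinMat) (b : R4 → SpinMat) : Phase → SpinMat :=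
  subprincipal (principalSymbol a) (fun z => b z.1)

/-- `f` is a scalar symbol of degree `k` on `O`: smooth and positively homogeneous in `ξ`. -/
def IsSymbol {F : Type*} [NormedAddCommGroup F] [NormedSpace ℝ F] (k : ℝ) (f : Phase → F)
    (O : Set Phase) : Prop :=
  ContDiffOn ℝ ∞ f O ∧ ∀ z ∈ O, ∀ t : ℝ, 0 < t → f (z.1, t • z.2) = t ^ k • f z

/-- The scalar real symbol `q` is of real principal type on `O`: where `q = 0`, the Hamiltonian
vector field has a nonzero `x`-component, so that it neither vanishes nor is radial. -/
def IsScalarRealPrincipalType (q : Phase → ℝ) (O : Set Phase) : Prop :=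
  ∀ z ∈ O, q z = 0 → (hamVec q z).1 ≠ 0

/-- The symbols `p̃` and `q` show on the open conic set `O ⊆ T*ℝ⁴ \ 0` that a system with principal
symbol `p` is of real principal type: `p̃ p = q · 1` with `q` scalar of real principal type. -/
structure IsRealPrincipalTypeVia (p pt : Phase → SpinMat) (q : Phase → ℝ) (O : Set Phase) :
    Prop where
  isOpen : IsOpen O
  conic : ∀ z ∈ O, ∀ t : ℝ, 0 < t → (z.1, t • z.2) ∈ O
  ne_zero : ∀ z ∈ O, z.2 ≠ 0
  symbol_pt : ∃ k : ℝ, ∀ c d, IsSymbol k (fun z => pt z c d) O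
  symbol_q : ∃ k : ℝ, IsSymbol k q O
  mul_eq : ∀ z ∈ O, pt z * p z = ((q z : ℝ) : ℂ) • (1 : SpinMat)
  scalar : IsScalarRealPrincipalType q O

/-- A system with principal symbol `p` is of real principal type at the point `z` of `T*ℝ⁴ \ 0`. -/
def IsRealPrincipalTypeAt (p : Phase → SpinMat) (z : Phase) : Prop :=
  ∃ (pt : Phase → SpinMat) (q : Phase → ℝ) (O : Set Phase),
    z ∈ O ∧ IsRealPrincipalTypeVia p pt q O

/-- Dencker's connection `D_P w = H_q w + ½ {p̃, p} w + i p̃ p^s w` on sections `w(x, ξ)`. -/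
def dencker (p pt : Phase → SpinMat) (q : Phase → ℝ) (ps : Phase → SpinMat) (w : Phase → Spinor)
    (z : Phase) : Spinor :=
  fderiv ℝ w z (hamVec q z) + (1 / 2 : ℂ) • (poisson pt p z).mulVec (w z)
    + Complex.I • (pt z * ps z).mulVec (w z)

/-- Dencker's connection on sections `w(τ)` along a curve `c(τ)` in phase space, which is a
bicharacteristic of `q`: there `H_q w = dw/dτ`. -/
def denckerAlong (p pt ps : Phase → SpinMat) (c : ℝ → Phase) (w : ℝ → Spinor) (τ : ℝ) : Spinor :=
  deriv w τ + (1 / 2 : ℂ) • (poisson pt p (c τ)).mulVec (w τ)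
    + Complex.I • (pt (c τ) * ps (c τ)).mulVec (w τ)

/-- The connection `∂_μ + σ_μ` pulled back to phase space along `(x, ξ) ↦ x`:
`(π*∇)_V w = dw(V) + V^μ σ_μ w` for a tangent vector `V` of phase space. -/
def pullbackConn (σ : Fin 4 → R4 → SpinMat) (w : Phase → Spinor) (z V : Phase) : Spinor :=
  fderiv ℝ w z V + ∑ μ, ((V.1 μ : ℝ) : ℂ) • (σ μ z.1).mulVec (w z)

/-- The connection `∂_μ + σ_μ` on sections `w(τ)` along a curve `x(τ)`:
`∇_τ w = dw/dτ + ẋ^μ σ_μ w`. -/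
def connAlong (σ : Fin 4 → R4 → SpinMat) (x : ℝ → R4) (w : ℝ → Spinor) (τ : ℝ) : Spinor :=
  deriv w τ + ∑ μ, ((deriv x τ μ : ℝ) : ℂ) • (σ μ (x τ)).mulVec (w τ)

/-- The points `(x, ξ)` with `x ∈ V` and `ξ ≠ 0`. -/
def coneOver (V : Set R4) : Set Phase := {z | z.1 ∈ V ∧ z.2 ≠ 0}

/-- `c : I → T*V \ 0` is a null bicharacteristic of `q` whose parameter runs with the speed `f`
(`f = 1`: an integral curve of `H_q`). -/
structure IsNullBichar (q : Phase → ℝ) (V : Set R4) (f : ℝ → ℝ) (c : ℝ → Phase) (I : Set ℝ) :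
    Prop where
  mem : ∀ τ ∈ I, c τ ∈ coneOver V
  null : ∀ τ ∈ I, q (c τ) = 0
  hasDerivAt : ∀ τ ∈ I, HasDerivAt c (f τ • hamVec q (c τ)) τ

/-- Over `V`, Dencker's connection for the system with principal symbol `p` and subprincipal symbol
`ps`, formed with `p̃` and `q`, acts on the kernel of `p` as the connection `∂_μ + σ_μ` lifted to
phase space and restricted to the null bicharacteristics of `q`; this is stated both for sections
over phase space and for sections along a single null bicharacteristic. -/
structure DenckerEqLift (p pt : Phase → SpinMat) (q : Phase → ℝ) (ps : Phase → SpinMat)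
    (σ : Fin 4 → R4 → SpinMat) (V : Set R4) : Prop where
  section_eq : ∀ (w : Phase → Spinor) (z : Phase), z ∈ coneOver V → q z = 0 →
    DifferentiableAt ℝ w z → (p z).mulVec (w z) = 0 →
      dencker p pt q ps w z = pullbackConn σ w z (hamVec q z)
  along_eq : ∀ (I : Set ℝ) (c : ℝ → Phase), IsOpen I → IsNullBichar q V (fun _ => 1) c I →
    ∀ (w : ℝ → Spinor), ∀ τ ∈ I, DifferentiableAt ℝ w τ → (p (c τ)).mulVec (w τ) = 0 →
      denckerAlong p pt ps c w τ = connAlong σ (fun t => (c t).1) w τ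

end Symbols

section Spacetime

variable {M : Type*} [TopologicalSpace M] [ChartedSpace R4 M] [IsManifold (𝓡 4) ∞ M]

/-- The operator `P` on sections of the bundle is a first order differential operator which is of
real principal type (on all of `T*M \ 0`): this holds for its principal symbol in all local
coordinates and local frames. -/
def IsRealPrincipalType {ι : Type*} {Z : VectorBundleCore ℂ M Spinor ι} (P : Sec Z → Sec Z) :
    Prop :=
  ∀ φ ∈ IsManifold.maximalAtlas (𝓡 4) ∞ M, ∀ (U : Set M), U ⊆ φ.source →
    ∀ s : SpinIdx → Sec Z, IsFrameOn s U →
      ∃ a b, HasLocalForm P φ s U a b ∧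
        ∀ z ∈ coneOver (φ '' U), IsRealPrincipalTypeAt (principalSymbol a) z

/-- `q = √(-g) g^{μν} ξ_μ ξ_ν` in local coordinates. -/
def nullSymbol (g : LorentzMetric M) (φ : Chart M) (z : Phase) : ℝ :=
  sqrtNegDet g φ z.1 * ∑ μ, ∑ ν, (metricMat g φ z.1)⁻¹ μ ν * z.2 μ * z.2 ν

variable {g : LorentzMetric M} (S : SpinStructure g)

/-- `ξ̸ = ∑ ξ_μ γ^μ` in local coordinates and a local frame of the Dirac bundle, where `γ^μ` is
Clifford multiplication by `dx^μ`. -/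
def slashLocal (φ : Chart M) (s : SpinIdx → Sec S.diracBundle) (z : Phase) : SpinMat :=
  ∑ μ, ((z.2 μ : ℝ) : ℂ) • inFrame s (φ.symm z.1)
    (S.slash (S.indexAt (φ.symm z.1)) (φ.symm z.1) (coordCovec φ μ (φ.symm z.1)))

/-- The action `v ↦ v ξ̸` on cospinors in local coordinates and a local frame of the dual bundle. -/
def coslashLocal (φ : Chart M) (s : SpinIdx → Sec S.codiracBundle) (z : Phase) : SpinMat :=
  ∑ μ, ((z.2 μ : ℝ) : ℂ) • inFrame s (φ.symm z.1)
    (S.slash (S.indexAt (φ.symm z.1)) (φ.symm z.1) (coordCovec φ μ (φ.symm z.1))).transpose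

end Spacetime

end

/-! ## Dirac matrices -/

/-! In a chart and a local frame both operators take the form `-i γ^μ (∂_μ + σ_μ) + m`, where the
`γ^μ` satisfy the Clifford relations for the inverse metric. So `p = ξ_μ γ^μ`, and `p² = g^{μν} ξ_μ
ξ_ν`; multiplying by `√(-g)` gives `p̃` and `q`. Nondegeneracy of the metric makes the `x`-part `2
√(-g) g^{μν} ξ_ν` of `H_q` nonzero for every `ξ ≠ 0`.

Dencker's connection is computed from the fact that the Dirac matrices are parallel: `∂_μ γ^ν =
[γ^ν, σ_μ] - Γ^ν_{μλ} γ^λ`. When this is inserted into `½ {p̃, p} + i p̃ p^s`, the Christoffel terms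
of the bracket cancel because `Γ` is symmetric. The trace `Γ^μ_{μλ} = ∂_λ log √(-g)` in the
subprincipal symbol cancels the derivative of the factor `√(-g)` in `p̃`, which is why this density
is the right normalization. By the Clifford relations the commutator terms equal `ẋ^μ σ_μ` plus a
matrix with right factor `p`, and the mass contributes another multiple of `p`. On `ker p` only `ẋ^μ
σ_μ` is left. This is `clifford_connection_identity`, `dencker_matrix_identity` and
`IsDiracType.dencker_zeroth_order`.

Parallelism comes from the Koszul formula in coordinates (`leviCivita_eq`, `fderiv_vielbein`)
together with the fact that the commutator with `¼ ω_ab γ^a γ^b` is the infinitesimal rotation `ω`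
(`commutator_spinForm`, `gammaField_parallel`); `parallel_conj` carries it to an arbitrary local
frame. The preferred spin frame may jump from point to point, so smoothness of `σ_μ` needs its
independence of the spin frame. Parallelism fixes the commutators of `σ_μ` with all `γ^ν`,
irreducibility leaves a scalar ambiguity, and the trace removes it (`IsSpinBundle.localConn_eq`);
the transition functions are never differentiated.

With `C^a = -(γ^a)ᵀ` acting on columns, the dual operator `i∇̸ + m` is again `-i C^a D_a + m`, so
`IsSpinBundle` covers both bundles at once.

For the bicharacteristics, `g_{μν} ẋ^ν = 2 √(-g) ξ_μ`. Differentiating this and using Hamilton's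
equations on `q = 0` gives `∇_ẋ ẋ = (d/dτ log √(-g)) ẋ`. Conversely, if `∇_ẋ ẋ = k ẋ`, the covector
`h g_{μν} ẋ^ν` with `h' = -k h` solves Hamilton's equations up to a change of speed. -/

lemma minkowski_of_ne {a b : Fin 4} (h : a ≠ b) : minkowski a b = 0 := by
  simp [minkowski, h]

lemma minkowski_sq (a : Fin 4) : minkowski a a * minkowski a a = 1 := by
  by_cases h : a = 0 <;> simp [minkowski, h]

/-- In size two the adjugate fixes the identity and negates traceless matrices. Writing the lower
blocks of the Dirac matrices as adjugates derives their algebra from `X adj X = det X` and the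
multiplicativity of `adj`. -/
lemma adjugate_pauli (a : Fin 4) :
    (if a = 0 then pauli a else -pauli a) = (pauli a).adjugate := by
  fin_cases a <;> ext i j <;> fin_cases i <;> fin_cases j <;>
    simp [pauli, Matrix.adjugate_fin_two]

lemma pauli_conjTranspose (a : Fin 4) : (pauli a).conjTranspose = pauli a := by
  fin_cases a <;> ext i j <;> fin_cases i <;> fin_cases j <;>
    simp [pauli, Matrix.conjTranspose_apply]

/-- Polarization of `X adj X = det X`: on combinations of the Pauli matrices the determinant is the
Minkowski quadratic form. -/
lemma pauli_mul_adjugate (a b : Fin 4) :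
    pauli a * (pauli b).adjugate + pauli b * (pauli a).adjugate =
      ((2 * minkowski a b : ℝ) : ℂ) • (1 : Matrix (Fin 2) (Fin 2) ℂ) := by
  fin_cases a <;> fin_cases b <;> ext i j <;> fin_cases i <;> fin_cases j <;>
    simp [pauli, Matrix.adjugate_fin_two, minkowski] <;> norm_num

lemma adjugate_mul_pauli (a b : Fin 4) :
    (pauli a).adjugate * pauli b + (pauli b).adjugate * pauli a =
      ((2 * minkowski a b : ℝ) : ℂ) • (1 : Matrix (Fin 2) (Fin 2) ℂ) := by
  fin_cases a <;> fin_cases b <;> ext i j <;> fin_cases i <;> fin_cases j <;>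
    simp [pauli, Matrix.adjugate_fin_two, minkowski] <;> norm_num

lemma diracGamma_eq (a : Fin 4) :
    diracGamma a = Matrix.fromBlocks 0 (pauli a) (pauli a).adjugate 0 := by
  rw [diracGamma, adjugate_pauli]

/-- The relations `{γᵃ, γᵇ} = 2 ηᵃᵇ`. -/
def IsClifford (C : Fin 4 → SpinMat) : Prop :=
  ∀ a b, C a * C b + C b * C a = ((2 * minkowski a b : ℝ) : ℂ) • (1 : SpinMat)

/-- Only scalar matrices commute with all the matrices `C a`. -/
def HasScalarCommutant (C : Fin 4 → SpinMat) : Prop :=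
  ∀ B : SpinMat, (∀ a, B * C a = C a * B) → ∃ c : ℂ, B = c • 1

lemma isClifford_diracGamma : IsClifford diracGamma := by
  intro a b
  simp only [diracGamma_eq, Matrix.fromBlocks_multiply, Matrix.fromBlocks_add, zero_mul, mul_zero,
    zero_add, add_zero]
  rw [pauli_mul_adjugate, adjugate_mul_pauli, ← Matrix.fromBlocks_one, Matrix.fromBlocks_smul]
  simp

/-- Irreducibility of the Dirac representation, in the form of Schur's lemma. It later determines
the connection matrices up to a scalar from their commutators. -/
lemma hasScalarCommutant_diracGamma : HasScalarCommutant diracGamma := by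
  intro B hB
  have h (a : Fin 4) (c d : SpinIdx) := congrFun (congrFun (hB a) c) d
  simp only [Matrix.mul_apply, Fintype.sum_sum_type, Fin.sum_univ_two, diracGamma_eq] at h
  have h0 := h 0
  have h1 := h 1
  have h2 := h 2
  have h3 := h 3
  clear h hB
  simp [pauli, Matrix.adjugate_fin_two] at h0 h1 h2 h3
  have hI := Complex.I_mul_I
  refine ⟨B (.inl 0) (.inl 0), ?_⟩
  ext c d
  rcases c with c | c <;> rcases d with d | d <;> fin_cases c <;> fin_cases d <;>
    simp <;> grind

/-- Transposition reverses the products in a relation that is symmetric in its two factors, and the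
signs square away. The Clifford relations do not force the sign; it is there to turn `i∇̸` on
cospinors into `-i C^a D_a`. -/
lemma IsClifford.neg_transpose {C : Fin 4 → SpinMat} (h : IsClifford C) :
    IsClifford fun a => -(C a).transpose := by
  intro a b
  have := congrArg Matrix.transpose (h a b)
  simp only [Matrix.transpose_add, Matrix.transpose_mul, Matrix.transpose_smul,
    Matrix.transpose_one] at this
  rw [← this]
  simp only [Matrix.neg_mul, Matrix.mul_neg, neg_neg]
  abel

lemma HasScalarCommutant.neg_transpose {C : Fin 4 → SpinMat} (h : HasScalarCommutant C) :
    HasScalarCommutant fun a => -(C a).transpose := by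
  intro B hB
  obtain ⟨c, hc⟩ := h B.transpose fun a => by
    have := congrArg Matrix.transpose (hB a)
    simp only [Matrix.mul_neg, Matrix.neg_mul, Matrix.transpose_neg, Matrix.transpose_mul,
      Matrix.transpose_transpose, neg_inj] at this
    exact this.symm
  refine ⟨c, ?_⟩
  have := congrArg Matrix.transpose hc
  simpa using this

/-- A Hermitian `2 × 2` matrix is a real combination of the Pauli matrices. -/
lemma hermitian_eq_sum_pauli {X : Matrix (Fin 2) (Fin 2) ℂ} (hX : X.conjTranspose = X) :
    X = ∑ b, (((X * pauli b).trace.re / 2 : ℝ) : ℂ) • pauli b := by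
  have h (i j : Fin 2) := congrFun (congrFun hX i) j
  simp only [Matrix.conjTranspose_apply] at h
  have h00 := h 0 0
  have h01 := h 0 1
  have h11 := h 1 1
  simp only [Complex.ext_iff, RCLike.star_def, Complex.conj_re, Complex.conj_im] at h00 h01 h11
  ext i j
  fin_cases i <;> fin_cases j <;>
  simp [Fin.sum_univ_four, pauli, Matrix.trace_fin_two, Matrix.mul_apply, Complex.ext_iff] <;>
  constructor <;> linarith

/-- `S* σ_a S` is Hermitian, hence a real combination of Pauli matrices. By cyclicity its
coefficients `½ tr (S* σ_a S σ_b)` are the traces that define `Λ(S)`. -/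
lemma conj_pauli_eq (A : Matrix.SpecialLinearGroup (Fin 2) ℂ) (a : Fin 4) :
    A.1.conjTranspose * pauli a * A.1 = ∑ b, ((lorentzOf A a b : ℝ) : ℂ) • pauli b := by
  rw [hermitian_eq_sum_pauli (X := A.1.conjTranspose * pauli a * A.1)]
  · refine Finset.sum_congr rfl fun b _ => ?_
    have : (A.1.conjTranspose * pauli a * A.1 * pauli b).trace =
        (pauli a * A.1 * pauli b * A.1.conjTranspose).trace := by
      rw [Matrix.mul_assoc, Matrix.mul_assoc, Matrix.trace_mul_comm]
      simp only [Matrix.mul_assoc]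
    rw [this]
    rfl
  · simp only [Matrix.conjTranspose_mul, Matrix.conjTranspose_conjTranspose, pauli_conjTranspose,
      Matrix.mul_assoc]

/-- The upper block is `conj_pauli_eq`. The lower block is its adjugate, where `adj` passes through
the sum because it is linear in size two; `det S = 1` makes `adj S` the inverse of `S`. -/
lemma diracGamma_mul_spinRep (A : Matrix.SpecialLinearGroup (Fin 2) ℂ) (a : Fin 4) :
    diracGamma a * spinRep A =
      spinRep A * ∑ b, ((lorentzOf A a b : ℝ) : ℂ) • diracGamma b := by
  have h1 := conj_pauli_eq A a
  have hadj : ∀ X Y : Matrix (Fin 2) (Fin 2) ℂ, ∀ c : ℂ,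
      (X + c • Y).adjugate = X.adjugate + c • Y.adjugate := by
    intro X Y c
    ext i j
    fin_cases i <;> fin_cases j <;> simp [Matrix.adjugate_fin_two, add_comm]
  have h2 : A.1.adjugate * (pauli a).adjugate * A.1.conjTranspose.adjugate =
      ∑ b, ((lorentzOf A a b : ℝ) : ℂ) • (pauli b).adjugate := by
    have := congrArg Matrix.adjugate h1
    rw [Matrix.adjugate_mul_distrib, Matrix.adjugate_mul_distrib, ← Matrix.mul_assoc] at this
    rw [this]
    have e : ∑ b, ((lorentzOf A a b : ℝ) : ℂ) • pauli b =
      (((0 + ((lorentzOf A a 0 : ℝ) : ℂ) • pauli 0) + ((lorentzOf A a 1 : ℝ) : ℂ) • pauli 1) +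
        ((lorentzOf A a 2 : ℝ) : ℂ) • pauli 2) + ((lorentzOf A a 3 : ℝ) : ℂ) • pauli 3 := by
      simp [Fin.sum_univ_four]
    rw [e, hadj, hadj, hadj, hadj]
    simp [Fin.sum_univ_four]
  have e3 : ∑ b, ((lorentzOf A a b : ℝ) : ℂ) • diracGamma b =
      Matrix.fromBlocks 0 (∑ b, ((lorentzOf A a b : ℝ) : ℂ) • pauli b)
        (∑ b, ((lorentzOf A a b : ℝ) : ℂ) • (pauli b).adjugate) 0 := by
    simp [diracGamma_eq, Fin.sum_univ_four, Matrix.fromBlocks_smul, Matrix.fromBlocks_add]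
  rw [e3, ← h1, ← h2, diracGamma_eq, spinRep, Matrix.fromBlocks_multiply,
    Matrix.fromBlocks_multiply]
  have d1 : A.1 * A.1.adjugate = 1 := by rw [Matrix.mul_adjugate, A.2, one_smul]
  have d2 : A.1.adjugate.conjTranspose * A.1.conjTranspose = 1 := by
    rw [← Matrix.conjTranspose_mul, d1, Matrix.conjTranspose_one]
  have d3 : A.1.conjTranspose.adjugate = A.1.adjugate.conjTranspose :=
    (Matrix.adjugate_conjTranspose _).symm
  simp only [Matrix.SpecialLinearGroup.coe_inv, zero_mul, mul_zero, zero_add, add_zero]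
  congr 1
  · rw [← Matrix.mul_assoc, ← Matrix.mul_assoc, d2, Matrix.one_mul]
  · rw [← Matrix.mul_assoc, ← Matrix.mul_assoc, d1, Matrix.one_mul, d3]

lemma det_spinRep (A : Matrix.SpecialLinearGroup (Fin 2) ℂ) : (spinRep A).det = 1 := by
  rw [spinRep, Matrix.det_fromBlocks_zero₂₁, Matrix.det_conjTranspose, A.2, (A⁻¹).2]
  simp

/-! ## Entrywise calculus of matrix-valued functions -/

section EntryCalculus

variable {E : Type*} [NormedAddCommGroup E] [NormedSpace ℝ E]
  {𝕜 : Type*} [NormedField 𝕜] [NormedAlgebra ℝ 𝕜] {l m n : Type*}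

/-- The directional derivative of a matrix-valued function, entry by entry. -/
noncomputable def entryDeriv (A : E → Matrix m n 𝕜) (y v : E) : Matrix m n 𝕜 :=
  Matrix.of fun c d => fderiv ℝ (fun z => A z c d) y v

/-- All entries of the matrix-valued function are differentiable at the point. -/
def EntryDiffAt (A : E → Matrix m n 𝕜) (y : E) : Prop :=
  ∀ c d, DifferentiableAt ℝ (fun z => A z c d) y

/-- All entries of the matrix-valued function are smooth at the point. -/
def EntrySmoothAt (A : E → Matrix m n 𝕜) (y : E) : Prop :=
  ∀ c d, ContDiffAt ℝ ∞ (fun z => A z c d) y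

lemma entryDeriv_apply (A : E → Matrix m n 𝕜) (y v : E) (c : m) (d : n) :
    entryDeriv A y v c d = fderiv ℝ (fun z => A z c d) y v := rfl

lemma EntrySmoothAt.entryDiffAt {A : E → Matrix m n 𝕜} {y : E} (h : EntrySmoothAt A y) :
    EntryDiffAt A y := fun c d => (h c d).differentiableAt (by simp)

lemma EntrySmoothAt.congr {A B : E → Matrix m n 𝕜} {y : E} (h : EntrySmoothAt A y)
    (hAB : B =ᶠ[𝓝 y] A) : EntrySmoothAt B y := fun c d =>
  (h c d).congr_of_eventuallyEq (hAB.mono fun z hz => by simp only [hz])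

lemma entryDeriv_congr {A B : E → Matrix m n 𝕜} {y : E} (hAB : A =ᶠ[𝓝 y] B) (v : E) :
    entryDeriv A y v = entryDeriv B y v := by
  ext c d
  have : (fun z => A z c d) =ᶠ[𝓝 y] fun z => B z c d := hAB.mono fun z hz => by simp only [hz]
  rw [entryDeriv_apply, entryDeriv_apply, this.fderiv_eq]

lemma entryDeriv_const (A : Matrix m n 𝕜) (y v : E) : entryDeriv (fun _ => A) y v = 0 := by
  ext c d; simp [entryDeriv_apply]

lemma entryDeriv_smul {f : E → 𝕜} {A : E → Matrix m n 𝕜} {y : E} (hf : DifferentiableAt ℝ f y)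
    (hA : EntryDiffAt A y) (v : E) :
    entryDeriv (fun z => f z • A z) y v = f y • entryDeriv A y v + fderiv ℝ f y v • A y := by
  ext c d
  simp only [entryDeriv_apply, Matrix.smul_apply, smul_eq_mul, Matrix.add_apply]
  rw [fderiv_fun_mul hf (hA c d)]
  simp [mul_comm]

lemma entryDeriv_sum {ι : Type*} (s : Finset ι) {A : ι → E → Matrix m n 𝕜} {y : E}
    (hA : ∀ i ∈ s, EntryDiffAt (A i) y) (v : E) :
    entryDeriv (fun z => ∑ i ∈ s, A i z) y v = ∑ i ∈ s, entryDeriv (A i) y v := by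
  ext c d
  simp only [entryDeriv_apply, Matrix.sum_apply]
  rw [fderiv_fun_sum fun i hi => hA i hi c d]
  simp

lemma EntryDiffAt.smul {f : E → 𝕜} {A : E → Matrix m n 𝕜} {y : E} (hf : DifferentiableAt ℝ f y)
    (hA : EntryDiffAt A y) : EntryDiffAt (fun z => f z • A z) y := fun c d => hf.mul (hA c d)

lemma EntrySmoothAt.const (A : Matrix m n 𝕜) (y : E) : EntrySmoothAt (fun _ => A) y :=
  fun _ _ => contDiffAt_const

lemma EntrySmoothAt.add {A B : E → Matrix m n 𝕜} {y : E} (hA : EntrySmoothAt A y)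
    (hB : EntrySmoothAt B y) : EntrySmoothAt (fun z => A z + B z) y :=
  fun c d => (hA c d).add (hB c d)

lemma EntrySmoothAt.smul {f : E → 𝕜} {A : E → Matrix m n 𝕜} {y : E} (hf : ContDiffAt ℝ ∞ f y)
    (hA : EntrySmoothAt A y) : EntrySmoothAt (fun z => f z • A z) y := fun c d => hf.mul (hA c d)

lemma EntrySmoothAt.sum {ι : Type*} {s : Finset ι} {A : ι → E → Matrix m n 𝕜} {y : E}
    (hA : ∀ i ∈ s, EntrySmoothAt (A i) y) : EntrySmoothAt (fun z => ∑ i ∈ s, A i z) y := by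
  intro c d
  simp only [Matrix.sum_apply]
  exact ContDiffAt.sum fun i hi => hA i hi c d

lemma EntrySmoothAt.entryDeriv {A : E → Matrix m n 𝕜} {y : E} (hA : EntrySmoothAt A y) (v : E) :
    EntrySmoothAt (fun z => entryDeriv A z v) y := fun c d =>
  ((hA c d).fderiv_right (m := ∞) (by simp)).clm_apply contDiffAt_const

lemma EntrySmoothAt.comp {E' : Type*} [NormedAddCommGroup E'] [NormedSpace ℝ E']
    {A : E → Matrix m n 𝕜} {f : E' → E} {y : E'} (hA : EntrySmoothAt A (f y))
    (hf : ContDiffAt ℝ ∞ f y) : EntrySmoothAt (fun z => A (f z)) y := fun c d =>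
  (hA c d).comp y hf

variable [Fintype m]

lemma entryDeriv_mul {A : E → Matrix l m 𝕜} {B : E → Matrix m n 𝕜} {y : E} (hA : EntryDiffAt A y)
    (hB : EntryDiffAt B y) (v : E) :
    entryDeriv (fun z => A z * B z) y v = entryDeriv A y v * B y + A y * entryDeriv B y v := by
  ext c d
  simp only [entryDeriv_apply, Matrix.mul_apply, Matrix.add_apply]
  rw [fderiv_fun_sum fun i _ => (hA c i).fun_mul (hB i d), ← Finset.sum_add_distrib,
    _root_.sum_apply]
  refine Finset.sum_congr rfl fun i _ => ?_
  rw [fderiv_fun_mul (hA c i) (hB i d)]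
  simp only [_root_.add_apply, _root_.smul_apply, smul_eq_mul]
  ring

lemma EntrySmoothAt.mul {A : E → Matrix l m 𝕜} {B : E → Matrix m n 𝕜} {y : E}
    (hA : EntrySmoothAt A y) (hB : EntrySmoothAt B y) : EntrySmoothAt (fun z => A z * B z) y := by
  intro c d
  simp only [Matrix.mul_apply]
  exact ContDiffAt.sum fun i _ => (hA c i).mul (hB i d)

variable [DecidableEq m]

lemma EntrySmoothAt.det {A : E → Matrix m m 𝕜} {y : E} (hA : EntrySmoothAt A y) :
    ContDiffAt ℝ ∞ (fun z => (A z).det) y := by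
  simp only [Matrix.det_apply']
  exact ContDiffAt.sum fun σ _ => contDiffAt_const.mul (contDiffAt_prod fun i _ => hA (σ i) i)

lemma EntrySmoothAt.adjugate {A : E → Matrix m m 𝕜} {y : E} (hA : EntrySmoothAt A y) :
    EntrySmoothAt (fun z => (A z).adjugate) y := by
  intro c d
  simp only [Matrix.adjugate_apply]
  refine EntrySmoothAt.det fun i j => ?_
  by_cases h : i = d
  · subst h; simp only [Matrix.updateRow_self]; exact contDiffAt_const
  · simp only [Matrix.updateRow_ne h]; exact hA i j

lemma EntrySmoothAt.inv {A : E → Matrix m m 𝕜} {y : E} (hA : EntrySmoothAt A y)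
    (hy : IsUnit (A y).det) : EntrySmoothAt (fun z => (A z)⁻¹) y := by
  simp only [Matrix.inv_def, Ring.inverse_eq_inv']
  exact EntrySmoothAt.smul (hA.det.inv hy.ne_zero) hA.adjugate

/-- Differentiate `A⁻¹ A = 1`, which holds in a neighbourhood because the determinant stays nonzero
there. -/
lemma entryDeriv_inv {A : E → Matrix m m 𝕜} {y : E} (hA : EntrySmoothAt A y)
    (hy : IsUnit (A y).det) (v : E) :
    entryDeriv (fun z => (A z)⁻¹) y v = -((A y)⁻¹ * entryDeriv A y v * (A y)⁻¹) := by
  have h1 : (fun z => (A z)⁻¹ * A z) =ᶠ[𝓝 y] fun _ => 1 := by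
    filter_upwards [hA.det.continuousAt.eventually_ne hy.ne_zero] with z hz
    exact Matrix.nonsing_inv_mul _ (isUnit_iff_ne_zero.2 hz)
  have h2 := entryDeriv_congr h1 v
  rw [entryDeriv_mul (hA.inv hy).entryDiffAt hA.entryDiffAt, entryDeriv_const] at h2
  have h3 := congrArg (· * (A y)⁻¹) (eq_neg_of_add_eq_zero_left h2)
  simpa [Matrix.mul_assoc, Matrix.mul_nonsing_inv _ hy] using h3

/-- Jacobi's formula for the derivative of a determinant. -/
lemma fderiv_det {A : E → Matrix m m 𝕜} {y : E} (hA : EntryDiffAt A y) (v : E) :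
    fderiv ℝ (fun z => (A z).det) y v = ((A y).adjugate * entryDeriv A y v).trace := by
  -- By Cramer's rule this diagonal entry is the determinant of `A` with its `i`-th column
  -- differentiated, that is, one summand of the product rule for the determinant.
  have key (i : m) : ((A y).adjugate * entryDeriv A y v) i i =
      ∑ σ : Equiv.Perm m, ((σ.sign : ℤ) : 𝕜) *
        ((∏ j ∈ Finset.univ.erase i, A y (σ j) j) * entryDeriv A y v (σ i) i) := by
    have : ((A y).adjugate * entryDeriv A y v) i i =
        ((A y).updateCol i fun k => entryDeriv A y v k i).det := by
      rw [← Matrix.cramer_apply, Matrix.cramer_eq_adjugate_mulVec]; rfl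
    rw [this, Matrix.det_apply']
    refine Finset.sum_congr rfl fun σ _ => ?_
    rw [← Finset.mul_prod_erase _ _ (Finset.mem_univ i), mul_comm (∏ _ ∈ _, _)]
    simp only [Matrix.updateCol_self]
    congr 2
    refine Finset.prod_congr rfl fun j hj => ?_
    rw [Matrix.updateCol_ne (Finset.ne_of_mem_erase hj)]
  simp only [Matrix.trace, Matrix.diag, key]
  rw [Finset.sum_comm]
  simp only [Matrix.det_apply']
  have h : HasFDerivAt (fun z => ∑ σ : Equiv.Perm m, ((σ.sign : ℤ) : 𝕜) * ∏ i, A z (σ i) i)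
      (∑ σ : Equiv.Perm m, ((σ.sign : ℤ) : 𝕜) • ∑ i, (∏ j ∈ Finset.univ.erase i, A y (σ j) j) •
        fderiv ℝ (fun z => A z (σ i) i) y) y :=
    HasFDerivAt.fun_sum fun σ _ => (HasFDerivAt.finsetProd fun i _ =>
      (hA (σ i) i).hasFDerivAt).const_mul _
  rw [h.fderiv, _root_.sum_apply]
  refine Finset.sum_congr rfl fun σ _ => ?_
  simp only [_root_.smul_apply, _root_.sum_apply, smul_eq_mul,
    Finset.mul_sum]
  rfl

lemma fderiv_det_of_isUnit {A : E → Matrix m m 𝕜} {y : E} (hA : EntryDiffAt A y)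
    (hy : IsUnit (A y).det) (v : E) :
    fderiv ℝ (fun z => (A z).det) y v = (A y).det * ((A y)⁻¹ * entryDeriv A y v).trace := by
  rw [fderiv_det hA, Matrix.inv_def, Ring.inverse_eq_inv', Matrix.smul_mul, Matrix.trace_smul,
    smul_eq_mul, mul_inv_cancel_left₀ hy.ne_zero]

end EntryCalculus

/-! ## Dencker's connection for operators of Dirac type over an open subset of `ℝ⁴` -/

section DiracType

/-- Coefficient matrices `γ^μ` over `V ⊆ ℝ⁴` which satisfy the Clifford relations for the inverse
metric `H` and are parallel for the connection `∂_μ + σ_μ` and a torsion free connection with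
coefficients `Γ` that preserves the density `r`. -/
structure IsDiracType (V : Set R4) (γ σ : Fin 4 → R4 → SpinMat)
    (H : R4 → Matrix (Fin 4) (Fin 4) ℝ) (r : R4 → ℝ) (Γ : R4 → Fin 4 → Fin 4 → Fin 4 → ℝ) :
    Prop where
  isOpen : IsOpen V
  smooth_γ : ∀ y ∈ V, ∀ μ, EntrySmoothAt (γ μ) y
  smooth_H : ∀ y ∈ V, EntrySmoothAt H y
  smooth_r : ∀ y ∈ V, ContDiffAt ℝ ∞ r y
  r_pos : ∀ y ∈ V, 0 < r y
  symm_H : ∀ y ∈ V, ∀ μ ν, H y μ ν = H y ν μ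
  isUnit_H : ∀ y ∈ V, IsUnit (H y).det
  clifford : ∀ y ∈ V, ∀ μ ν,
    γ μ y * γ ν y + γ ν y * γ μ y = ((2 * H y μ ν : ℝ) : ℂ) • (1 : SpinMat)
  parallel : ∀ y ∈ V, ∀ μ ν, entryDeriv (γ ν) y (stdVec μ) =
    γ ν y * σ μ y - σ μ y * γ ν y - ∑ l, ((Γ y ν μ l : ℝ) : ℂ) • γ l y
  symm_Γ : ∀ y ∈ V, ∀ κ μ ν, Γ y κ μ ν = Γ y κ ν μ
  trace_Γ : ∀ y ∈ V, ∀ l, r y * ∑ μ, Γ y μ μ l = fderiv ℝ r y (stdVec l)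

/-- The symbol `∑ ξ_μ γ^μ`. -/
def slashSymbol (γ : Fin 4 → R4 → SpinMat) (z : Phase) : SpinMat :=
  ∑ μ, ((z.2 μ : ℝ) : ℂ) • γ μ z.1

/-- The symbol `r H^{μν} ξ_μ ξ_ν`. -/
def quadSymbol (H : R4 → Matrix (Fin 4) (Fin 4) ℝ) (r : R4 → ℝ) (z : Phase) : ℝ :=
  r z.1 * ∑ μ, ∑ ν, H z.1 μ ν * z.2 μ * z.2 ν

lemma stdVec_apply (μ ν : Fin 4) : stdVec μ ν = if ν = μ then 1 else 0 := by
  simp [stdVec, PiLp.single_apply]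

lemma sum_smul_stdVec_apply (f : Fin 4 → ℝ) (ν : Fin 4) : (∑ μ, f μ • stdVec μ) ν = f ν := by
  simp [stdVec_apply]

lemma eq_sum_smul_stdVec (v : R4) : v = ∑ μ, v μ • stdVec μ := by
  ext ν
  rw [sum_smul_stdVec_apply]

lemma contDiff_coord (ν : Fin 4) : ContDiff ℝ ∞ fun v : R4 => v ν :=
  (EuclideanSpace.proj ν : R4 →L[ℝ] ℝ).contDiff

lemma contDiff_coord_ofReal (ν : Fin 4) : ContDiff ℝ ∞ fun v : R4 => ((v ν : ℝ) : ℂ) :=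
  Complex.ofRealCLM.contDiff.comp (contDiff_coord ν)

lemma fderiv_coord (ν : Fin 4) (x v : R4) : fderiv ℝ (fun u : R4 => u ν) x v = v ν := by
  have := (EuclideanSpace.proj ν : R4 →L[ℝ] ℝ).fderiv (x := x)
  exact congrArg (fun L : R4 →L[ℝ] ℝ => L v) this

lemma fderiv_ofReal_comp {E : Type*} [NormedAddCommGroup E] [NormedSpace ℝ E] {f : E → ℝ} {x : E}
    (hf : DifferentiableAt ℝ f x) (v : E) :
    fderiv ℝ (fun u => ((f u : ℝ) : ℂ)) x v = ((fderiv ℝ f x v : ℝ) : ℂ) := by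
  have := (Complex.ofRealCLM.hasFDerivAt.comp x hf.hasFDerivAt).fderiv
  exact congrArg (fun L : E →L[ℝ] ℂ => L v) this

lemma fderiv_coord_ofReal (ν : Fin 4) (x v : R4) :
    fderiv ℝ (fun u : R4 => ((u ν : ℝ) : ℂ)) x v = ((v ν : ℝ) : ℂ) := by
  rw [fderiv_ofReal_comp ((contDiff_coord ν).differentiable (by simp) x), fderiv_coord]

variable {F : Type*} [NormedAddCommGroup F] [NormedSpace ℝ F]

lemma partX_eq {f : Phase → F} {z : Phase} (hf : DifferentiableAt ℝ f z) (μ : Fin 4) :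
    partX μ f z = fderiv ℝ (fun x => f (x, z.2)) z.1 (stdVec μ) := by
  have h := HasFDerivAt.comp (f := fun x : R4 => (x, z.2)) z.1
    (show HasFDerivAt f (fderiv ℝ f z) (z.1, z.2) from hf.hasFDerivAt)
    ((hasFDerivAt_id z.1).prodMk (hasFDerivAt_const z.2 z.1))
  have h' := congrArg (fun L : R4 →L[ℝ] F => L (stdVec μ)) h.fderiv
  exact h'.symm

lemma partXi_eq {f : Phase → F} {z : Phase} (hf : DifferentiableAt ℝ f z) (μ : Fin 4) :
    partXi μ f z = fderiv ℝ (fun ξ => f (z.1, ξ)) z.2 (stdVec μ) := by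
  have h := HasFDerivAt.comp (f := fun ξ : R4 => (z.1, ξ)) z.2
    (show HasFDerivAt f (fderiv ℝ f z) (z.1, z.2) from hf.hasFDerivAt)
    ((hasFDerivAt_const z.1 z.2).prodMk (hasFDerivAt_id z.2))
  have h' := congrArg (fun L : R4 →L[ℝ] F => L (stdVec μ)) h.fderiv
  exact h'.symm

lemma matX_eq {p : Phase → SpinMat} {z : Phase} (hp : EntryDiffAt p z) (μ : Fin 4) :
    matX μ p z = entryDeriv (fun x => p (x, z.2)) z.1 (stdVec μ) := by
  ext c d
  exact partX_eq (hp c d) μ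

lemma matXi_eq {p : Phase → SpinMat} {z : Phase} (hp : EntryDiffAt p z) (μ : Fin 4) :
    matXi μ p z = entryDeriv (fun ξ => p (z.1, ξ)) z.2 (stdVec μ) := by
  ext c d
  exact partXi_eq (hp c d) μ

lemma contDiff_ofReal_coord_snd (μ : Fin 4) : ContDiff ℝ ∞ fun z : Phase => ((z.2 μ : ℝ) : ℂ) :=
  (contDiff_coord_ofReal μ).comp contDiff_snd

section Symbol

variable {γ : Fin 4 → R4 → SpinMat} {z : Phase}

lemma entrySmoothAt_slashSymbol (hγ : ∀ μ, EntrySmoothAt (γ μ) z.1) :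
    EntrySmoothAt (slashSymbol γ) z :=
  EntrySmoothAt.sum fun μ _ => .smul (contDiff_ofReal_coord_snd μ).contDiffAt
    ((hγ μ).comp contDiffAt_fst)

lemma matXi_slashSymbol (hγ : ∀ μ, EntrySmoothAt (γ μ) z.1) (μ : Fin 4) :
    matXi μ (slashSymbol γ) z = γ μ z.1 := by
  rw [matXi_eq (entrySmoothAt_slashSymbol hγ).entryDiffAt]
  have hd (ν : Fin 4) : DifferentiableAt ℝ (fun v : R4 => ((v ν : ℝ) : ℂ)) z.2 :=
    (contDiff_coord_ofReal ν).differentiable (by simp) _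
  have hc (ν : Fin 4) : EntryDiffAt (fun _ : R4 => γ ν z.1) z.2 :=
    (EntrySmoothAt.const _ _).entryDiffAt
  simp only [slashSymbol]
  rw [entryDeriv_sum _ fun ν _ => EntryDiffAt.smul (hd ν) (hc ν)]
  simp only [entryDeriv_smul (hd _) (hc _), entryDeriv_const, fderiv_coord_ofReal, stdVec_apply]
  simp

lemma matX_slashSymbol (hγ : ∀ μ, EntrySmoothAt (γ μ) z.1) (μ : Fin 4) :
    matX μ (slashSymbol γ) z = ∑ ν, ((z.2 ν : ℝ) : ℂ) • entryDeriv (γ ν) z.1 (stdVec μ) := by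
  rw [matX_eq (entrySmoothAt_slashSymbol hγ).entryDiffAt]
  have hd (ν : Fin 4) : DifferentiableAt ℝ (fun _ : R4 => ((z.2 ν : ℝ) : ℂ)) z.1 :=
    differentiableAt_const _
  simp only [slashSymbol]
  rw [entryDeriv_sum _ fun ν _ => EntryDiffAt.smul (hd ν) (hγ ν).entryDiffAt]
  refine Finset.sum_congr rfl fun ν _ => ?_
  rw [entryDeriv_smul (hd ν) (hγ ν).entryDiffAt]
  simp

/-- The term `∂²p/∂x^μ∂ξ_μ` of the subprincipal symbol. Since `∂p/∂ξ_μ = γ^μ` gets differentiated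
again, it has to be known near the point, hence the hypothesis on a neighbourhood. -/
lemma matX_matXi_slashSymbol (hγ : ∀ᶠ y in 𝓝 z.1, ∀ μ, EntrySmoothAt (γ μ) y) (μ : Fin 4) :
    matX μ (matXi μ (slashSymbol γ)) z = entryDeriv (γ μ) z.1 (stdVec μ) := by
  have h : matXi μ (slashSymbol γ) =ᶠ[𝓝 z] fun z => γ μ z.1 := by
    filter_upwards [continuousAt_fst.eventually hγ] with z' hz'
    exact matXi_slashSymbol hz' μ
  have h1 : matX μ (matXi μ (slashSymbol γ)) z = matX μ (fun z => γ μ z.1) z :=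
    entryDeriv_congr h _
  have h2 : EntryDiffAt (fun z : Phase => γ μ z.1) z :=
    ((hγ.self_of_nhds μ).comp contDiffAt_fst).entryDiffAt
  rw [h1, matX_eq h2]

variable {r : R4 → ℝ}

lemma contDiffAt_ofReal_comp {E : Type*} [NormedAddCommGroup E] [NormedSpace ℝ E] {f : E → ℝ}
    {x : E} (hf : ContDiffAt ℝ ∞ f x) : ContDiffAt ℝ ∞ (fun u => ((f u : ℝ) : ℂ)) x :=
  Complex.ofRealCLM.contDiff.contDiffAt.comp x hf

lemma entrySmoothAt_smul_slashSymbol (hγ : ∀ μ, EntrySmoothAt (γ μ) z.1)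
    (hr : ContDiffAt ℝ ∞ r z.1) :
    EntrySmoothAt (fun z : Phase => ((r z.1 : ℝ) : ℂ) • slashSymbol γ z) z :=
  .smul ((contDiffAt_ofReal_comp hr).comp z contDiffAt_fst) (entrySmoothAt_slashSymbol hγ)

lemma matXi_smul_slashSymbol (hγ : ∀ μ, EntrySmoothAt (γ μ) z.1) (hr : ContDiffAt ℝ ∞ r z.1)
    (μ : Fin 4) :
    matXi μ (fun z : Phase => ((r z.1 : ℝ) : ℂ) • slashSymbol γ z) z = (r z.1 : ℂ) • γ μ z.1 := by
  have h : EntryDiffAt (fun ξ => slashSymbol γ (z.1, ξ)) z.2 :=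
    (EntrySmoothAt.comp (f := fun ξ => (z.1, ξ)) (A := slashSymbol γ)
      (entrySmoothAt_slashSymbol (z := (z.1, z.2)) hγ)
      (contDiffAt_const.prodMk contDiffAt_id)).entryDiffAt
  rw [matXi_eq (entrySmoothAt_smul_slashSymbol hγ hr).entryDiffAt]
  simp only []
  rw [entryDeriv_smul (differentiableAt_const _) h,
    ← matXi_eq (entrySmoothAt_slashSymbol hγ).entryDiffAt, matXi_slashSymbol hγ]
  simp

/-- The second summand, from the derivative of the density, is the one that the trace of the
Christoffel symbols later cancels. -/
lemma matX_smul_slashSymbol (hγ : ∀ μ, EntrySmoothAt (γ μ) z.1) (hr : ContDiffAt ℝ ∞ r z.1)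
    (μ : Fin 4) :
    matX μ (fun z : Phase => ((r z.1 : ℝ) : ℂ) • slashSymbol γ z) z =
      (r z.1 : ℂ) • (∑ ν, ((z.2 ν : ℝ) : ℂ) • entryDeriv (γ ν) z.1 (stdVec μ)) +
        ((fderiv ℝ r z.1 (stdVec μ) : ℝ) : ℂ) • slashSymbol γ z := by
  have h : EntryDiffAt (fun x => slashSymbol γ (x, z.2)) z.1 :=
    (EntrySmoothAt.comp (f := fun x => (x, z.2)) (A := slashSymbol γ)
      (entrySmoothAt_slashSymbol (z := (z.1, z.2)) hγ)
      (contDiffAt_id.prodMk contDiffAt_const)).entryDiffAt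
  have hr' := hr.differentiableAt (by simp)
  have hrc := (contDiffAt_ofReal_comp hr).differentiableAt (by simp)
  rw [matX_eq (entrySmoothAt_smul_slashSymbol hγ hr).entryDiffAt]
  simp only []
  rw [entryDeriv_smul hrc h,
    ← matX_eq (entrySmoothAt_slashSymbol hγ).entryDiffAt, matX_slashSymbol hγ,
    fderiv_ofReal_comp hr']

lemma principalSymbol_slash : principalSymbol (fun μ y => -Complex.I • γ μ y) = slashSymbol γ := by
  funext z
  refine Finset.sum_congr rfl fun μ _ => ?_
  rw [smul_smul]
  congr 1
  linear_combination -((z.2 μ : ℝ) : ℂ) * Complex.I_mul_I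

end Symbol

section Quad

variable {H : R4 → Matrix (Fin 4) (Fin 4) ℝ} {r : R4 → ℝ} {z : Phase}

lemma contDiffAt_quadSymbol (hH : EntrySmoothAt H z.1) (hr : ContDiffAt ℝ ∞ r z.1) :
    ContDiffAt ℝ ∞ (quadSymbol H r) z := by
  have hc (μ : Fin 4) : ContDiffAt ℝ ∞ (fun z : Phase => z.2 μ) z :=
    ((contDiff_coord μ).comp contDiff_snd).contDiffAt
  exact (hr.comp z contDiffAt_fst).mul (ContDiffAt.sum fun μ _ => ContDiffAt.sum fun ν _ =>
    (((hH μ ν).comp z contDiffAt_fst).mul (hc μ)).mul (hc ν))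

lemma partXi_quadSymbol (hH : EntrySmoothAt H z.1) (hr : ContDiffAt ℝ ∞ r z.1)
    (hs : ∀ μ ν, H z.1 μ ν = H z.1 ν μ) (κ : Fin 4) :
    partXi κ (quadSymbol H r) z = 2 * r z.1 * ∑ ν, H z.1 κ ν * z.2 ν := by
  rw [partXi_eq ((contDiffAt_quadSymbol hH hr).differentiableAt (by simp))]
  have hc (μ : Fin 4) : HasFDerivAt (fun ξ : R4 => ξ μ) (EuclideanSpace.proj μ : R4 →L[ℝ] ℝ) z.2 :=
    (EuclideanSpace.proj μ : R4 →L[ℝ] ℝ).hasFDerivAt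
  have h : HasFDerivAt (fun ξ => quadSymbol H r (z.1, ξ)) _ z.2 :=
    (HasFDerivAt.fun_sum (u := Finset.univ) fun μ _ => HasFDerivAt.fun_sum (u := Finset.univ)
      fun ν _ => ((hc μ).const_mul (H z.1 μ ν)).fun_mul (hc ν)).const_mul (r z.1)
  rw [h.fderiv]
  simp only [_root_.smul_apply, _root_.sum_apply, _root_.add_apply, smul_eq_mul]
  have hp (μ : Fin 4) : (EuclideanSpace.proj μ : R4 →L[ℝ] ℝ) (stdVec κ) = if μ = κ then 1 else 0 :=
    stdVec_apply κ μ
  simp only [hp, mul_ite, mul_one, mul_zero, Finset.sum_add_distrib, Finset.sum_ite_eq',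
    Finset.mem_univ, if_true, Finset.sum_ite_irrel, Finset.sum_const_zero]
  have e1 : ∑ x, H z.1 x κ * z.2 x = ∑ ν, H z.1 κ ν * z.2 ν :=
    Finset.sum_congr rfl fun ν _ => by rw [hs]
  have e2 : ∑ x, z.2 x * H z.1 κ x = ∑ ν, H z.1 κ ν * z.2 ν :=
    Finset.sum_congr rfl fun ν _ => mul_comm _ _
  rw [e1, e2]
  ring

end Quad
end DiracType

/-! ### The cancellations in Dencker's connection for parallel Dirac matrices. -/

section DiracType

/-- After expansion the two `p σ γ` terms cancel. What is left is `½ (γ p + p γ) σ = h σ`, then `½ σ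
p γ = h σ - ½ σ γ p`, and `-½ γ σ p`; apart from `2 h σ` every term ends in `p`. -/
lemma clifford_connection_identity {γ p σ : SpinMat} {h : ℂ}
    (hγ : γ * p + p * γ = (2 * h) • (1 : SpinMat)) :
    (1 / 2 : ℂ) • (γ * (p * σ - σ * p)) - (1 / 2 : ℂ) • ((p * σ - σ * p) * γ) + p * (γ * σ)
      - (1 / 2 : ℂ) • (p * (γ * σ - σ * γ)) =
    (2 * h) • σ - (1 / 2 : ℂ) • ((σ * γ + γ * σ) * p) := by
  have h1 : p * γ = (2 * h) • (1 : SpinMat) - γ * p := by rw [← hγ]; abel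
  have h2 : p * (γ * σ) = (2 * h) • σ - γ * (p * σ) := by
    rw [← Matrix.mul_assoc, h1, Matrix.sub_mul, Matrix.smul_mul, Matrix.one_mul, Matrix.mul_assoc]
  have h3 : σ * (p * γ) = (2 * h) • σ - σ * (γ * p) := by
    rw [h1, Matrix.mul_sub, Matrix.mul_smul, Matrix.mul_one]
  simp only [Matrix.mul_sub, Matrix.sub_mul, Matrix.add_mul, Matrix.mul_assoc, h2, h3]
  module

/-- Exchanging the two summation indices turns one double sum into the other. In the application
this is how torsion-freeness removes the Christoffel symbols from the Poisson bracket. -/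
lemma sum_symm_commutator_eq_zero {γ : Fin 4 → SpinMat} {k : Fin 4 → Fin 4 → ℂ}
    (hk : ∀ μ l, k μ l = k l μ) :
    ∑ μ, (γ μ * ∑ l, k μ l • γ l) - ∑ μ, ((∑ l, k μ l • γ l) * γ μ) = 0 := by
  simp only [Finset.mul_sum, Finset.sum_mul, Matrix.mul_smul, Matrix.smul_mul]
  rw [sub_eq_zero, Finset.sum_comm]
  refine Finset.sum_congr rfl fun μ _ => Finset.sum_congr rfl fun l _ => ?_
  rw [hk]

/-- The algebraic identity behind the computation of Dencker's connection. -/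
lemma dencker_matrix_identity {γ σ : Fin 4 → SpinMat} {dγ : Fin 4 → Fin 4 → SpinMat}
    {Γ : Fin 4 → Fin 4 → Fin 4 → ℂ} {ξ h dr : Fin 4 → ℂ} {r m : ℂ} {p : SpinMat}
    (hp : p = ∑ ν, ξ ν • γ ν)
    (hγ : ∀ μ, γ μ * p + p * γ μ = (2 * h μ) • (1 : SpinMat))
    (hd : ∀ μ ν, dγ μ ν = γ ν * σ μ - σ μ * γ ν - ∑ l, Γ ν μ l • γ l)
    (hs : ∀ κ μ ν, Γ κ μ ν = Γ κ ν μ) (ht : ∀ l, r * ∑ μ, Γ μ μ l = dr l) :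
    (1 / 2 : ℂ) • (∑ μ, (r • γ μ) * (∑ ν, ξ ν • dγ μ ν)
        - ∑ μ, (r • (∑ ν, ξ ν • dγ μ ν) + dr μ • p) * γ μ)
      + Complex.I • ((r • p) * ((-Complex.I • ∑ μ, γ μ * σ μ) + m • (1 : SpinMat)
        - (1 / (2 * Complex.I)) • ∑ μ, dγ μ μ)) =
    ∑ μ, (2 * r * h μ) • σ μ +
      ((Complex.I * r * m) • (1 : SpinMat) - (r / 2) • ∑ μ, (σ μ * γ μ + γ μ * σ μ)) * p := by
  -- `K μ` is the Christoffel part of `∂_μ p`; its coefficients are symmetric in `μ` and `l`.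
  set K : Fin 4 → SpinMat := fun μ => ∑ l, (∑ ν, ξ ν * Γ ν μ l) • γ l with hK
  have e1 (μ : Fin 4) : ∑ ν, ξ ν • dγ μ ν = p * σ μ - σ μ * p - K μ := by
    simp only [hd, smul_sub, Finset.sum_sub_distrib, hp, Finset.sum_mul, Finset.mul_sum,
      Matrix.smul_mul, Matrix.mul_smul, hK, Finset.sum_smul, Finset.smul_sum, smul_smul]
    congr 1
    exact Finset.sum_comm
  -- In the divergence of `γ^μ` only the trace of `Γ` occurs, and `r` times that trace is the
  -- derivative of the density.
  have e2 : r • ∑ μ, dγ μ μ = r • ∑ μ, (γ μ * σ μ - σ μ * γ μ) - ∑ l, dr l • γ l := by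
    simp only [hd, Finset.sum_sub_distrib, smul_sub, ← ht]
    congr 1
    simp only [Finset.mul_sum, Finset.sum_smul, Finset.smul_sum, smul_smul]
    exact Finset.sum_comm
  have e3 : ∑ μ, γ μ * K μ - ∑ μ, K μ * γ μ = 0 :=
    sum_symm_commutator_eq_zero fun μ l => Finset.sum_congr rfl fun ν _ => by rw [hs]
  have e4 : ∑ μ, ((1 / 2 : ℂ) • (γ μ * (p * σ μ - σ μ * p))
      - (1 / 2 : ℂ) • ((p * σ μ - σ μ * p) * γ μ) + p * (γ μ * σ μ)
      - (1 / 2 : ℂ) • (p * (γ μ * σ μ - σ μ * γ μ))) =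
      ∑ μ, ((2 * h μ) • σ μ - (1 / 2 : ℂ) • ((σ μ * γ μ + γ μ * σ μ) * p)) :=
    Finset.sum_congr rfl fun μ _ => clifford_connection_identity (hγ μ)
  have e5 : (r • p) * ∑ μ, dγ μ μ =
      p * (r • ∑ μ, (γ μ * σ μ - σ μ * γ μ)) - ∑ l, dr l • (p * γ l) := by
    rw [Matrix.smul_mul, ← Matrix.mul_smul, e2, Matrix.mul_sub, Finset.mul_sum]
    simp only [Matrix.mul_smul]
  have hI : Complex.I * (1 / (2 * Complex.I)) = 1 / 2 := by
    field_simp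
  have e6 : Complex.I • ((r • p) * ((-Complex.I • ∑ μ, γ μ * σ μ) + m • (1 : SpinMat)
        - (1 / (2 * Complex.I)) • ∑ μ, dγ μ μ)) =
      r • (p * ∑ μ, γ μ * σ μ) + (Complex.I * r * m) • p - (1 / 2 : ℂ) •
        (p * (r • ∑ μ, (γ μ * σ μ - σ μ * γ μ)) - ∑ l, dr l • (p * γ l)) := by
    rw [Matrix.mul_sub, Matrix.mul_add, Matrix.mul_smul _ (1 / _), e5, smul_sub, smul_smul, hI,
      smul_add]
    simp only [Matrix.mul_smul, Matrix.smul_mul, smul_smul, Matrix.mul_one]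
    congr 2
    · congr 1
      linear_combination -r * Complex.I_mul_I
    · congr 1
      ring
  rw [e6]
  simp only [e1]
  -- The last term comes from the derivative of `r` in `∂_x p̃`. With the factor `½` of the bracket
  -- it is the negative of the `dr` term of `e6`.
  have e7 : ∑ μ, (r • γ μ) * (p * σ μ - σ μ * p - K μ)
        - ∑ μ, (r • (p * σ μ - σ μ * p - K μ) + dr μ • p) * γ μ =
      r • (∑ μ, γ μ * (p * σ μ - σ μ * p) - ∑ μ, (p * σ μ - σ μ * p) * γ μ)
        - r • (∑ μ, γ μ * K μ - ∑ μ, K μ * γ μ) - ∑ l, dr l • (p * γ l) := by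
    have a1 (μ : Fin 4) : (r • γ μ) * (p * σ μ - σ μ * p - K μ) =
        r • (γ μ * (p * σ μ - σ μ * p)) - r • (γ μ * K μ) := by
      rw [Matrix.mul_sub, Matrix.smul_mul, Matrix.smul_mul]
    have a2 (μ : Fin 4) : (r • (p * σ μ - σ μ * p - K μ) + dr μ • p) * γ μ =
        r • ((p * σ μ - σ μ * p) * γ μ) - r • (K μ * γ μ) + dr μ • (p * γ μ) := by
      rw [Matrix.add_mul, smul_sub, Matrix.sub_mul, Matrix.smul_mul, Matrix.smul_mul,
        Matrix.smul_mul]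
    simp only [a1, a2, Finset.sum_sub_distrib, Finset.sum_add_distrib, ← Finset.smul_sum]
    module
  rw [e7, e3]
  simp only [Finset.sum_sub_distrib, Finset.sum_add_distrib, ← Finset.smul_sum, ← Finset.mul_sum,
    ← Finset.sum_mul] at e4
  have e8 : ∑ μ, (2 * r * h μ) • σ μ = r • ∑ μ, (2 * h μ) • σ μ := by
    rw [Finset.smul_sum]
    refine Finset.sum_congr rfl fun μ _ => ?_
    rw [smul_smul]; congr 1; ring
  rw [e8]
  have e9 := congrArg (fun X => r • X) e4
  simp only [Finset.sum_sub_distrib, Finset.sum_add_distrib, Matrix.sub_mul, Matrix.smul_mul,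
    Matrix.one_mul, Matrix.mul_smul] at e9 ⊢
  linear_combination (norm := module) e9

variable {V : Set R4} {γ σ : Fin 4 → R4 → SpinMat} {H : R4 → Matrix (Fin 4) (Fin 4) ℝ}
  {r : R4 → ℝ} {Γ : R4 → Fin 4 → Fin 4 → Fin 4 → ℝ}

/-- The zeroth order term `-i γ^μ σ_μ + m` of the operator `-i γ^μ (∂_μ + σ_μ) + m`. -/
noncomputable def diracLow (γ σ : Fin 4 → R4 → SpinMat) (m : ℝ) (y : R4) : SpinMat :=
  (-Complex.I • ∑ μ, γ μ y * σ μ y) + (m : ℂ) • (1 : SpinMat)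

lemma gamma_mul_slash {y : R4} (hc : ∀ μ ν,
      γ μ y * γ ν y + γ ν y * γ μ y = ((2 * H y μ ν : ℝ) : ℂ) • (1 : SpinMat)) (ξ : R4)
    (μ : Fin 4) : γ μ y * slashSymbol γ (y, ξ) + slashSymbol γ (y, ξ) * γ μ y =
      (2 * ((∑ ν, H y μ ν * ξ ν : ℝ) : ℂ)) • (1 : SpinMat) := by
  simp only [slashSymbol, Finset.mul_sum, Finset.sum_mul, ← Finset.sum_add_distrib,
    Matrix.mul_smul, Matrix.smul_mul, ← smul_add, hc, smul_smul, ← Finset.sum_smul]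
  congr 1
  push_cast
  rw [Finset.mul_sum]
  exact Finset.sum_congr rfl fun ν _ => by ring

namespace IsDiracType

variable (h : IsDiracType V γ σ H r Γ)
include h

/-- Contract the Clifford relation between `γ^μ` and `p` with `ξ_μ`: the left side becomes `2 p²`.
-/
lemma slash_mul_slash {z : Phase} (hz : z.1 ∈ V) : slashSymbol γ z * slashSymbol γ z =
    ((∑ μ, ∑ ν, H z.1 μ ν * z.2 μ * z.2 ν : ℝ) : ℂ) • (1 : SpinMat) := by
  have h1 := gamma_mul_slash (h.clifford z.1 hz) z.2
  have h2 : (2 : ℂ) • (slashSymbol γ z * slashSymbol γ z) = ∑ μ, ((z.2 μ : ℝ) : ℂ) •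
      (γ μ z.1 * slashSymbol γ z + slashSymbol γ z * γ μ z.1) := by
    have e1 : ∑ μ, ((z.2 μ : ℝ) : ℂ) • (γ μ z.1 * slashSymbol γ z) =
        slashSymbol γ z * slashSymbol γ z := by
      simp only [← Matrix.smul_mul, ← Finset.sum_mul]
      rfl
    have e2 : ∑ μ, ((z.2 μ : ℝ) : ℂ) • (slashSymbol γ z * γ μ z.1) =
        slashSymbol γ z * slashSymbol γ z := by
      simp only [← Matrix.mul_smul, ← Finset.mul_sum]
      rfl
    simp only [smul_add, Finset.sum_add_distrib, e1, e2, two_smul]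
  have h3 : ∑ μ, ((z.2 μ : ℝ) : ℂ) •
      (γ μ z.1 * slashSymbol γ z + slashSymbol γ z * γ μ z.1) =
      (2 : ℂ) • (((∑ μ, ∑ ν, H z.1 μ ν * z.2 μ * z.2 ν : ℝ) : ℂ) • (1 : SpinMat)) := by
    have h1' (μ : Fin 4) : γ μ z.1 * slashSymbol γ z + slashSymbol γ z * γ μ z.1 = _ := h1 μ
    simp only [h1', smul_smul, ← Finset.sum_smul]
    congr 1
    push_cast
    simp only [Finset.mul_sum]
    exact Finset.sum_congr rfl fun μ _ => Finset.sum_congr rfl fun ν _ => by ring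
  exact smul_right_injective _ two_ne_zero (h2.trans h3)

lemma smul_slash_mul_slash {z : Phase} (hz : z.1 ∈ V) :
    ((r z.1 : ℝ) : ℂ) • slashSymbol γ z * slashSymbol γ z =
      ((quadSymbol H r z : ℝ) : ℂ) • (1 : SpinMat) := by
  rw [Matrix.smul_mul, h.slash_mul_slash hz, smul_smul, quadSymbol, Complex.ofReal_mul]

/-- The square of `p` is scalar, so `(det p)²` is the fourth power of the quadratic form; the
density is a positive factor. -/
lemma det_slash_eq_zero_iff {z : Phase} (hz : z.1 ∈ V) :
    (slashSymbol γ z).det = 0 ↔ quadSymbol H r z = 0 := by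
  have h1 := congrArg Matrix.det (h.slash_mul_slash hz)
  rw [Matrix.det_mul, Matrix.det_smul, Matrix.det_one, mul_one] at h1
  rw [← mul_self_eq_zero, h1, pow_eq_zero_iff (by simp), Complex.ofReal_eq_zero, quadSymbol,
    mul_eq_zero, or_iff_right (h.r_pos _ hz).ne']

lemma hamVec_fst {z : Phase} (hz : z.1 ∈ V) (μ : Fin 4) :
    (hamVec (quadSymbol H r) z).1 μ = 2 * r z.1 * ∑ ν, H z.1 μ ν * z.2 ν := by
  rw [hamVec]
  simp only
  rw [sum_smul_stdVec_apply, partXi_quadSymbol (h.smooth_H _ hz) (h.smooth_r _ hz)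
    (h.symm_H _ hz)]

/-- The `x`-component is a positive multiple of `H ξ`, and `H` is invertible. The null condition
plays no role. -/
lemma hamVec_fst_ne_zero {z : Phase} (hz : z.1 ∈ V) (hξ : z.2 ≠ 0) :
    (hamVec (quadSymbol H r) z).1 ≠ 0 := by
  intro h0
  apply hξ
  have h1 : (H z.1).mulVec z.2 = 0 := by
    ext μ
    have := h.hamVec_fst hz μ
    rw [h0] at this
    have hr := h.r_pos _ hz
    have h2 : (2 * r z.1) ≠ 0 := by positivity
    simpa [h2, Matrix.mulVec, dotProduct] using this.symm
  have h2 := Matrix.eq_zero_of_mulVec_eq_zero (h.isUnit_H _ hz).ne_zero h1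
  ext μ
  exact congrFun h2 μ

lemma isOpen_coneOver : IsOpen (coneOver V) :=
  (h.isOpen.preimage continuous_fst).inter (isOpen_compl_singleton.preimage continuous_snd)

lemma isRealPrincipalTypeVia :
    IsRealPrincipalTypeVia (slashSymbol γ) (fun z => ((r z.1 : ℝ) : ℂ) • slashSymbol γ z)
      (quadSymbol H r) (coneOver V) where
  isOpen := h.isOpen_coneOver
  conic z hz t ht := ⟨hz.1, smul_ne_zero ht.ne' hz.2⟩
  ne_zero z hz := hz.2
  symbol_pt := by
    refine ⟨1, fun c d => ⟨fun z hz => ?_, fun z hz t ht => ?_⟩⟩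
    · exact (entrySmoothAt_smul_slashSymbol (h.smooth_γ _ hz.1) (h.smooth_r _ hz.1) c d
        ).contDiffWithinAt
    · have : slashSymbol γ (z.1, t • z.2) = (t : ℂ) • slashSymbol γ z := by
        simp only [slashSymbol, Finset.smul_sum, smul_smul]
        simp
      change (((r z.1 : ℝ) : ℂ) • slashSymbol γ (z.1, t • z.2)) c d =
        t ^ (1 : ℝ) • (((r z.1 : ℝ) : ℂ) • slashSymbol γ z) c d
      rw [this, Real.rpow_one]
      simp only [Matrix.smul_apply, smul_eq_mul, Complex.real_smul]
      ring
  symbol_q := by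
    refine ⟨2, fun z hz => ?_, fun z hz t ht => ?_⟩
    · exact (contDiffAt_quadSymbol (h.smooth_H _ hz.1) (h.smooth_r _ hz.1)).contDiffWithinAt
    · simp only [quadSymbol, PiLp.smul_apply, smul_eq_mul, Finset.mul_sum, Real.rpow_two]
      exact Finset.sum_congr rfl fun μ _ => Finset.sum_congr rfl fun ν _ => by ring
  mul_eq z hz := h.smul_slash_mul_slash hz.1
  scalar z hz _ := h.hamVec_fst_ne_zero hz.1 hz.2

/-- On the kernel of `p`, the zeroth order part of Dencker's connection is `ẋ^μ σ_μ`. -/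
lemma dencker_zeroth_order (m : ℝ) {z : Phase} (hz : z.1 ∈ V) {w : Spinor}
    (hw : (slashSymbol γ z).mulVec w = 0) :
    (1 / 2 : ℂ) • (poisson (fun z => ((r z.1 : ℝ) : ℂ) • slashSymbol γ z) (slashSymbol γ) z).mulVec w
      + Complex.I • ((((r z.1 : ℝ) : ℂ) • slashSymbol γ z) *
        subprincipal (slashSymbol γ) (fun z => diracLow γ σ m z.1) z).mulVec w =
    ∑ μ, (((hamVec (quadSymbol H r) z).1 μ : ℝ) : ℂ) • (σ μ z.1).mulVec w := by
  have hγ := h.smooth_γ _ hz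
  have hev : ∀ᶠ y in 𝓝 z.1, ∀ μ, EntrySmoothAt (γ μ) y :=
    Filter.mem_of_superset (h.isOpen.mem_nhds hz) h.smooth_γ
  have key := dencker_matrix_identity (γ := fun μ => γ μ z.1) (σ := fun μ => σ μ z.1)
    (dγ := fun μ ν => entryDeriv (γ ν) z.1 (stdVec μ)) (Γ := fun κ μ ν => (Γ z.1 κ μ ν : ℂ))
    (ξ := fun μ => ((z.2 μ : ℝ) : ℂ)) (h := fun μ => ((∑ ν, H z.1 μ ν * z.2 ν : ℝ) : ℂ))
    (dr := fun l => ((fderiv ℝ r z.1 (stdVec l) : ℝ) : ℂ)) (r := ((r z.1 : ℝ) : ℂ)) (m := (m : ℂ))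
    (p := slashSymbol γ z) rfl (gamma_mul_slash (h.clifford _ hz) z.2) (h.parallel _ hz)
    (fun κ μ ν => by rw [h.symm_Γ _ hz]) (fun l => by rw [← h.trace_Γ _ hz]; push_cast; rfl)
  simp only [poisson, subprincipal, matX_slashSymbol hγ, matXi_slashSymbol hγ,
    matX_matXi_slashSymbol hev, matX_smul_slashSymbol hγ (h.smooth_r _ hz),
    matXi_smul_slashSymbol hγ (h.smooth_r _ hz), diracLow]
  -- Collected into one matrix, everything except `ẋ^μ σ_μ` has right factor `p`, the mass term
  -- included, and so annihilates `w`.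
  rw [← Matrix.smul_mulVec, ← Matrix.smul_mulVec, ← Matrix.add_mulVec, key, Matrix.add_mulVec,
    ← Matrix.mulVec_mulVec, hw, Matrix.mulVec_zero, add_zero, Matrix.sum_mulVec]
  refine Finset.sum_congr rfl fun μ _ => ?_
  rw [Matrix.smul_mulVec, h.hamVec_fst hz]
  push_cast
  rfl

lemma dencker_eq (m : ℝ) {z : Phase} (hz : z.1 ∈ V) {w : Phase → Spinor}
    (hw : (slashSymbol γ z).mulVec (w z) = 0) :
    dencker (slashSymbol γ) (fun z => ((r z.1 : ℝ) : ℂ) • slashSymbol γ z) (quadSymbol H r)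
      (subprincipal (slashSymbol γ) fun z => diracLow γ σ m z.1) w z =
    pullbackConn σ w z (hamVec (quadSymbol H r) z) := by
  rw [dencker, add_assoc, h.dencker_zeroth_order m hz hw, pullbackConn]

lemma denckerEqLift (m : ℝ) :
    DenckerEqLift (slashSymbol γ) (fun z => ((r z.1 : ℝ) : ℂ) • slashSymbol γ z) (quadSymbol H r)
      (subprincipal (slashSymbol γ) fun z => diracLow γ σ m z.1) σ V where
  section_eq w z hz _ _ hw := h.dencker_eq m hz.1 hw
  along_eq I c _ hc w τ hτ _ hw := by
    rw [denckerAlong, add_assoc, h.dencker_zeroth_order m (hc.mem τ hτ).1 hw, connAlong]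
    have h1 := (ContinuousLinearMap.fst ℝ R4 R4).hasFDerivAt.comp_hasDerivAt τ
      (hc.hasDerivAt τ hτ)
    rw [one_smul] at h1
    have h2 : deriv (fun t => (c t).1) τ = (hamVec (quadSymbol H r) (c τ)).1 := h1.deriv
    rw [h2]

end IsDiracType
end DiracType

/-! ## Tensor calculus in a chart -/

section ChartCalculus

variable {M : Type*} [TopologicalSpace M] [ChartedSpace R4 M]

/-- The components of a vector field in a chart, as functions of the coordinates. -/
noncomputable def pushVec (φ : Chart M) (X : (x : M) → TangentSpace (𝓡 4) x) (y : R4) : R4 :=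
  mvfderiv (𝓡 4) φ (φ.symm y) (X (φ.symm y))

variable {φ : Chart M} (hφ : φ ∈ IsManifold.maximalAtlas (𝓡 4) ∞ M)
include hφ

lemma chart_mdifferentiable : φ.MDifferentiable (𝓡 4) (𝓡 4) :=
  ⟨fun _ hx => ((contMDiffAt_of_mem_maximalAtlas hφ hx).mdifferentiableAt
      (by simp)).mdifferentiableWithinAt,
    fun _ hx => ((contMDiffAt_symm_of_mem_maximalAtlas hφ hx).mdifferentiableAt
      (by simp)).mdifferentiableWithinAt⟩

lemma isInvertible_mvfderiv_chart {x : M} (hx : x ∈ φ.source) :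
    (mvfderiv (𝓡 4) φ x).IsInvertible :=
  ⟨(chart_mdifferentiable hφ).mfderiv hx, rfl⟩

lemma isInvertible_mfderiv_chart_symm {y : R4} (hy : y ∈ φ.target) :
    (mfderiv (𝓡 4) (𝓡 4) φ.symm y).IsInvertible :=
  ⟨(chart_mdifferentiable hφ).symm.mfderiv hy, rfl⟩

lemma mfderiv_symm_mvfderiv_chart {x : M} (hx : x ∈ φ.source) (v : TangentSpace (𝓡 4) x) :
    mfderiv (𝓡 4) (𝓡 4) φ.symm (φ x) (mvfderiv (𝓡 4) φ x v) = v :=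
  congrArg (fun L : R4 →L[ℝ] R4 => L v) ((chart_mdifferentiable hφ).symm_comp_deriv hx)

lemma mvfderiv_coordVec {x : M} (hx : x ∈ φ.source) (μ : Fin 4) :
    mvfderiv (𝓡 4) φ x (coordVec φ μ x) = stdVec μ := by
  obtain ⟨e, he⟩ := isInvertible_mvfderiv_chart hφ hx
  rw [coordVec, ← he, ContinuousLinearMap.inverse_equiv]
  simp

lemma mvfderiv_chart_injective {x : M} (hx : x ∈ φ.source) :
    Function.Injective (mvfderiv (𝓡 4) φ x) := by
  obtain ⟨e, he⟩ := isInvertible_mvfderiv_chart hφ hx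
  rw [← he]
  exact e.injective

lemma eq_sum_coordVec {x : M} (hx : x ∈ φ.source) (v : TangentSpace (𝓡 4) x) :
    v = ∑ μ, (mvfderiv (𝓡 4) φ x v) μ • coordVec φ μ x := by
  apply mvfderiv_chart_injective hφ hx
  rw [map_sum]
  simp only [map_smul, mvfderiv_coordVec hφ hx]
  exact eq_sum_smul_stdVec _

variable {F : Type*} [NormedAddCommGroup F] [NormedSpace ℝ F]

lemma mvfderiv_eq_fderiv_chart {f : M → F} {y : R4} (hy : y ∈ φ.target)
    (hf : MDifferentiableAt (𝓡 4) 𝓘(ℝ, F) f (φ.symm y)) (v : TangentSpace (𝓡 4) (φ.symm y)) :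
    mvfderiv (𝓡 4) f (φ.symm y) v =
      fderiv ℝ (fun z => f (φ.symm z)) y (mvfderiv (𝓡 4) φ (φ.symm y) v) := by
  have h1 : mfderiv (𝓡 4) 𝓘(ℝ, F) (f ∘ φ.symm) y = _ :=
    mfderiv_comp y hf ((chart_mdifferentiable hφ).mdifferentiableAt_symm hy)
  rw [mfderiv_eq_fderiv] at h1
  have h2 := congrArg (fun L : R4 →L[ℝ] F => L (mvfderiv (𝓡 4) φ (φ.symm y) v)) h1
  have h3 := mfderiv_symm_mvfderiv_chart hφ (φ.map_target hy) v
  rw [φ.right_inv hy] at h3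
  refine Eq.trans ?_ h2.symm
  exact congrArg (mvfderiv (𝓡 4) f (φ.symm y)) h3.symm

lemma contDiffAt_comp_chart_symm {f : M → F} {y : R4} (hy : y ∈ φ.target)
    (hf : ContMDiffAt (𝓡 4) 𝓘(ℝ, F) ∞ f (φ.symm y)) :
    ContDiffAt ℝ ∞ (fun z => f (φ.symm z)) y :=
  contMDiffAt_iff_contDiffAt.1 (hf.comp y (contMDiffAt_symm_of_mem_maximalAtlas hφ hy))

lemma pushVec_eq_mpullback (X : (x : M) → TangentSpace (𝓡 4) x) {y : R4} (hy : y ∈ φ.target) :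
    VectorField.mpullback (𝓡 4) (𝓡 4) φ.symm X y = pushVec φ X y := by
  obtain ⟨e, he⟩ := isInvertible_mfderiv_chart_symm hφ hy
  rw [VectorField.mpullback_apply, ← he, ContinuousLinearMap.inverse_equiv]
  refine (ContinuousLinearEquiv.symm_apply_eq e).2 ?_
  have h3 := mfderiv_symm_mvfderiv_chart hφ (φ.map_target hy) (X (φ.symm y))
  rw [φ.right_inv hy, ← he] at h3
  exact h3.symm

variable [IsManifold (𝓡 4) ∞ M]

/-- Smoothness at a point of a vector field. -/
def SmoothFieldAt (X : (x : M) → TangentSpace (𝓡 4) x) (x : M) : Prop :=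
  ContMDiffAt (𝓡 4) (𝓡 4).tangent ∞ (fun x => (⟨x, X x⟩ : TangentBundle (𝓡 4) M)) x

lemma contDiffAt_pushVec {X : (x : M) → TangentSpace (𝓡 4) x} {y : R4} (hy : y ∈ φ.target)
    (hX : SmoothFieldAt X (φ.symm y)) : ContDiffAt ℝ ∞ (pushVec φ X) y := by
  have h1 := ContMDiffAt.mpullback_vectorField_preimage (I := 𝓡 4) (I' := 𝓡 4) (m := ∞) (n := ∞)
    hX (contMDiffAt_symm_of_mem_maximalAtlas hφ hy) (isInvertible_mfderiv_chart_symm hφ hy)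
    (by simp)
  rw [contMDiffAt_vectorSpace_iff_contDiffAt] at h1
  refine h1.congr_of_eventuallyEq ?_
  filter_upwards [φ.open_target.mem_nhds hy] with z hz
  exact (pushVec_eq_mpullback hφ X hz).symm

/-- The Lie bracket is natural under pullback along `φ.symm`, and on a vector space it is the
commutator of directional derivatives. -/
lemma pushVec_mlieBracket {X Y : (x : M) → TangentSpace (𝓡 4) x} {y : R4} (hy : y ∈ φ.target)
    (hX : SmoothFieldAt X (φ.symm y)) (hY : SmoothFieldAt Y (φ.symm y)) :
    pushVec φ (VectorField.mlieBracket (𝓡 4) X Y) y =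
      fderiv ℝ (pushVec φ Y) y (pushVec φ X y) - fderiv ℝ (pushVec φ X) y (pushVec φ Y y) := by
  have hev (X : (x : M) → TangentSpace (𝓡 4) x) :
      VectorField.mpullback (𝓡 4) (𝓡 4) φ.symm X =ᶠ[𝓝 y] pushVec φ X := by
    filter_upwards [φ.open_target.mem_nhds hy] with z hz
    exact pushVec_eq_mpullback hφ X hz
  have : IsManifold (𝓡 4) (minSmoothness ℝ 3) M := .of_le (n := ∞)
    (by simpa using WithTop.coe_le_coe.2 (le_top : (3 : ℕ∞) ≤ ⊤))
  rw [← pushVec_eq_mpullback hφ _ hy, VectorField.mpullback_mlieBracket (n := ∞)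
    (ContMDiffAt.mdifferentiableAt hX (by simp)) (ContMDiffAt.mdifferentiableAt hY (by simp))
    (contMDiffAt_symm_of_mem_maximalAtlas hφ hy)
    (by simpa using WithTop.coe_le_coe.2 (le_top : (2 : ℕ∞) ≤ ⊤)),
    (hev X).mlieBracket_vectorField_eq (hev Y)]
  refine Eq.trans ?_ (congrFun (VectorField.lieBracketWithin_univ (𝕜 := ℝ)) y)
  refine Eq.trans ?_ (congrFun VectorField.mlieBracketWithin_eq_lieBracketWithin y)
  exact (congrFun VectorField.mlieBracketWithin_univ y).symm

/-- The coordinate field is the pullback under the chart of a constant field. -/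
lemma smoothFieldAt_coordVec {x : M} (hx : x ∈ φ.source) (μ : Fin 4) :
    SmoothFieldAt (coordVec φ μ) x := by
  have h0 : ContMDiffAt (𝓡 4) (𝓡 4).tangent ∞
      (fun y : R4 => (⟨y, stdVec μ⟩ : TangentBundle (𝓡 4) R4)) (φ x) :=
    contMDiffAt_vectorSpace_iff_contDiffAt.2 contDiffAt_const
  exact ContMDiffAt.mpullback_vectorField_preimage (I := 𝓡 4) (I' := 𝓡 4) (m := ∞) (n := ∞)
    h0 (contMDiffAt_of_mem_maximalAtlas hφ hx) (isInvertible_mvfderiv_chart hφ hx) (by simp)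

variable (g : LorentzMetric M)

lemma metric_eq_sum {x : M} (hx : x ∈ φ.source) (v w : TangentSpace (𝓡 4) x) :
    g.val x v w = ∑ μ, ∑ ν, metricMat g φ (φ x) μ ν *
      (mvfderiv (𝓡 4) φ x v) μ * (mvfderiv (𝓡 4) φ x w) ν := by
  have hl : φ.symm (φ x) = x := φ.left_inv hx
  conv_lhs => rw [eq_sum_coordVec hφ hx v, eq_sum_coordVec hφ hx w]
  simp only [map_sum, map_smul, _root_.sum_apply, _root_.smul_apply, smul_eq_mul, metricMat,
    Matrix.of_apply, Finset.mul_sum]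
  rw [hl]
  refine Finset.sum_comm.trans (Finset.sum_congr rfl fun μ _ => Finset.sum_congr rfl fun ν _ => ?_)
  ring

omit hφ in
lemma contMDiffAt_metric {X Y : (x : M) → TangentSpace (𝓡 4) x} {x : M} (hX : SmoothFieldAt X x)
    (hY : SmoothFieldAt Y x) :
    ContMDiffAt (𝓡 4) 𝓘(ℝ, ℝ) ∞ (fun x => g.val x (X x) (Y x)) x := by
  have h := ContMDiffAt.clm_bundle_apply₂ (F₁ := R4) (F₂ := R4) (F₃ := ℝ)
    (E₁ := fun x : M => TangentSpace (𝓡 4) x) (E₂ := fun x : M => TangentSpace (𝓡 4) x)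
    (E₃ := Bundle.Trivial M ℝ) (b := fun x : M => x) (v := X) (w := Y)
    (g.contMDiff.contMDiffAt (x := x)) hX hY
  exact (Bundle.contMDiffAt_section _).1 h |>.congr_of_eventuallyEq (Filter.Eventually.of_forall fun x => rfl)

lemma entrySmoothAt_metricMat {y : R4} (hy : y ∈ φ.target) :
    EntrySmoothAt (metricMat g φ) y := fun μ ν =>
  contDiffAt_comp_chart_symm hφ hy (contMDiffAt_metric g
    (smoothFieldAt_coordVec hφ (φ.map_target hy) μ)
    (smoothFieldAt_coordVec hφ (φ.map_target hy) ν))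

omit hφ in
lemma metricMat_symm (y : R4) (μ ν : Fin 4) : metricMat g φ y μ ν = metricMat g φ y ν μ :=
  g.symm _ _ _

end ChartCalculus

/-! ## Bilinear forms with variable coefficients and orthonormal frames -/

section BilinearForms

/-- The bilinear form with matrix `A`. -/
noncomputable def bil (A : Matrix (Fin 4) (Fin 4) ℝ) (v w : R4) : ℝ :=
  ∑ μ, ∑ ν, A μ ν * v μ * w ν

lemma bil_add_left (A : Matrix (Fin 4) (Fin 4) ℝ) (v v' w : R4) :
    bil A (v + v') w = bil A v w + bil A v' w := by
  simp only [bil, PiLp.add_apply, mul_add, add_mul, Finset.sum_add_distrib]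

lemma bil_sub_left (A : Matrix (Fin 4) (Fin 4) ℝ) (v v' w : R4) :
    bil A (v - v') w = bil A v w - bil A v' w := by
  simp only [bil, PiLp.sub_apply, mul_sub, sub_mul, Finset.sum_sub_distrib]

lemma bil_smul_left (A : Matrix (Fin 4) (Fin 4) ℝ) (c : ℝ) (v w : R4) :
    bil A (c • v) w = c * bil A v w := by
  simp only [bil, PiLp.smul_apply, smul_eq_mul, Finset.mul_sum]
  exact Finset.sum_congr rfl fun _ _ => Finset.sum_congr rfl fun _ _ => by ring

lemma bil_comm {A : Matrix (Fin 4) (Fin 4) ℝ} (hA : ∀ μ ν, A μ ν = A ν μ) (v w : R4) :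
    bil A v w = bil A w v := by
  rw [bil, Finset.sum_comm, bil]
  exact Finset.sum_congr rfl fun μ _ => Finset.sum_congr rfl fun ν _ => by rw [hA]; ring

lemma bil_add_matrix (A B : Matrix (Fin 4) (Fin 4) ℝ) (v w : R4) :
    bil (A + B) v w = bil A v w + bil B v w := by
  simp only [bil, Matrix.add_apply, add_mul, Finset.sum_add_distrib]

lemma bil_smul_matrix (c : ℝ) (A : Matrix (Fin 4) (Fin 4) ℝ) (v w : R4) :
    bil (c • A) v w = c * bil A v w := by
  simp only [bil, Matrix.smul_apply, smul_eq_mul, Finset.mul_sum]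
  exact Finset.sum_congr rfl fun _ _ => Finset.sum_congr rfl fun _ _ => by ring

/-- The dependence of `entryDeriv` on the direction is linear. -/
lemma entryDeriv_eq_sum {𝕜 : Type*} [NormedField 𝕜] [NormedAlgebra ℝ 𝕜] {m n : Type*}
    (A : R4 → Matrix m n 𝕜) (y v : R4) :
    entryDeriv A y v = ∑ μ, v μ • entryDeriv A y (stdVec μ) := by
  ext c d
  simp only [Matrix.sum_apply, Matrix.smul_apply, entryDeriv_apply]
  conv_lhs => rw [eq_sum_smul_stdVec v, map_sum]
  simp only [map_smul]

lemma contDiffAt_coord_comp {E : Type*} [NormedAddCommGroup E] [NormedSpace ℝ E] {f : E → R4}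
    {x : E} (hf : ContDiffAt ℝ ∞ f x) (μ : Fin 4) : ContDiffAt ℝ ∞ (fun z => f z μ) x :=
  (contDiff_coord μ).contDiffAt.comp x hf

lemma fderiv_coord_comp {E : Type*} [NormedAddCommGroup E] [NormedSpace ℝ E] {f : E → R4} {x : E}
    (hf : DifferentiableAt ℝ f x) (μ : Fin 4) (v : E) :
    fderiv ℝ (fun z => f z μ) x v = (fderiv ℝ f x v) μ := by
  have h := ((EuclideanSpace.proj μ : R4 →L[ℝ] ℝ).hasFDerivAt.comp x hf.hasFDerivAt).fderiv
  exact congrArg (fun L : E →L[ℝ] ℝ => L v) h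

lemma contDiffAt_bil {A : R4 → Matrix (Fin 4) (Fin 4) ℝ} {Y Z : R4 → R4} {y : R4}
    (hA : EntrySmoothAt A y) (hY : ContDiffAt ℝ ∞ Y y) (hZ : ContDiffAt ℝ ∞ Z y) :
    ContDiffAt ℝ ∞ (fun z => bil (A z) (Y z) (Z z)) y :=
  ContDiffAt.sum fun μ _ => ContDiffAt.sum fun ν _ =>
    ((hA μ ν).mul (contDiffAt_coord_comp hY μ)).mul (contDiffAt_coord_comp hZ ν)

lemma fderiv_bil {A : R4 → Matrix (Fin 4) (Fin 4) ℝ} {Y Z : R4 → R4} {y : R4}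
    (hA : EntryDiffAt A y) (hY : DifferentiableAt ℝ Y y) (hZ : DifferentiableAt ℝ Z y) (v : R4) :
    fderiv ℝ (fun z => bil (A z) (Y z) (Z z)) y v =
      bil (entryDeriv A y v) (Y y) (Z y) + bil (A y) (fderiv ℝ Y y v) (Z y)
        + bil (A y) (Y y) (fderiv ℝ Z y v) := by
  have hc {f : R4 → R4} (hf : DifferentiableAt ℝ f y) (μ : Fin 4) :
      DifferentiableAt ℝ (fun z => f z μ) y :=
    ((contDiff_coord μ).differentiable (by simp) _).comp y hf
  have h (μ ν : Fin 4) := ((hA μ ν).fun_mul (hc hY μ)).fun_mul (hc hZ ν)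
  simp only [bil]
  rw [fderiv_fun_sum fun μ _ => DifferentiableAt.fun_sum fun ν _ => h μ ν, _root_.sum_apply,
    ← Finset.sum_add_distrib, ← Finset.sum_add_distrib]
  refine Finset.sum_congr rfl fun μ _ => ?_
  rw [fderiv_fun_sum fun ν _ => h μ ν, _root_.sum_apply,
    ← Finset.sum_add_distrib, ← Finset.sum_add_distrib]
  refine Finset.sum_congr rfl fun ν _ => ?_
  rw [fderiv_fun_mul ((hA μ ν).fun_mul (hc hY μ)) (hc hZ ν), fderiv_fun_mul (hA μ ν) (hc hY μ)]
  simp only [_root_.add_apply, _root_.smul_apply, smul_eq_mul, fderiv_coord_comp hY,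
    fderiv_coord_comp hZ, entryDeriv_apply]
  ring

/-- The vectors `e a` are orthonormal for the form `G`. -/
def IsOrthoFrame (G : Matrix (Fin 4) (Fin 4) ℝ) (e : Fin 4 → R4) : Prop :=
  ∀ a b, bil G (e a) (e b) = minkowski a b

variable {G : Matrix (Fin 4) (Fin 4) ℝ} {e : Fin 4 → R4}

/-- The matrix whose columns are the vectors of the frame. -/
def frameCols (e : Fin 4 → R4) : Matrix (Fin 4) (Fin 4) ℝ := Matrix.of fun μ a => e a μ

lemma minkowski_matrix_sq : Matrix.of minkowski * Matrix.of minkowski = 1 := by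
  ext a b
  simp only [Matrix.mul_apply, Matrix.of_apply, minkowski, Matrix.one_apply]
  fin_cases a <;> fin_cases b <;> simp

lemma IsOrthoFrame.transpose_mul_mul (h : IsOrthoFrame G e) :
    (frameCols e).transpose * G * frameCols e = Matrix.of minkowski := by
  ext a b
  rw [Matrix.of_apply, ← h a b]
  simp only [Matrix.mul_apply, Matrix.transpose_apply, frameCols, Matrix.of_apply, bil,
    Finset.sum_mul]
  rw [Finset.sum_comm]
  exact Finset.sum_congr rfl fun μ _ => Finset.sum_congr rfl fun ν _ => by ring

/-- Determinants of `Eᵀ G E = η` give `(det E)² det G = -1`. -/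
lemma IsOrthoFrame.det_neg (h : IsOrthoFrame G e) : G.det < 0 := by
  have h1 := congrArg Matrix.det h.transpose_mul_mul
  rw [Matrix.det_mul, Matrix.det_mul, Matrix.det_transpose] at h1
  have h2 : (Matrix.of minkowski).det = -1 := by
    have : Matrix.of minkowski = Matrix.diagonal ![1, -1, -1, -1] := by
      ext a b
      fin_cases a <;> fin_cases b <;> simp [minkowski]
    rw [this, Matrix.det_diagonal]
    simp [Fin.prod_univ_four]
  rw [h2] at h1
  nlinarith [sq_nonneg (frameCols e).det]

lemma IsOrthoFrame.mul_eq_one (h : IsOrthoFrame G e) :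
    frameCols e * (Matrix.of minkowski * (frameCols e).transpose * G) = 1 := by
  rw [mul_eq_one_comm, Matrix.mul_assoc, Matrix.mul_assoc, ← Matrix.mul_assoc _ G,
    h.transpose_mul_mul, minkowski_matrix_sq]

/-- Since `η² = 1`, the relation `Eᵀ G E = η` inverts to `G⁻¹ = E η Eᵀ`. In this form the inverse
metric appears in the Clifford relations of the coordinate Dirac matrices. -/
lemma IsOrthoFrame.inv_eq (h : IsOrthoFrame G e) (μ ν : Fin 4) :
    G⁻¹ μ ν = ∑ a, minkowski a a * e a μ * e a ν := by
  have h1 : G⁻¹ = frameCols e * Matrix.of minkowski * (frameCols e).transpose :=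
    Matrix.inv_eq_left_inv (by rw [← h.mul_eq_one]; simp only [Matrix.mul_assoc])
  rw [h1]
  simp only [Matrix.mul_apply, frameCols, Matrix.of_apply, Matrix.transpose_apply]
  refine Finset.sum_congr rfl fun a _ => ?_
  rw [Finset.sum_eq_single a (fun b _ hb => by rw [minkowski_of_ne hb, mul_zero]) (by simp)]
  ring

lemma IsOrthoFrame.eq_sum (h : IsOrthoFrame G e) (v : R4) :
    v = ∑ a, (minkowski a a * bil G (e a) v) • e a := by
  ext μ
  have h1 := congrFun (congrArg (fun A : Matrix (Fin 4) (Fin 4) ℝ => A.mulVec v) h.mul_eq_one) μ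
  simp only [Matrix.one_mulVec, ← Matrix.mulVec_mulVec, Matrix.mul_assoc] at h1
  rw [← h1]
  simp only [WithLp.ofLp_sum, Finset.sum_apply, PiLp.smul_apply, smul_eq_mul]
  simp only [Matrix.mulVec, dotProduct, frameCols, Matrix.of_apply, Matrix.transpose_apply]
  refine Finset.sum_congr rfl fun a _ => ?_
  rw [Finset.sum_eq_single a (fun b _ hb => by rw [minkowski_of_ne hb.symm, zero_mul]) (by simp)]
  rw [mul_comm]
  congr 2
  simp only [bil, Finset.mul_sum]
  exact Finset.sum_congr rfl fun _ _ => Finset.sum_congr rfl fun _ _ => by ring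

end BilinearForms

/-! ## The Levi-Civita connection in a chart -/

section LeviCivita

variable {M : Type*} [TopologicalSpace M] [ChartedSpace R4 M] [IsManifold (𝓡 4) ∞ M]

/-- The Christoffel form `Γ(v, w, z) = ½ (∂_v g(w, z) + ∂_w g(v, z) - ∂_z g(v, w))` for constant
vector fields. -/
noncomputable def christoffelForm (G : R4 → Matrix (Fin 4) (Fin 4) ℝ) (y v w z : R4) : ℝ :=
  (bil (entryDeriv G y v) w z + bil (entryDeriv G y w) v z - bil (entryDeriv G y z) v w) / 2

variable (g : LorentzMetric M) {φ : Chart M} (hφ : φ ∈ IsManifold.maximalAtlas (𝓡 4) ∞ M)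
include hφ

lemma metric_eq_bil {y : R4} (hy : y ∈ φ.target) (v w : TangentSpace (𝓡 4) (φ.symm y)) :
    g.val (φ.symm y) v w = bil (metricMat g φ y)
      (mvfderiv (𝓡 4) φ (φ.symm y) v) (mvfderiv (𝓡 4) φ (φ.symm y) w) := by
  have h := metric_eq_sum hφ g (φ.map_target hy) v w
  rwa [φ.right_inv hy] at h

lemma mvfderiv_metric {X Y Z : (x : M) → TangentSpace (𝓡 4) x} {y : R4} (hy : y ∈ φ.target)
    (hY : SmoothFieldAt Y (φ.symm y)) (hZ : SmoothFieldAt Z (φ.symm y)) :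
    mvfderiv (𝓡 4) (fun x => g.val x (Y x) (Z x)) (φ.symm y) (X (φ.symm y)) =
      bil (entryDeriv (metricMat g φ) y (pushVec φ X y)) (pushVec φ Y y) (pushVec φ Z y)
        + bil (metricMat g φ y) (fderiv ℝ (pushVec φ Y) y (pushVec φ X y)) (pushVec φ Z y)
        + bil (metricMat g φ y) (pushVec φ Y y) (fderiv ℝ (pushVec φ Z) y (pushVec φ X y)) := by
  rw [mvfderiv_eq_fderiv_chart hφ hy ((contMDiffAt_metric g hY hZ).mdifferentiableAt (by simp))]
  have hev : (fun z => g.val (φ.symm z) (Y (φ.symm z)) (Z (φ.symm z))) =ᶠ[𝓝 y]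
      fun z => bil (metricMat g φ z) (pushVec φ Y z) (pushVec φ Z z) := by
    filter_upwards [φ.open_target.mem_nhds hy] with z hz
    exact metric_eq_bil g hφ hz _ _
  rw [hev.fderiv_eq]
  exact fderiv_bil (entrySmoothAt_metricMat hφ g hy).entryDiffAt
    ((contDiffAt_pushVec hφ hy hY).differentiableAt (by simp))
    ((contDiffAt_pushVec hφ hy hZ).differentiableAt (by simp)) _

/-- The Koszul formula in a chart. -/
lemma leviCivita_eq {X Y Z : (x : M) → TangentSpace (𝓡 4) x} {y : R4} (hy : y ∈ φ.target)
    (hX : SmoothFieldAt X (φ.symm y)) (hY : SmoothFieldAt Y (φ.symm y))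
    (hZ : SmoothFieldAt Z (φ.symm y)) :
    leviCivita g X Y Z (φ.symm y) =
      bil (metricMat g φ y) (fderiv ℝ (pushVec φ Y) y (pushVec φ X y)) (pushVec φ Z y)
        + christoffelForm (metricMat g φ) y (pushVec φ X y) (pushVec φ Y y) (pushVec φ Z y) := by
  have hb {A B C : (x : M) → TangentSpace (𝓡 4) x} (hA : SmoothFieldAt A (φ.symm y))
      (hB : SmoothFieldAt B (φ.symm y)) :
      g.val (φ.symm y) (VectorField.mlieBracket (𝓡 4) A B (φ.symm y)) (C (φ.symm y)) =
        bil (metricMat g φ y) (fderiv ℝ (pushVec φ B) y (pushVec φ A y)) (pushVec φ C y)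
          - bil (metricMat g φ y) (fderiv ℝ (pushVec φ A) y (pushVec φ B y)) (pushVec φ C y) := by
    rw [metric_eq_bil g hφ hy, ← bil_sub_left, ← pushVec_mlieBracket hφ hy hA hB]
    rfl
  have hs := metricMat_symm g (φ := φ) y
  -- In the six Koszul terms the derivatives of `X` and `Z` cancel and so does the derivative of `Y`
  -- along `Z`; the derivative of `Y` along `X` occurs twice, and the derivatives of the metric form
  -- the Christoffel form.
  rw [leviCivita, mvfderiv_metric g hφ hy hY hZ, mvfderiv_metric g hφ hy hX hZ,
    mvfderiv_metric g hφ hy hX hY, hb hX hY, hb hX hZ, hb hY hZ, christoffelForm,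
    bil_comm hs (pushVec φ Y y), bil_comm hs (pushVec φ X y) (fderiv ℝ (pushVec φ Z) y _),
    bil_comm hs (pushVec φ X y) (fderiv ℝ (pushVec φ Y) y _)]
  ring

end LeviCivita

/-! ### Christoffel symbols: lowered index, and trace as logarithmic derivative of the density. -/

section Christoffel

variable {M : Type*} [TopologicalSpace M] [ChartedSpace R4 M] [IsManifold (𝓡 4) ∞ M]
  (g : LorentzMetric M) (φ : Chart M)

lemma entryDeriv_metricMat_symm (y v : R4) (μ ν : Fin 4) :
    entryDeriv (metricMat g φ) y v μ ν = entryDeriv (metricMat g φ) y v ν μ := by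
  simp only [entryDeriv_apply, fun z => metricMat_symm g (φ := φ) z μ ν]

lemma christoffel_symm (y : R4) (κ μ ν : Fin 4) :
    christoffel g φ y κ μ ν = christoffel g φ y κ ν μ := by
  refine Finset.sum_congr rfl fun ρ _ => ?_
  rw [show (fun z => metricMat g φ z μ ν) = fun z => metricMat g φ z ν μ from
    funext fun z => metricMat_symm g z μ ν]
  ring

/-- The vector `Γ^κ_{μν} v^μ w^ν`. -/
noncomputable def christoffelVec (y v w : R4) : R4 :=
  WithLp.toLp 2 fun κ => ∑ μ, ∑ ν, christoffel g φ y κ μ ν * v μ * w ν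

lemma christoffelVec_apply (y v w : R4) (κ : Fin 4) :
    christoffelVec g φ y v w κ = ∑ μ, ∑ ν, christoffel g φ y κ μ ν * v μ * w ν := rfl

lemma sum_rotate {ι : Type*} [Fintype ι] (f : ι → ι → ι → ℝ) :
    ∑ a, ∑ b, ∑ c, f a b c = ∑ c, ∑ a, ∑ b, f a b c := by
  rw [Finset.sum_comm' (t' := Finset.univ) (s' := fun _ => Finset.univ) (by simp)]
  conv_rhs => rw [Finset.sum_comm]; enter [2, a]; rw [Finset.sum_comm]
  rw [Finset.sum_comm]

lemma bil_entryDeriv (G : R4 → Matrix (Fin 4) (Fin 4) ℝ) (y v w z : R4) :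
    bil (entryDeriv G y v) w z =
      ∑ κ, ∑ μ, ∑ ν, entryDeriv G y (stdVec κ) μ ν * v κ * w μ * z ν := by
  rw [entryDeriv_eq_sum, bil]
  simp only [Matrix.sum_apply, Matrix.smul_apply, smul_eq_mul, Finset.sum_mul]
  rw [sum_rotate]
  exact Finset.sum_congr rfl fun _ _ => Finset.sum_congr rfl fun _ _ =>
    Finset.sum_congr rfl fun _ _ => by ring

variable {φ}

lemma metricMat_mul_christoffel {y : R4} (hd : IsUnit (metricMat g φ y).det) (ρ μ ν : Fin 4) :
    ∑ κ, metricMat g φ y ρ κ * christoffel g φ y κ μ ν =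
      (entryDeriv (metricMat g φ) y (stdVec μ) ρ ν + entryDeriv (metricMat g φ) y (stdVec ν) ρ μ
        - entryDeriv (metricMat g φ) y (stdVec ρ) μ ν) / 2 := by
  set f : Fin 4 → ℝ := fun ρ => (entryDeriv (metricMat g φ) y (stdVec μ) ρ ν
    + entryDeriv (metricMat g φ) y (stdVec ν) ρ μ
    - entryDeriv (metricMat g φ) y (stdVec ρ) μ ν) / 2 with hf
  have h1 : (fun κ => christoffel g φ y κ μ ν) = (metricMat g φ y)⁻¹.mulVec f := by
    funext κ
    unfold christoffel Matrix.mulVec dotProduct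
    refine Finset.sum_congr rfl fun ρ _ => ?_
    rw [mul_div_assoc]
    rfl
  have h2 : (metricMat g φ y).mulVec (fun κ => christoffel g φ y κ μ ν) ρ = f ρ := by
    rw [h1, Matrix.mulVec_mulVec, Matrix.mul_nonsing_inv _ hd, Matrix.one_mulVec]
  exact h2

/-- Lowering the index cancels the inverse metric in the Christoffel symbols. This links the
coefficients in the geodesic equation to the form produced by the Koszul formula. -/
lemma bil_christoffelVec {y : R4} (hd : IsUnit (metricMat g φ y).det) (v w z : R4) :
    bil (metricMat g φ y) (christoffelVec g φ y v w) z =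
      christoffelForm (metricMat g φ) y v w z := by
  have h1 : bil (metricMat g φ y) (christoffelVec g φ y v w) z =
      ∑ ρ, ∑ μ, ∑ ν, ((entryDeriv (metricMat g φ) y (stdVec μ) ρ ν
        + entryDeriv (metricMat g φ) y (stdVec ν) ρ μ
        - entryDeriv (metricMat g φ) y (stdVec ρ) μ ν) / 2) * v μ * w ν * z ρ := by
    rw [bil, Finset.sum_comm]
    refine Finset.sum_congr rfl fun ρ _ => ?_
    simp only [← metricMat_mul_christoffel g hd, christoffelVec_apply, Finset.mul_sum,
      Finset.sum_mul]
    rw [sum_rotate fun μ ν κ => metricMat g φ y ρ κ * christoffel g φ y κ μ ν * v μ * w ν * z ρ]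
    refine Finset.sum_congr rfl fun κ _ => Finset.sum_congr rfl fun _ _ =>
      Finset.sum_congr rfl fun _ _ => ?_
    rw [metricMat_symm g y κ ρ]
    ring
  have e1 : bil (entryDeriv (metricMat g φ) y v) w z = ∑ ρ, ∑ μ, ∑ ν,
      entryDeriv (metricMat g φ) y (stdVec μ) ρ ν * v μ * w ν * z ρ := by
    rw [bil_entryDeriv, sum_rotate]
    refine Finset.sum_congr rfl fun _ _ => Finset.sum_congr rfl fun _ _ =>
      Finset.sum_congr rfl fun _ _ => ?_
    rw [entryDeriv_metricMat_symm]
  have e2 : bil (entryDeriv (metricMat g φ) y w) v z = ∑ ρ, ∑ μ, ∑ ν,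
      entryDeriv (metricMat g φ) y (stdVec ν) ρ μ * v μ * w ν * z ρ := by
    rw [bil_entryDeriv, sum_rotate]
    refine Finset.sum_congr rfl fun _ _ => ?_
    rw [Finset.sum_comm]
    refine Finset.sum_congr rfl fun _ _ => Finset.sum_congr rfl fun _ _ => ?_
    rw [entryDeriv_metricMat_symm]
    ring
  have e3 : bil (entryDeriv (metricMat g φ) y z) v w = ∑ ρ, ∑ μ, ∑ ν,
      entryDeriv (metricMat g φ) y (stdVec ρ) μ ν * v μ * w ν * z ρ := by
    rw [bil_entryDeriv]
    exact Finset.sum_congr rfl fun _ _ => Finset.sum_congr rfl fun _ _ =>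
      Finset.sum_congr rfl fun _ _ => by ring
  rw [h1, christoffelForm, e1, e2, e3, ← Finset.sum_add_distrib, ← Finset.sum_sub_distrib,
    Finset.sum_div]
  refine Finset.sum_congr rfl fun ρ _ => ?_
  rw [← Finset.sum_add_distrib, ← Finset.sum_sub_distrib, Finset.sum_div]
  refine Finset.sum_congr rfl fun μ _ => ?_
  rw [← Finset.sum_add_distrib, ← Finset.sum_sub_distrib, Finset.sum_div]
  exact Finset.sum_congr rfl fun ν _ => by ring

variable (hφ : φ ∈ IsManifold.maximalAtlas (𝓡 4) ∞ M)
include hφ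

lemma contDiffAt_sqrtNegDet {y : R4} (hy : y ∈ φ.target) (hd : (metricMat g φ y).det < 0) :
    ContDiffAt ℝ ∞ (sqrtNegDet g φ) y :=
  (entrySmoothAt_metricMat hφ g hy).det.neg.sqrt (by simpa using hd.ne)

/-- In the trace, two of the three derivative terms are exchanged by swapping the summation indices
and cancel. The rest is `½ tr (G⁻¹ ∂_l G)`, which Jacobi's formula identifies with `∂_l log √(-det
G)`. -/
lemma trace_christoffel {y : R4} (hy : y ∈ φ.target) (hd : (metricMat g φ y).det < 0)
    (l : Fin 4) : sqrtNegDet g φ y * ∑ μ, christoffel g φ y μ μ l =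
      fderiv ℝ (sqrtNegDet g φ) y (stdVec l) := by
  have hG := entrySmoothAt_metricMat hφ g hy
  have hu : IsUnit (metricMat g φ y).det := isUnit_iff_ne_zero.2 hd.ne
  have hr : 0 < sqrtNegDet g φ y := Real.sqrt_pos.2 (by linarith)
  have hsq : sqrtNegDet g φ y * sqrtNegDet g φ y = -(metricMat g φ y).det :=
    Real.mul_self_sqrt (by linarith)
  have hs := hG.det.differentiableAt (by simp)
  have h1 : fderiv ℝ (sqrtNegDet g φ) y (stdVec l) =
      (1 / (2 * sqrtNegDet g φ y)) * -(fderiv ℝ (fun z => (metricMat g φ z).det) y (stdVec l)) := by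
    have := (hs.hasFDerivAt.neg.sqrt (by simpa using hd.ne)).fderiv
    have h2 := congrArg (fun L : R4 →L[ℝ] ℝ => L (stdVec l)) this
    exact h2
  have hinv : ∀ μ ν, (metricMat g φ y)⁻¹ μ ν = (metricMat g φ y)⁻¹ ν μ := by
    intro μ ν
    have : (metricMat g φ y).transpose = metricMat g φ y := by
      ext a b; exact metricMat_symm g y b a
    conv_rhs => rw [← this, ← Matrix.transpose_nonsing_inv]
    rfl
  have h3 : ∑ μ, christoffel g φ y μ μ l =
      ((metricMat g φ y)⁻¹ * entryDeriv (metricMat g φ) y (stdVec l)).trace / 2 := by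
    have e (μ ρ : Fin 4) : (metricMat g φ y)⁻¹ μ ρ *
        (fderiv ℝ (fun z => metricMat g φ z ρ l) y (stdVec μ)
          + fderiv ℝ (fun z => metricMat g φ z ρ μ) y (stdVec l)
          - fderiv ℝ (fun z => metricMat g φ z μ l) y (stdVec ρ)) / 2 =
        ((metricMat g φ y)⁻¹ μ ρ * entryDeriv (metricMat g φ) y (stdVec μ) ρ l
          - (metricMat g φ y)⁻¹ ρ μ * entryDeriv (metricMat g φ) y (stdVec ρ) μ l) / 2
          + (metricMat g φ y)⁻¹ μ ρ * entryDeriv (metricMat g φ) y (stdVec l) ρ μ / 2 := by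
      rw [hinv ρ μ]
      simp only [entryDeriv_apply]
      ring
    simp only [christoffel, e, Finset.sum_add_distrib, ← Finset.sum_div, Finset.sum_sub_distrib]
    rw [Finset.sum_comm (f := fun μ ρ => (metricMat g φ y)⁻¹ ρ μ *
      entryDeriv (metricMat g φ) y (stdVec ρ) μ l), sub_self, zero_div, zero_add]
    rfl
  rw [h1, fderiv_det_of_isUnit hG.entryDiffAt hu, h3]
  have : (metricMat g φ y).det = -(sqrtNegDet g φ y * sqrtNegDet g φ y) := by linarith
  rw [this]
  field_simp

end Christoffel

/-! ## The spin frame in a chart -/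

section SpinCoefficients

/-- The connection form `¼ ∑ w_ab Cᵃ Cᵇ`. -/
noncomputable def spinForm (C : Fin 4 → SpinMat) (w : Fin 4 → Fin 4 → ℝ) : SpinMat :=
  ∑ a, ∑ b, ((w a b / 4 : ℝ) : ℂ) • (C a * C b)

/-- Move `C c` through the product one factor at a time; each exchange costs one Clifford relation.
-/
lemma IsClifford.commutator {C : Fin 4 → SpinMat} (hC : IsClifford C) (a b c : Fin 4) :
    C c * (C a * C b) - C a * C b * C c =
      ((2 * minkowski a c : ℝ) : ℂ) • C b - ((2 * minkowski b c : ℝ) : ℂ) • C a := by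
  have h1 := congrArg (· * C b) (hC a c)
  have h2 := congrArg (C a * ·) (hC b c)
  simp only [Matrix.add_mul, Matrix.mul_add, Matrix.smul_mul, Matrix.mul_smul, Matrix.one_mul,
    Matrix.mul_one, Matrix.mul_assoc] at h1 h2
  rw [← h1, ← h2, Matrix.mul_assoc]
  abel

/-- The spin representation of the Lorentz algebra: bracketing with `¼ w_ab CᵃCᵇ` rotates the Dirac
matrices by `w`. The two terms of the commutator contribute equally because `w` is antisymmetric, so
the normalization is `¼ · 2 · 2 = 1`. -/
lemma commutator_spinForm {C : Fin 4 → SpinMat} (hC : IsClifford C) {w : Fin 4 → Fin 4 → ℝ}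
    (hw : ∀ a b, w a b = -w b a) (c : Fin 4) :
    C c * spinForm C w - spinForm C w * C c =
      ∑ b, ((minkowski c c * w c b : ℝ) : ℂ) • C b := by
  have h1 : C c * spinForm C w - spinForm C w * C c =
      ∑ a, ∑ b, ((w a b / 4 : ℝ) : ℂ) • (C c * (C a * C b) - C a * C b * C c) := by
    simp only [spinForm, Finset.mul_sum, Finset.sum_mul, Matrix.mul_smul, Matrix.smul_mul,
      smul_sub, Finset.sum_sub_distrib]
  rw [h1]
  simp only [hC.commutator, smul_sub, smul_smul, Finset.sum_sub_distrib]
  have h2 : ∑ a, ∑ b, (((w a b / 4 : ℝ) : ℂ) * ((2 * minkowski a c : ℝ) : ℂ)) • C b =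
      ∑ b, ((minkowski c c * w c b / 2 : ℝ) : ℂ) • C b := by
    rw [Finset.sum_eq_single c (fun a _ ha => by simp [minkowski_of_ne ha]) (by simp)]
    refine Finset.sum_congr rfl fun b _ => ?_
    congr 1
    push_cast
    ring
  have h3 : ∑ a, ∑ b, (((w a b / 4 : ℝ) : ℂ) * ((2 * minkowski b c : ℝ) : ℂ)) • C a =
      -∑ b, ((minkowski c c * w c b / 2 : ℝ) : ℂ) • C b := by
    rw [← Finset.sum_neg_distrib]
    refine Finset.sum_congr rfl fun a _ => ?_
    rw [Finset.sum_eq_single c (fun b _ hb => by simp [minkowski_of_ne hb]) (by simp), hw a c,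
      ← neg_smul]
    congr 1
    push_cast
    ring
  rw [h2, h3, sub_neg_eq_add, ← Finset.sum_add_distrib]
  refine Finset.sum_congr rfl fun b _ => ?_
  rw [← add_smul]
  congr 1
  push_cast
  ring

end SpinCoefficients

/-! ### Orthonormal frames in coordinates and the parallelism of the Dirac matrices. -/

section SpinFrame

variable {M : Type*} [TopologicalSpace M] [ChartedSpace R4 M] [IsManifold (𝓡 4) ∞ M]
  {g : LorentzMetric M}

/-- The coordinate components of the vectors of the `i`-th spin frame. -/
noncomputable def vielbein (S : SpinStructure g) (φ : Chart M) (i : S.ι) (a : Fin 4) : R4 → R4 :=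
  pushVec φ (S.frame i a)

/-- The spin connection coefficients `g(∇_v e_b, e_a)` in a chart. -/
noncomputable def spinCoeff (S : SpinStructure g) (φ : Chart M) (i : S.ι) (y v : R4)
    (a b : Fin 4) : ℝ :=
  bil (metricMat g φ y) (fderiv ℝ (vielbein S φ i b) y v) (vielbein S φ i a y)
    + christoffelForm (metricMat g φ) y v (vielbein S φ i b y) (vielbein S φ i a y)

/-- The matrices `γ^ν = ∑ₐ e_a^ν Cᵃ` in the `i`-th spin frame and the coordinates `φ`. -/
noncomputable def gammaField (S : SpinStructure g) (C : Fin 4 → SpinMat) (φ : Chart M) (i : S.ι)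
    (ν : Fin 4) (y : R4) : SpinMat :=
  ∑ a, ((vielbein S φ i a y ν : ℝ) : ℂ) • C a

lemma entryDeriv_smul_dir {𝕜 : Type*} [NormedField 𝕜] [NormedAlgebra ℝ 𝕜] {m n : Type*}
    {E : Type*} [NormedAddCommGroup E] [NormedSpace ℝ E]
    (A : E → Matrix m n 𝕜) (y v : E) (c : ℝ) :
    entryDeriv A y (c • v) = c • entryDeriv A y v := by
  ext i j
  simp [entryDeriv_apply]

lemma entryDeriv_add_dir {𝕜 : Type*} [NormedField 𝕜] [NormedAlgebra ℝ 𝕜] {m n : Type*}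
    {E : Type*} [NormedAddCommGroup E] [NormedSpace ℝ E]
    (A : E → Matrix m n 𝕜) (y v w : E) :
    entryDeriv A y (v + w) = entryDeriv A y v + entryDeriv A y w := by
  ext i j
  simp [entryDeriv_apply]

variable {S : SpinStructure g} {φ : Chart M} {i : S.ι} {y : R4}

lemma spinCoeff_add (v w : R4) (a b : Fin 4) :
    spinCoeff S φ i y (v + w) a b = spinCoeff S φ i y v a b + spinCoeff S φ i y w a b := by
  simp only [spinCoeff, christoffelForm, map_add, bil_add_left, entryDeriv_add_dir,
    bil_add_matrix]
  ring

lemma spinCoeff_smul (c : ℝ) (v : R4) (a b : Fin 4) :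
    spinCoeff S φ i y (c • v) a b = c * spinCoeff S φ i y v a b := by
  simp only [spinCoeff, christoffelForm, map_smul, bil_smul_left, entryDeriv_smul_dir,
    bil_smul_matrix]
  ring

lemma spinCoeff_sum (c : Fin 4 → ℝ) (v : Fin 4 → R4) (a b : Fin 4) :
    spinCoeff S φ i y (∑ k, c k • v k) a b = ∑ k, c k * spinCoeff S φ i y (v k) a b := by
  simp only [Fin.sum_univ_four, spinCoeff_add, spinCoeff_smul]

variable (hφ : φ ∈ IsManifold.maximalAtlas (𝓡 4) ∞ M) (hy : y ∈ φ.target)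
  (hi : φ.symm y ∈ S.baseSet i)

lemma smoothFieldAt_frame {x : M} (hx : x ∈ S.baseSet i) (a : Fin 4) :
    SmoothFieldAt (S.frame i a) x :=
  (S.contMDiffOn_frame i a).contMDiffAt ((S.isOpen_baseSet i).mem_nhds hx)

include hy hi

lemma eventually_mem_baseSet : ∀ᶠ z in 𝓝 y, z ∈ φ.target ∧ φ.symm z ∈ S.baseSet i :=
  (φ.open_target.eventually_mem hy).and
    ((φ.continuousAt_symm hy).eventually ((S.isOpen_baseSet i).eventually_mem hi))

include hφ

lemma contDiffAt_vielbein (a : Fin 4) : ContDiffAt ℝ ∞ (vielbein S φ i a) y :=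
  contDiffAt_pushVec hφ hy (smoothFieldAt_frame hi a)

lemma isOrthoFrame_vielbein : IsOrthoFrame (metricMat g φ y) fun a => vielbein S φ i a y := by
  intro a b
  rw [← S.orthonormal i _ hi a b, metric_eq_bil g hφ hy]
  rfl

lemma det_metricMat_neg : (metricMat g φ y).det < 0 := (isOrthoFrame_vielbein hφ hy hi).det_neg

lemma isUnit_det_metricMat : IsUnit (metricMat g φ y).det :=
  isUnit_iff_ne_zero.2 (det_metricMat_neg hφ hy hi).ne

/-- Metric compatibility: differentiate the constant function `g(e_a, e_b)`. The last two terms of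
the Christoffel form are already antisymmetric in the frame indices. -/
lemma spinCoeff_antisymm (v : R4) (a b : Fin 4) :
    spinCoeff S φ i y v a b = -spinCoeff S φ i y v b a := by
  have hev : (fun z => bil (metricMat g φ z) (vielbein S φ i a z) (vielbein S φ i b z)) =ᶠ[𝓝 y]
      fun _ => minkowski a b := by
    filter_upwards [eventually_mem_baseSet hy hi] with z hz
    exact isOrthoFrame_vielbein hφ hz.1 hz.2 a b
  have h0 := fderiv_bil (entrySmoothAt_metricMat hφ g hy).entryDiffAt
    ((contDiffAt_vielbein hφ hy hi a).differentiableAt (by simp))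
    ((contDiffAt_vielbein hφ hy hi b).differentiableAt (by simp)) v
  rw [hev.fderiv_eq] at h0
  simp only [fderiv_fun_const, Pi.zero_apply, _root_.zero_apply] at h0
  rw [spinCoeff, spinCoeff, christoffelForm, christoffelForm,
    bil_comm (metricMat_symm g y) (fderiv ℝ (vielbein S φ i b) y v),
    bil_comm (entryDeriv_metricMat_symm g φ y v) (vielbein S φ i b y)]
  linarith

/-- The Koszul expression takes vector fields, so the connection form expands `X` in the frame. In a
chart the coefficients depend linearly on the direction, and the expansion can be summed up again.
-/
lemma connForm_eq (X : TangentSpace (𝓡 4) (φ.symm y)) :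
    S.connForm i (φ.symm y) X =
      spinForm diracGamma (spinCoeff S φ i y (mvfderiv (𝓡 4) φ (φ.symm y) X)) := by
  refine Finset.sum_congr rfl fun a _ => Finset.sum_congr rfl fun b _ => ?_
  rw [← Finset.sum_smul, ← Complex.ofReal_sum]
  congr 2
  have h1 := (isOrthoFrame_vielbein hφ hy hi).eq_sum (mvfderiv (𝓡 4) φ (φ.symm y) X)
  rw [h1, spinCoeff_sum, Finset.sum_div]
  refine Finset.sum_congr rfl fun c _ => ?_
  rw [leviCivita_eq g hφ hy (smoothFieldAt_frame hi c) (smoothFieldAt_frame hi b)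
    (smoothFieldAt_frame hi a), metric_eq_bil g hφ hy]
  rfl

/-- The left side is the coordinate expression of `∇_v e_b`; its components in the orthonormal frame
are `η_aa g(∇_v e_b, e_a)`. -/
lemma fderiv_vielbein (v : R4) (b : Fin 4) :
    fderiv ℝ (vielbein S φ i b) y v + christoffelVec g φ y v (vielbein S φ i b y) =
      ∑ a, (minkowski a a * spinCoeff S φ i y v a b) • vielbein S φ i a y := by
  have hs := metricMat_symm g (φ := φ) y
  rw [(isOrthoFrame_vielbein hφ hy hi).eq_sum (fderiv ℝ (vielbein S φ i b) y v +
    christoffelVec g φ y v (vielbein S φ i b y))]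
  refine Finset.sum_congr rfl fun a _ => ?_
  congr 2
  rw [bil_comm hs, bil_add_left, bil_christoffelVec g (isUnit_det_metricMat hφ hy hi), spinCoeff]

lemma fderiv_vielbein_apply (μ ν b : Fin 4) :
    fderiv ℝ (fun z => vielbein S φ i b z ν) y (stdVec μ) =
      ∑ a, minkowski a a * spinCoeff S φ i y (stdVec μ) a b * vielbein S φ i a y ν
        - ∑ l, christoffel g φ y ν μ l * vielbein S φ i b y l := by
  rw [fderiv_coord_comp ((contDiffAt_vielbein hφ hy hi b).differentiableAt (by simp)),
    eq_sub_iff_add_eq]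
  have h := congrArg (fun u : R4 => u ν) (fderiv_vielbein hφ hy hi (stdVec μ) b)
  simp only [PiLp.add_apply, christoffelVec_apply, WithLp.ofLp_sum, Finset.sum_apply,
    PiLp.smul_apply, smul_eq_mul, stdVec_apply, mul_ite, mul_one, mul_zero, ite_mul, zero_mul,
    Finset.sum_ite_irrel, Finset.sum_const_zero, Finset.sum_ite_eq', Finset.mem_univ, if_true] at h
  exact h

variable (C : Fin 4 → SpinMat)

lemma entrySmoothAt_gammaField (ν : Fin 4) : EntrySmoothAt (gammaField S C φ i ν) y :=
  .sum fun a _ => .smul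
    (contDiffAt_ofReal_comp (contDiffAt_coord_comp (contDiffAt_vielbein hφ hy hi a) ν))
    (.const _ _)

variable {C}

lemma gammaField_clifford (hC : IsClifford C) (μ ν : Fin 4) :
    gammaField S C φ i μ y * gammaField S C φ i ν y
      + gammaField S C φ i ν y * gammaField S C φ i μ y =
      ((2 * (metricMat g φ y)⁻¹ μ ν : ℝ) : ℂ) • (1 : SpinMat) := by
  have h1 : gammaField S C φ i μ y * gammaField S C φ i ν y
      + gammaField S C φ i ν y * gammaField S C φ i μ y =
      ∑ a, ∑ b, ((vielbein S φ i a y μ * vielbein S φ i b y ν : ℝ) : ℂ) •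
        (C a * C b + C b * C a) := by
    simp only [gammaField, Finset.mul_sum, Finset.sum_mul, smul_add, Finset.sum_add_distrib,
      Matrix.mul_smul, Matrix.smul_mul, smul_smul]
    congr 1
    · rw [Finset.sum_comm]
      refine Finset.sum_congr rfl fun a _ => Finset.sum_congr rfl fun b _ => ?_
      congr 1; push_cast; ring
    · refine Finset.sum_congr rfl fun a _ => Finset.sum_congr rfl fun b _ => ?_
      congr 1; push_cast; ring
  rw [h1, (isOrthoFrame_vielbein hφ hy hi).inv_eq μ ν]
  simp only [hC _ _, smul_smul, ← Finset.sum_smul]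
  congr 1
  push_cast
  rw [Finset.mul_sum]
  refine Finset.sum_congr rfl fun a _ => ?_
  rw [Finset.sum_eq_single a (fun b _ hb => by simp [minkowski_of_ne hb.symm]) (by simp)]
  ring

/-- The Dirac matrices are parallel. -/
lemma gammaField_parallel (hC : IsClifford C) (μ ν : Fin 4) :
    entryDeriv (gammaField S C φ i ν) y (stdVec μ) =
      gammaField S C φ i ν y * spinForm C (spinCoeff S φ i y (stdVec μ))
        - spinForm C (spinCoeff S φ i y (stdVec μ)) * gammaField S C φ i ν y
        - ∑ l, ((christoffel g φ y ν μ l : ℝ) : ℂ) • gammaField S C φ i l y := by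
  have hd (a : Fin 4) : DifferentiableAt ℝ (fun z => vielbein S φ i a z ν) y :=
    (contDiffAt_coord_comp (contDiffAt_vielbein hφ hy hi a) ν).differentiableAt (by simp)
  have hdc (a : Fin 4) : DifferentiableAt ℝ (fun z => ((vielbein S φ i a z ν : ℝ) : ℂ)) y :=
    (contDiffAt_ofReal_comp (contDiffAt_coord_comp (contDiffAt_vielbein hφ hy hi a) ν)
      ).differentiableAt (by simp)
  have hc (a : Fin 4) : EntryDiffAt (fun _ : R4 => C a) y := (EntrySmoothAt.const _ _).entryDiffAt
  have h1 : entryDeriv (gammaField S C φ i ν) y (stdVec μ) =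
      ∑ b, ((fderiv ℝ (fun z => vielbein S φ i b z ν) y (stdVec μ) : ℝ) : ℂ) • C b := by
    unfold gammaField
    rw [entryDeriv_sum _ fun a _ => EntryDiffAt.smul (hdc a) (hc a)]
    refine Finset.sum_congr rfl fun b _ => ?_
    rw [entryDeriv_smul (hdc b) (hc b), entryDeriv_const, smul_zero, zero_add,
      fderiv_ofReal_comp (hd b)]
  -- The derivative of `e_b^ν` consists of a rotation of the frame and a Christoffel term. The
  -- rotation is the commutator with the spin connection form.
  have h2 : gammaField S C φ i ν y * spinForm C (spinCoeff S φ i y (stdVec μ))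
      - spinForm C (spinCoeff S φ i y (stdVec μ)) * gammaField S C φ i ν y =
      ∑ b, ((∑ a, minkowski a a * spinCoeff S φ i y (stdVec μ) a b * vielbein S φ i a y ν : ℝ) : ℂ) •
        C b := by
    simp only [gammaField, Finset.sum_mul, Finset.mul_sum, Matrix.smul_mul, Matrix.mul_smul,
      ← Finset.sum_sub_distrib, ← smul_sub,
      commutator_spinForm hC (spinCoeff_antisymm hφ hy hi (stdVec μ)), Complex.ofReal_sum,
      Finset.sum_smul, Finset.smul_sum, smul_smul]
    rw [Finset.sum_comm]
    refine Finset.sum_congr rfl fun b _ => Finset.sum_congr rfl fun a _ => ?_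
    congr 1
    push_cast
    ring
  have h3 : ∑ l, ((christoffel g φ y ν μ l : ℝ) : ℂ) • gammaField S C φ i l y =
      ∑ b, ((∑ l, christoffel g φ y ν μ l * vielbein S φ i b y l : ℝ) : ℂ) • C b := by
    simp only [gammaField, Finset.smul_sum, smul_smul, Complex.ofReal_sum, Finset.sum_smul]
    rw [Finset.sum_comm]
    simp only [Complex.ofReal_mul]
  rw [h1, h2, h3, ← Finset.sum_sub_distrib]
  refine Finset.sum_congr rfl fun b _ => ?_
  rw [fderiv_vielbein_apply hφ hy hi, Complex.ofReal_sub, sub_smul]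

lemma contDiffAt_spinCoeff (v : R4) (a b : Fin 4) :
    ContDiffAt ℝ ∞ (fun z => spinCoeff S φ i z v a b) y := by
  have he := contDiffAt_vielbein hφ hy hi
  have hG := entrySmoothAt_metricMat hφ g hy
  have hD : ContDiffAt ℝ ∞ (fun z => fderiv ℝ (vielbein S φ i b) z v) y :=
    ((he b).fderiv_right (m := ∞) (by simp)).clm_apply contDiffAt_const
  have hdG (f : R4 → R4) (hf : ContDiffAt ℝ ∞ f y) :
      EntrySmoothAt (fun z => entryDeriv (metricMat g φ) z (f z)) y := fun c d =>
    ((hG c d).fderiv_right (m := ∞) (by simp)).clm_apply hf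
  exact (contDiffAt_bil hG hD (he a)).add
    ((((contDiffAt_bil (hdG _ contDiffAt_const) (he b) (he a)).add
      (contDiffAt_bil (hdG _ (he b)) contDiffAt_const (he a))).sub
      (contDiffAt_bil (hdG _ (he a)) contDiffAt_const (he b))).div_const 2)

lemma entrySmoothAt_spinForm (C : Fin 4 → SpinMat) (v : R4) :
    EntrySmoothAt (fun z => spinForm C (spinCoeff S φ i z v)) y :=
  .sum fun a _ => .sum fun b _ => .smul
    (contDiffAt_ofReal_comp ((contDiffAt_spinCoeff hφ hy hi v a b).div_const 4)) (.const _ _)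

end SpinFrame

/-! ## Change of the local frame -/

section Gauge

/-- The connection coefficients `F⁻¹ (∂_μ F + Ω_μ F)` of `∂_μ + Ω_μ` in the frame given by the
columns of `F`. -/
noncomputable def gaugeConn (F : R4 → SpinMat) (Ω : Fin 4 → R4 → SpinMat) (μ : Fin 4) (y : R4) :
    SpinMat :=
  (F y)⁻¹ * (entryDeriv F y (stdVec μ) + Ω μ y * F y)

variable {F : R4 → SpinMat} {Ω γ : Fin 4 → R4 → SpinMat} {y : R4}

/-- Gauge covariance of the parallelism relation: the inhomogeneous term `F⁻¹ ∂_μ F` of the new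
connection absorbs the derivatives of `F` and of `F⁻¹`. -/
lemma parallel_conj {Γ : Fin 4 → Fin 4 → Fin 4 → ℝ} (hF : EntrySmoothAt F y)
    (hu : IsUnit (F y).det) (hγ : ∀ ν, EntrySmoothAt (γ ν) y) (μ ν : Fin 4)
    (hp : entryDeriv (γ ν) y (stdVec μ) =
      γ ν y * Ω μ y - Ω μ y * γ ν y - ∑ l, ((Γ ν μ l : ℝ) : ℂ) • γ l y) :
    entryDeriv (fun z => (F z)⁻¹ * γ ν z * F z) y (stdVec μ) =
      (F y)⁻¹ * γ ν y * F y * gaugeConn F Ω μ y - gaugeConn F Ω μ y * ((F y)⁻¹ * γ ν y * F y)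
        - ∑ l, ((Γ ν μ l : ℝ) : ℂ) • ((F y)⁻¹ * γ l y * F y) := by
  have h1 : ∑ l, ((Γ ν μ l : ℝ) : ℂ) • ((F y)⁻¹ * γ l y * F y) =
      (F y)⁻¹ * (∑ l, ((Γ ν μ l : ℝ) : ℂ) • γ l y) * F y := by
    simp only [Finset.mul_sum, Finset.sum_mul, Matrix.mul_smul, Matrix.smul_mul]
  have h2 (X : SpinMat) : F y * ((F y)⁻¹ * X) = X := Matrix.mul_nonsing_inv_cancel_left _ _ hu
  rw [entryDeriv_mul ((hF.inv hu).mul (hγ ν)).entryDiffAt hF.entryDiffAt,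
    entryDeriv_mul (hF.inv hu).entryDiffAt (hγ ν).entryDiffAt, entryDeriv_inv hF hu, h1, hp]
  simp only [gaugeConn, Matrix.mul_add, Matrix.add_mul, Matrix.mul_sub, Matrix.sub_mul,
    Matrix.neg_mul, Matrix.mul_assoc, h2]
  abel

/-- Conjugating a traceless form keeps it traceless, and `tr (F⁻¹ ∂_μ F)` is the logarithmic
derivative of `det F`. -/
lemma trace_gaugeConn (hF : EntryDiffAt F y) (hu : IsUnit (F y).det) (μ : Fin 4)
    (hΩ : (Ω μ y).trace = 0) :
    (F y).det * (gaugeConn F Ω μ y).trace = fderiv ℝ (fun z => (F z).det) y (stdVec μ) := by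
  rw [fderiv_det_of_isUnit hF hu, gaugeConn, Matrix.mul_add, Matrix.trace_add,
    Matrix.trace_mul_comm _ (Ω μ y * F y), Matrix.mul_assoc, Matrix.mul_nonsing_inv _ hu,
    Matrix.mul_one, hΩ, add_zero]

lemma HasScalarCommutant.conj {C : Fin 4 → SpinMat} (hC : HasScalarCommutant C) {A : SpinMat}
    (hA : IsUnit A.det) : HasScalarCommutant fun ν => A⁻¹ * C ν * A := by
  intro B hB
  obtain ⟨c, hc⟩ := hC (A * B * A⁻¹) fun a => by
    have h := congrArg (fun X => A * X * A⁻¹) (hB a)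
    simpa only [Matrix.mul_assoc, Matrix.mul_nonsing_inv _ hA, Matrix.mul_one,
      Matrix.mul_nonsing_inv_cancel_left _ _ hA] using h
  refine ⟨c, ?_⟩
  have h := congrArg (fun X => A⁻¹ * X * A) hc
  simpa only [Matrix.mul_assoc, Matrix.nonsing_inv_mul _ hA, Matrix.mul_one,
    Matrix.nonsing_inv_mul_cancel_left _ _ hA, Matrix.mul_smul, Matrix.smul_mul] using h

/-- A traceless matrix is determined by its commutators with an irreducible set of matrices. -/
lemma HasScalarCommutant.eq_of_commutator_eq {C : Fin 4 → SpinMat} (hC : HasScalarCommutant C)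
    {A B : SpinMat} (hAB : ∀ a, C a * A - A * C a = C a * B - B * C a) (ht : A.trace = B.trace) :
    A = B := by
  obtain ⟨c, hc⟩ := hC (A - B) fun a => by
    rw [Matrix.sub_mul, Matrix.mul_sub, sub_eq_sub_iff_add_eq_add]
    have := hAB a
    rw [sub_eq_sub_iff_add_eq_add] at this
    rw [add_comm, ← this, add_comm]
  have h := congrArg Matrix.trace hc
  rw [Matrix.trace_sub, ht, sub_self, Matrix.trace_smul, Matrix.trace_one] at h
  have hc0 : c = 0 := by
    simpa using h.symm
  rw [hc0, zero_smul] at hc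
  exact sub_eq_zero.1 hc

lemma trace_spinForm {C : Fin 4 → SpinMat} {w : Fin 4 → Fin 4 → ℝ} (hw : ∀ a b, w a b = -w b a) :
    (spinForm C w).trace = 0 := by
  have h : (spinForm C w).trace = -(spinForm C w).trace := by
    simp only [spinForm, Matrix.trace_sum, Matrix.trace_smul, ← Finset.sum_neg_distrib]
    rw [Finset.sum_comm]
    refine Finset.sum_congr rfl fun a _ => Finset.sum_congr rfl fun b _ => ?_
    rw [hw b a, Matrix.trace_mul_comm, neg_div, Complex.ofReal_neg, neg_smul]
  exact self_eq_neg.1 h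

/-- Transposition reverses `CᵃCᵇ`, and antisymmetry of `w` turns the reversal into a sign. The dual
connection `v ↦ dv - v Ω` is therefore of the same form as the original one. -/
lemma spinForm_neg_transpose {C : Fin 4 → SpinMat} {w : Fin 4 → Fin 4 → ℝ}
    (hw : ∀ a b, w a b = -w b a) :
    spinForm (fun a => -(C a).transpose) w = -(spinForm C w).transpose := by
  simp only [spinForm, Matrix.transpose_sum, ← Finset.sum_neg_distrib, Matrix.transpose_smul,
    Matrix.transpose_mul, Matrix.neg_mul, Matrix.mul_neg, neg_neg]
  rw [Finset.sum_comm]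
  refine Finset.sum_congr rfl fun a _ => Finset.sum_congr rfl fun b _ => ?_
  rw [hw b a, neg_div, Complex.ofReal_neg, neg_smul]

end Gauge

/-! ### Irreducibility of the coordinate Dirac matrices. -/

section SpinFrame

variable {M : Type*} [TopologicalSpace M] [ChartedSpace R4 M] [IsManifold (𝓡 4) ∞ M]
  {g : LorentzMetric M} {S : SpinStructure g} {φ : Chart M} {i : S.ι} {y : R4}

/-- Pairing with the frame vectors through the metric recovers the constant matrices as combinations
of the `γ^ν`, so both families have the same commutant. -/
lemma hasScalarCommutant_gammaField (hφ : φ ∈ IsManifold.maximalAtlas (𝓡 4) ∞ M)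
    (hy : y ∈ φ.target) (hi : φ.symm y ∈ S.baseSet i) {C : Fin 4 → SpinMat}
    (hC : HasScalarCommutant C) : HasScalarCommutant fun ν => gammaField S C φ i ν y := by
  have he := isOrthoFrame_vielbein hφ hy hi
  have key (b : Fin 4) : C b = ∑ ν, ((minkowski b b *
      ∑ μ, metricMat g φ y μ ν * vielbein S φ i b y μ : ℝ) : ℂ) • gammaField S C φ i ν y := by
    have h (a : Fin 4) : ∑ ν, (minkowski b b * ∑ μ, metricMat g φ y μ ν * vielbein S φ i b y μ) *
        vielbein S φ i a y ν = if a = b then 1 else 0 := by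
      have h1 := he b a
      simp only [bil] at h1
      rw [Finset.sum_comm] at h1
      simp only [mul_assoc, ← Finset.mul_sum, Finset.sum_mul]
      simp only [mul_assoc] at h1
      rw [h1]
      split_ifs with hab
      · rw [hab, minkowski_sq]
      · rw [minkowski_of_ne (Ne.symm hab), mul_zero]
    simp only [gammaField, Finset.smul_sum, smul_smul]
    rw [Finset.sum_comm]
    simp only [← Finset.sum_smul, ← Complex.ofReal_mul, ← Complex.ofReal_sum, h]
    simp
  intro B hB
  refine hC B fun b => ?_
  rw [key b]
  simp only [Finset.mul_sum, Finset.sum_mul, Matrix.mul_smul, Matrix.smul_mul, hB]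

end SpinFrame

/-! ## The Dirac bundle and its dual in a chart and a local frame -/

section SpinBundle

variable {M : Type*} [TopologicalSpace M] [ChartedSpace R4 M] [IsManifold (𝓡 4) ∞ M]
  {g : LorentzMetric M}

/-- `Z` is a spinor bundle: its coordinate changes `R` intertwine the Clifford multiplications which
are given by the constant matrices `C` in the spin frames. -/
structure IsSpinBundle (S : SpinStructure g) (Z : VectorBundleCore ℂ M Spinor S.ι)
    (C : Fin 4 → SpinMat) (R : S.ι → S.ι → M → SpinMat) : Prop where
  baseSet_eq : ∀ i, Z.baseSet i = S.baseSet i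
  indexAt_eq : ∀ x, Z.indexAt x = S.indexAt x
  coordChange_eq : ∀ i j x v, Z.coordChange i j x v = (R i j x).mulVec v
  det_eq : ∀ i j x, (R i j x).det = 1
  intertwine : ∀ i j, ∀ x ∈ S.baseSet i ∩ S.baseSet j, ∀ ξ : TangentSpace (𝓡 4) x →L[ℝ] ℝ,
    R i j x * ∑ a, ((ξ (S.frame i a x) : ℝ) : ℂ) • C a =
      (∑ a, ((ξ (S.frame j a x) : ℝ) : ℂ) • C a) * R i j x
  clifford : IsClifford C
  commutant : HasScalarCommutant C

/-- `D` is the connection `d + ¼ ∑ g(∇e_b, e_a) Cᵃ Cᵇ` in the preferred spin frames. -/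
def IsSpinConnection (S : SpinStructure g) (Z : VectorBundleCore ℂ M Spinor S.ι)
    (C : Fin 4 → SpinMat) (D : Sec Z → (x : M) → TangentSpace (𝓡 4) x → Z.Fiber x) : Prop :=
  ∀ φ ∈ IsManifold.maximalAtlas (𝓡 4) ∞ M, ∀ y ∈ φ.target, ∀ (ψ : Sec Z)
    (X : TangentSpace (𝓡 4) (φ.symm y)),
    comps Z (φ.symm y) (D ψ (φ.symm y) X) =
      mvfderiv (𝓡 4) (inTriv Z (S.indexAt (φ.symm y)) ψ) (φ.symm y) X
        + (spinForm C (spinCoeff S φ (S.indexAt (φ.symm y)) y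
            (mvfderiv (𝓡 4) φ (φ.symm y) X))).mulVec (comps Z (φ.symm y) (ψ (φ.symm y)))

/-- `P` is the operator `-i ∑ₐ Cᵃ D_{e_a} + m`. -/
def IsDiracOperator (S : SpinStructure g) (Z : VectorBundleCore ℂ M Spinor S.ι)
    (C : Fin 4 → SpinMat) (D : Sec Z → (x : M) → TangentSpace (𝓡 4) x → Z.Fiber x) (m : ℝ)
    (P : Sec Z → Sec Z) : Prop :=
  ∀ ψ x, comps Z x (P ψ x) =
    -Complex.I • ∑ a, (C a).mulVec (comps Z x (D ψ x (S.frame (S.indexAt x) a x)))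
      + (m : ℂ) • comps Z x (ψ x)

section

variable {ι : Type*}

/-- The matrix whose columns are the vectors of a local frame in the `i`-th trivialization. -/
noncomputable def frameIn (Z : VectorBundleCore ℂ M Spinor ι) (i : ι) (s : SpinIdx → Sec Z) (x : M) : SpinMat :=
  Matrix.of fun c b => inTriv Z i (s b) x c

omit [ChartedSpace R4 M] [IsManifold (𝓡 4) ∞ M] in
lemma inTriv_eq (Z : VectorBundleCore ℂ M Spinor ι) (i : ι) (ψ : Sec Z) (x : M) :
    inTriv Z i ψ x = Z.coordChange (Z.indexAt x) i x (comps Z x (ψ x)) := rfl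

end

variable {S : SpinStructure g} {Z : VectorBundleCore ℂ M Spinor S.ι} {C : Fin 4 → SpinMat}
  {R : S.ι → S.ι → M → SpinMat} {D : Sec Z → (x : M) → TangentSpace (𝓡 4) x → Z.Fiber x}
  {φ : Chart M} {s : SpinIdx → Sec Z} {U : Set M} {i j : S.ι} {x : M} {y : R4}

variable (S C φ s) in
/-- The matrices `γ^ν` of Clifford multiplication by `dx^ν` in the local frame. -/
noncomputable def localGamma (ν : Fin 4) (y : R4) : SpinMat :=
  inFrame s (φ.symm y) (gammaField S C φ (S.indexAt (φ.symm y)) ν y)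

variable (S C φ s) in
/-- The matrices of the spin connection in the local frame, computed from the `i`-th spin frame. -/
noncomputable def localConn (i : S.ι) : Fin 4 → R4 → SpinMat :=
  gaugeConn (fun y => frameIn Z i s (φ.symm y))
    (fun μ y => spinForm C (spinCoeff S φ i y (stdVec μ)))

namespace IsSpinBundle

variable (h : IsSpinBundle S Z C R)
include h

lemma frameIn_eq (i : S.ι) (s : SpinIdx → Sec Z) (x : M) :
    frameIn Z i s x = R (S.indexAt x) i x * frameMat s x := by
  ext c b
  rw [frameIn, Matrix.of_apply, inTriv_eq, h.indexAt_eq, h.coordChange_eq]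
  rfl

lemma det_frameIn (i : S.ι) (s : SpinIdx → Sec Z) (x : M) :
    (frameIn Z i s x).det = (frameMat s x).det := by
  rw [h.frameIn_eq, Matrix.det_mul, h.det_eq, one_mul]

lemma frameIn_indexAt (s : SpinIdx → Sec Z) (x : M) :
    frameIn Z (S.indexAt x) s x = frameMat s x := by
  ext c b
  have h1 := Z.coordChange_self (Z.indexAt x) x (Z.mem_baseSet_at x) (comps Z x (s b x))
  rw [frameIn, Matrix.of_apply, inTriv_eq, ← h.indexAt_eq, h1]
  rfl

lemma isUnit_det_frameIn (hs : IsFrameOn s U) (hx : x ∈ U) (i : S.ι) :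
    IsUnit (frameIn Z i s x).det := by
  rw [h.det_frameIn]
  exact hs.isUnit x hx

lemma isUnit_det (i j : S.ι) (x : M) : IsUnit (R i j x).det := by
  rw [h.det_eq]
  exact isUnit_one

lemma intertwine_gammaField (hi : φ.symm y ∈ S.baseSet i) (hj : φ.symm y ∈ S.baseSet j)
    (ν : Fin 4) :
    R i j (φ.symm y) * gammaField S C φ i ν y = gammaField S C φ j ν y * R i j (φ.symm y) :=
  h.intertwine i j _ ⟨hi, hj⟩ (coordCovec φ ν (φ.symm y))

/-- The transition matrices intertwine Clifford multiplication, so any spin frame may replace the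
preferred one. This is needed because the preferred index can vary discontinuously; derivatives are
taken with `i` held fixed. -/
lemma localGamma_eq (hi : φ.symm y ∈ S.baseSet i) (ν : Fin 4) :
    localGamma S C φ s ν y =
      (frameIn Z i s (φ.symm y))⁻¹ * gammaField S C φ i ν y * frameIn Z i s (φ.symm y) := by
  have hu := h.isUnit_det (S.indexAt (φ.symm y)) i (φ.symm y)
  rw [localGamma, inFrame, h.frameIn_eq, Matrix.mul_inv_rev, Matrix.mul_assoc, Matrix.mul_assoc,
    Matrix.mul_assoc]
  congr 1
  rw [← Matrix.mul_assoc (gammaField S C φ i ν y), ← h.intertwine_gammaField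
    (S.mem_baseSet_at _) hi, Matrix.mul_assoc, Matrix.nonsing_inv_mul_cancel_left _ _ hu]

variable (hφ : φ ∈ IsManifold.maximalAtlas (𝓡 4) ∞ M) (hs : IsFrameOn s U)
  (hy : y ∈ φ.target) (hyU : φ.symm y ∈ U)
include hφ hs hy hyU

lemma entrySmoothAt_frameIn (hi : φ.symm y ∈ S.baseSet i) :
    EntrySmoothAt (fun y => frameIn Z i s (φ.symm y)) y := by
  have hi' : φ.symm y ∈ Z.baseSet i := by rwa [h.baseSet_eq]
  intro c b
  have h1 := (hs.contMDiffOn b i).contMDiffAt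
    ((hs.isOpen.inter (Z.isOpen_baseSet i)).mem_nhds ⟨hyU, hi'⟩)
  exact contDiffAt_pi.1 (contDiffAt_comp_chart_symm hφ hy h1) c

omit hφ hs hyU in
lemma eventually_localGamma_eq (hi : φ.symm y ∈ S.baseSet i) (ν : Fin 4) :
    localGamma S C φ s ν =ᶠ[𝓝 y] fun y =>
      (frameIn Z i s (φ.symm y))⁻¹ * gammaField S C φ i ν y * frameIn Z i s (φ.symm y) := by
  filter_upwards [eventually_mem_baseSet hy hi] with z hz
  exact h.localGamma_eq hz.2 ν

lemma entrySmoothAt_localGamma (ν : Fin 4) : EntrySmoothAt (localGamma S C φ s ν) y := by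
  have hi := S.mem_baseSet_at (φ.symm y)
  have hF := h.entrySmoothAt_frameIn hφ hs hy hyU hi
  exact (((hF.inv (h.isUnit_det_frameIn hs hyU _)).mul
    (entrySmoothAt_gammaField hφ hy hi C ν)).mul hF).congr
      (h.eventually_localGamma_eq hy hi ν)

lemma localGamma_parallel (hi : φ.symm y ∈ S.baseSet i) (μ ν : Fin 4) :
    entryDeriv (localGamma S C φ s ν) y (stdVec μ) =
      localGamma S C φ s ν y * localConn S C φ s i μ y
        - localConn S C φ s i μ y * localGamma S C φ s ν y
        - ∑ l, ((christoffel g φ y ν μ l : ℝ) : ℂ) • localGamma S C φ s l y := by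
  have hF := h.entrySmoothAt_frameIn hφ hs hy hyU hi
  rw [entryDeriv_congr (h.eventually_localGamma_eq hy hi ν)]
  simp only [h.localGamma_eq hi]
  exact parallel_conj hF (h.isUnit_det_frameIn hs hyU _)
    (fun ν => entrySmoothAt_gammaField hφ hy hi C ν) μ ν
    (gammaField_parallel hφ hy hi h.clifford μ ν)

lemma localGamma_clifford (μ ν : Fin 4) :
    localGamma S C φ s μ y * localGamma S C φ s ν y
      + localGamma S C φ s ν y * localGamma S C φ s μ y =
      ((2 * (metricMat g φ y)⁻¹ μ ν : ℝ) : ℂ) • (1 : SpinMat) := by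
  have hu := hs.isUnit _ hyU
  have h1 := congrArg (fun X => (frameMat s (φ.symm y))⁻¹ * X * frameMat s (φ.symm y))
    (gammaField_clifford hφ hy (S.mem_baseSet_at (φ.symm y)) h.clifford μ ν)
  simpa only [localGamma, inFrame, Matrix.mul_add, Matrix.add_mul, Matrix.mul_assoc,
    Matrix.mul_nonsing_inv_cancel_left _ _ hu, Matrix.mul_smul, Matrix.smul_mul, Matrix.one_mul,
    Matrix.nonsing_inv_mul _ hu] using h1

/-- Parallelism expresses the commutators of either connection matrix with the same irreducible
`γ^ν` by the same data, so the two matrices differ by a scalar. Equality of their traces makes the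
scalar zero. -/
lemma localConn_eq (hi : φ.symm y ∈ S.baseSet i) (hj : φ.symm y ∈ S.baseSet j) (μ : Fin 4) :
    localConn S C φ s i μ y = localConn S C φ s j μ y := by
  have hc : HasScalarCommutant fun ν => localGamma S C φ s ν y := by
    simp only [h.localGamma_eq hi]
    exact (hasScalarCommutant_gammaField hφ hy hi h.commutant).conj
      (h.isUnit_det_frameIn hs hyU _)
  refine hc.eq_of_commutator_eq (fun ν => ?_) ?_
  · have h1 := h.localGamma_parallel hφ hs hy hyU hi μ ν
    rw [h.localGamma_parallel hφ hs hy hyU hj μ ν] at h1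
    exact (sub_left_injective h1).symm
  -- The transition matrices have determinant one, so the determinant of the frame, and with it the
  -- trace of the connection, does not depend on the trivialization.
  · have ht {k : S.ι} (hk : φ.symm y ∈ S.baseSet k) :
        (frameMat s (φ.symm y)).det * (localConn S C φ s k μ y).trace =
          fderiv ℝ (fun z => (frameMat s (φ.symm z)).det) y (stdVec μ) := by
      have := trace_gaugeConn (Ω := fun μ y => spinForm C (spinCoeff S φ k y (stdVec μ)))
        (h.entrySmoothAt_frameIn hφ hs hy hyU hk).entryDiffAt
        (h.isUnit_det_frameIn hs hyU _) μ
        (trace_spinForm (spinCoeff_antisymm hφ hy hk (stdVec μ)))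
      simp only [h.det_frameIn] at this
      exact this
    exact mul_left_cancel₀ (hs.isUnit _ hyU).ne_zero ((ht hi).trans (ht hj).symm)

lemma mvfderiv_inTriv (hi : φ.symm y ∈ S.baseSet i) (b : SpinIdx)
    (X : TangentSpace (𝓡 4) (φ.symm y)) (c : SpinIdx) :
    mvfderiv (𝓡 4) (inTriv Z i (s b)) (φ.symm y) X c =
      entryDeriv (fun y => frameIn Z i s (φ.symm y)) y (mvfderiv (𝓡 4) φ (φ.symm y) X) c b := by
  have hi' : φ.symm y ∈ Z.baseSet i := by rwa [h.baseSet_eq]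
  have h1 := (hs.contMDiffOn b i).contMDiffAt
    ((hs.isOpen.inter (Z.isOpen_baseSet i)).mem_nhds ⟨hyU, hi'⟩)
  rw [mvfderiv_eq_fderiv_chart hφ hy (h1.mdifferentiableAt (by simp))]
  have h2 := (contDiffAt_comp_chart_symm hφ hy h1).differentiableAt (by simp)
  rw [entryDeriv_apply]
  exact (congrArg (fun L : R4 →L[ℝ] ℂ => L (mvfderiv (𝓡 4) φ (φ.symm y) X))
    (fderiv_apply h2 c)).symm

lemma connMat_eq (hD : IsSpinConnection S Z C D) (hi : φ.symm y ∈ S.baseSet i) (μ : Fin 4) :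
    connMat D φ s μ y = localConn S C φ s i μ y := by
  have hi₀ := S.mem_baseSet_at (φ.symm y)
  rw [h.localConn_eq hφ hs hy hyU hi hi₀, localConn, gaugeConn, connMat, h.frameIn_indexAt]
  congr 1
  ext c b
  rw [Matrix.of_apply, hD φ hφ y hy, Pi.add_apply, h.mvfderiv_inTriv hφ hs hy hyU hi₀,
    mvfderiv_coordVec hφ (φ.map_target hy)]
  rfl

/-- Near `y` the preferred index is replaced by its value at `y`; the resulting expression involves
only one smooth spin frame. -/
lemma entrySmoothAt_connMat (hD : IsSpinConnection S Z C D) (μ : Fin 4) :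
    EntrySmoothAt (connMat D φ s μ) y := by
  have hi := S.mem_baseSet_at (φ.symm y)
  have hF := h.entrySmoothAt_frameIn hφ hs hy hyU hi
  refine ((hF.inv (h.isUnit_det_frameIn hs hyU _)).mul ((hF.entryDeriv (stdVec μ)).add
    ((entrySmoothAt_spinForm hφ hy hi C (stdVec μ)).mul hF))).congr ?_
  filter_upwards [eventually_mem_baseSet hy hi,
    (φ.continuousAt_symm hy).eventually (hs.isOpen.eventually_mem hyU)] with z hz hzU
  exact h.connMat_eq hφ hs hz.1 hzU hD hz.2 μ

omit hy hyU in
lemma isDiracType (hD : IsSpinConnection S Z C D) (hU : U ⊆ φ.source) :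
    IsDiracType (φ '' U) (localGamma S C φ s) (connMat D φ s) (fun y => (metricMat g φ y)⁻¹)
      (sqrtNegDet g φ) (christoffel g φ) := by
  have hy {y : R4} (hyU : y ∈ φ '' U) : y ∈ φ.target ∧ φ.symm y ∈ U := by
    obtain ⟨x, hx, rfl⟩ := hyU
    exact ⟨φ.map_source (hU hx), by rwa [φ.left_inv (hU hx)]⟩
  have hd {y : R4} (hyU : y ∈ φ '' U) : (metricMat g φ y).det < 0 :=
    det_metricMat_neg hφ (hy hyU).1 (S.mem_baseSet_at (φ.symm y))
  refine
    { isOpen := φ.isOpen_image_of_subset_source hs.isOpen hU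
      smooth_γ := fun y hyU => h.entrySmoothAt_localGamma hφ hs (hy hyU).1 (hy hyU).2
      smooth_H := fun y hyU => (entrySmoothAt_metricMat hφ g (hy hyU).1).inv
        (isUnit_iff_ne_zero.2 (hd hyU).ne)
      smooth_r := fun y hyU => contDiffAt_sqrtNegDet g hφ (hy hyU).1 (hd hyU)
      r_pos := fun y hyU => Real.sqrt_pos.2 (neg_pos.2 (hd hyU))
      symm_H := fun y hyU μ ν => ?_
      isUnit_H := fun y hyU => (Matrix.isUnit_nonsing_inv_det_iff).2
        (isUnit_iff_ne_zero.2 (hd hyU).ne)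
      clifford := fun y hyU => h.localGamma_clifford hφ hs (hy hyU).1 (hy hyU).2
      parallel := fun y hyU μ ν => ?_
      symm_Γ := fun y _ => christoffel_symm g φ y
      trace_Γ := fun y hyU => trace_christoffel g hφ (hy hyU).1 (hd hyU) }
  · have h1 : (metricMat g φ y).transpose = metricMat g φ y := by
      ext μ ν
      exact metricMat_symm g y ν μ
    have h2 := Matrix.transpose_nonsing_inv (metricMat g φ y)
    rw [h1] at h2
    exact congrFun (congrFun h2.symm μ) ν
  · have hi := S.mem_baseSet_at (φ.symm y)
    rw [h.connMat_eq hφ hs (hy hyU).1 (hy hyU).2 hD hi]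
    exact h.localGamma_parallel hφ hs (hy hyU).1 (hy hyU).2 hi μ ν

end IsSpinBundle

end SpinBundle

/-! ### Local form of the Dirac operators; the Dirac bundle and its dual as instances. -/

section SpinBundle

variable {M : Type*} [TopologicalSpace M] [ChartedSpace R4 M] [IsManifold (𝓡 4) ∞ M]
  {g : LorentzMetric M}

omit [IsManifold (𝓡 4) ∞ M] in
lemma mdifferentiableAt_of_comp_chart_symm {φ : Chart M}
    (hφ : φ ∈ IsManifold.maximalAtlas (𝓡 4) ∞ M) {F : Type*} [NormedAddCommGroup F]
    [NormedSpace ℝ F] {f : M → F} {y : R4} (hy : y ∈ φ.target)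
    (hf : DifferentiableAt ℝ (fun z => f (φ.symm z)) y) :
    MDifferentiableAt (𝓡 4) 𝓘(ℝ, F) f (φ.symm y) := by
  have h1 : MDifferentiableAt (𝓡 4) (𝓡 4) φ (φ.symm y) :=
    (chart_mdifferentiable hφ).mdifferentiableAt (φ.map_target hy)
  have h2 : DifferentiableAt ℝ (fun z => f (φ.symm z)) (φ (φ.symm y)) := by
    rwa [φ.right_inv hy]
  refine (h2.mdifferentiableAt.comp (φ.symm y) h1).congr_of_eventuallyEq ?_
  filter_upwards [φ.open_source.mem_nhds (φ.map_target hy)] with x hx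
  simp only [Function.comp_apply, φ.left_inv hx]

lemma fderiv_mulVec {A : R4 → SpinMat} {f : R4 → Spinor} {y : R4} (hA : EntryDiffAt A y)
    (hf : DifferentiableAt ℝ f y) :
    DifferentiableAt ℝ (fun z => (A z).mulVec (f z)) y ∧ ∀ v,
      fderiv ℝ (fun z => (A z).mulVec (f z)) y v =
        (entryDeriv A y v).mulVec (f y) + (A y).mulVec (fderiv ℝ f y v) := by
  have hfc (d : SpinIdx) : DifferentiableAt ℝ (fun z => f z d) y := differentiableAt_pi.1 hf d
  have hd : DifferentiableAt ℝ (fun z => (A z).mulVec (f z)) y :=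
    differentiableAt_pi.2 fun c =>
    show DifferentiableAt ℝ (fun z => ∑ d, A z c d * f z d) y from
      DifferentiableAt.fun_sum fun d _ => (hA c d).fun_mul (hfc d)
  refine ⟨hd, fun v => ?_⟩
  ext c
  have h1 := congrArg (fun L : R4 →L[ℝ] ℂ => L v) (fderiv_apply hd c)
  refine h1.symm.trans ?_
  simp only [Matrix.mulVec, dotProduct, Pi.add_apply]
  rw [fderiv_fun_sum fun d _ => (hA c d).fun_mul (hfc d), ← Finset.sum_add_distrib,
    _root_.sum_apply]
  refine Finset.sum_congr rfl fun d _ => ?_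
  have h2 := congrArg (fun L : R4 →L[ℝ] ℂ => L v) (fderiv_apply hf d)
  rw [fderiv_fun_mul (hA c d) (hfc d)]
  simp only [_root_.add_apply, _root_.smul_apply, smul_eq_mul, entryDeriv_apply]
  rw [show fderiv ℝ (fun z => f z d) y v = fderiv ℝ f y v d from h2]
  ring

variable {S : SpinStructure g} {Z : VectorBundleCore ℂ M Spinor S.ι} {C : Fin 4 → SpinMat}
  {R : S.ι → S.ι → M → SpinMat} {D : Sec Z → (x : M) → TangentSpace (𝓡 4) x → Z.Fiber x}
  {φ : Chart M} {s : SpinIdx → Sec Z} {U : Set M}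

lemma fderiv_eq_sum_stdVec (f : R4 → Spinor) (y v : R4) :
    fderiv ℝ f y v = ∑ μ, ((v μ : ℝ) : ℂ) • fderiv ℝ f y (stdVec μ) := by
  conv_lhs => rw [eq_sum_smul_stdVec v]
  simp only [map_sum, map_smul, Complex.coe_smul]

lemma spinForm_spinCoeff_eq_sum (C : Fin 4 → SpinMat) (i : S.ι) (y v : R4) :
    spinForm C (spinCoeff S φ i y v) =
      ∑ μ, ((v μ : ℝ) : ℂ) • spinForm C (spinCoeff S φ i y (stdVec μ)) := by
  conv_lhs => rw [eq_sum_smul_stdVec v]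
  simp only [spinForm, spinCoeff_sum, Finset.smul_sum, smul_smul, Finset.sum_div,
    Complex.ofReal_sum, Finset.sum_smul]
  symm
  rw [Finset.sum_comm]
  refine Finset.sum_congr rfl fun a _ => ?_
  rw [Finset.sum_comm]
  refine Finset.sum_congr rfl fun b _ => Finset.sum_congr rfl fun μ _ => ?_
  congr 1
  push_cast
  ring

namespace IsSpinBundle

variable (h : IsSpinBundle S Z C R)
include h

lemma inTriv_ofComponents (i : S.ι) (f : R4 → Spinor) (x : M) :
    inTriv Z i (ofComponents φ s f) x = (frameIn Z i s x).mulVec (f (φ x)) := by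
  rw [inTriv_eq, h.indexAt_eq, h.coordChange_eq, h.frameIn_eq, ← Matrix.mulVec_mulVec]
  rfl

variable (hφ : φ ∈ IsManifold.maximalAtlas (𝓡 4) ∞ M) (hs : IsFrameOn s U)
  (hD : IsSpinConnection S Z C D)
include hφ hs hD

/-- The covariant derivative in the local frame is `∂_μ + σ_μ`. -/
lemma comps_conn_ofComponents {y : R4} (hy : y ∈ φ.target) (hyU : φ.symm y ∈ U) {f : R4 → Spinor}
    (hf : DifferentiableAt ℝ f y) (X : TangentSpace (𝓡 4) (φ.symm y)) :
    comps Z (φ.symm y) (D (ofComponents φ s f) (φ.symm y) X) =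
      (frameMat s (φ.symm y)).mulVec (∑ μ, ((mvfderiv (𝓡 4) φ (φ.symm y) X μ : ℝ) : ℂ) •
        (fderiv ℝ f y (stdVec μ) + (connMat D φ s μ y).mulVec (f y))) := by
  set i := S.indexAt (φ.symm y) with hi_def
  have hi : φ.symm y ∈ S.baseSet i := S.mem_baseSet_at (φ.symm y)
  set v : R4 := mvfderiv (𝓡 4) φ (φ.symm y) X with hv
  have hF := h.entrySmoothAt_frameIn hφ hs hy hyU hi
  have hFi : frameIn Z i s (φ.symm y) = frameMat s (φ.symm y) := h.frameIn_indexAt s _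
  have hu := hs.isUnit _ hyU
  have hev : (fun z => inTriv Z i (ofComponents φ s f) (φ.symm z)) =ᶠ[𝓝 y]
      fun z => (frameIn Z i s (φ.symm z)).mulVec (f z) := by
    filter_upwards [φ.open_target.mem_nhds hy] with z hz
    rw [h.inTriv_ofComponents, φ.right_inv hz]
  obtain ⟨hd, hder⟩ := fderiv_mulVec hF.entryDiffAt hf
  have hσ (μ : Fin 4) : (frameMat s (φ.symm y)) * connMat D φ s μ y =
      entryDeriv (fun y => frameIn Z i s (φ.symm y)) y (stdVec μ)
        + spinForm C (spinCoeff S φ i y (stdVec μ)) * frameMat s (φ.symm y) := by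
    rw [h.connMat_eq hφ hs hy hyU hD hi, localConn, gaugeConn, hFi,
      Matrix.mul_nonsing_inv_cancel_left _ _ hu]
  have hc : comps Z (φ.symm y) (ofComponents φ s f (φ.symm y)) =
      (frameMat s (φ.symm y)).mulVec (f y) :=
    congrArg (fun u => (frameMat s (φ.symm y)).mulVec (f u)) (φ.right_inv hy)
  rw [hD φ hφ y hy, mvfderiv_eq_fderiv_chart hφ hy
    (mdifferentiableAt_of_comp_chart_symm hφ hy (hd.congr_of_eventuallyEq hev)), hev.fderiv_eq,
    hder, hc, ← hv, hFi, spinForm_spinCoeff_eq_sum, Matrix.mulVec_sum,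
    entryDeriv_eq_sum _ y v, fderiv_eq_sum_stdVec f y v]
  simp only [Matrix.mulVec_smul, Matrix.mulVec_add, Matrix.mulVec_mulVec, hσ, Matrix.add_mulVec,
    Matrix.sum_mulVec, Matrix.smul_mulVec, Matrix.mulVec_sum, smul_add, Finset.sum_add_distrib,
    Finset.sum_mul, Matrix.smul_mul, Complex.coe_smul, ← hi_def]
  abel

lemma hasLocalForm {m : ℝ} {P : Sec Z → Sec Z} (hP : IsDiracOperator S Z C D m P)
    (hU : U ⊆ φ.source) :
    HasLocalForm P φ s U (fun μ y => -Complex.I • localGamma S C φ s μ y)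
      (diracLow (localGamma S C φ s) (connMat D φ s) m) where
  smooth_a μ c d y hyU := by
    have hγ := (h.isDiracType hφ hs hD hU).smooth_γ y hyU μ
    exact (EntrySmoothAt.smul contDiffAt_const hγ c d).contDiffWithinAt
  smooth_b c d y hyU := by
    have hγ := (h.isDiracType hφ hs hD hU).smooth_γ y hyU
    have hσ (μ : Fin 4) : EntrySmoothAt (connMat D φ s μ) y := by
      obtain ⟨x, hx, rfl⟩ := hyU
      exact h.entrySmoothAt_connMat hφ hs (φ.map_source (hU hx)) (by rwa [φ.left_inv (hU hx)]) hD μ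
    exact (EntrySmoothAt.add (.smul contDiffAt_const (.sum fun μ _ => (hγ μ).mul (hσ μ)))
      (.const _ _) c d).contDiffWithinAt
  apply_eq f hf x hx := by
    obtain ⟨y, hy, rfl⟩ : ∃ y ∈ φ.target, φ.symm y = x :=
      ⟨φ x, φ.map_source (hU hx), φ.left_inv (hU hx)⟩
    have hyV : y ∈ φ '' U := ⟨φ.symm y, hx, φ.right_inv hy⟩
    have hfy : DifferentiableAt ℝ f y := (hf.contDiffAt
      ((φ.isOpen_image_of_subset_source hs.isOpen hU).mem_nhds hyV)).differentiableAt (by simp)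
    have hc (f : R4 → Spinor) : comps Z (φ.symm y) (ofComponents φ s f (φ.symm y)) =
        (frameMat s (φ.symm y)).mulVec (f y) :=
      congrArg (fun u => (frameMat s (φ.symm y)).mulVec (f u)) (φ.right_inv hy)
    change comps Z (φ.symm y) (P (ofComponents φ s f) (φ.symm y)) =
      comps Z (φ.symm y) (ofComponents φ s _ (φ.symm y))
    have hg (μ : Fin 4) : frameMat s (φ.symm y) * localGamma S C φ s μ y =
        gammaField S C φ (S.indexAt (φ.symm y)) μ y * frameMat s (φ.symm y) := by
      rw [localGamma, inFrame, Matrix.mul_assoc, Matrix.mul_nonsing_inv_cancel_left _ _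
        (hs.isUnit _ hx)]
    -- Contracting the constant matrices with the frame components `e_a^μ` gives `γ^μ`; the frame
    -- matrix is then pulled to the left by `hg`.
    have key (G : Fin 4 → Spinor) :
        ∑ a, (C a).mulVec ((frameMat s (φ.symm y)).mulVec (∑ μ,
          ((vielbein S φ (S.indexAt (φ.symm y)) a y μ : ℝ) : ℂ) • G μ)) =
        (frameMat s (φ.symm y)).mulVec (∑ μ, (localGamma S C φ s μ y).mulVec (G μ)) := by
      simp only [Matrix.mulVec_sum, Matrix.mulVec_mulVec, Matrix.mulVec_smul, hg, gammaField,
        Matrix.sum_mulVec, Finset.sum_mul, Matrix.smul_mul, Matrix.smul_mulVec]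
      rw [Finset.sum_comm]
    rw [hP, hc, hc]
    simp only [h.comps_conn_ofComponents hφ hs hD hy hx hfy]
    refine (congrArg (fun u => -Complex.I • u + _) (key _)).trans ?_
    simp only [diracLow, Matrix.add_mulVec, Matrix.mulVec_add, Matrix.smul_mulVec,
      Matrix.sum_mulVec, Matrix.one_mulVec, Finset.sum_add_distrib, Matrix.mulVec_smul,
      Matrix.mulVec_mulVec, smul_add, ← Finset.smul_sum, add_assoc]

end IsSpinBundle

variable (S)

lemma isSpinBundle_dirac :
    IsSpinBundle S S.diracBundle diracGamma fun i j x => spinRep (S.lift j i x) where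
  baseSet_eq _ := rfl
  indexAt_eq _ := rfl
  coordChange_eq _ _ _ _ := rfl
  det_eq _ _ _ := det_spinRep _
  intertwine i j x hx ξ := by
    simp only [S.frame_eq j i x ⟨hx.2, hx.1⟩, map_sum, map_smul, smul_eq_mul, Complex.ofReal_sum,
      Complex.ofReal_mul, Finset.sum_smul]
    rw [Finset.sum_comm, Finset.mul_sum, Finset.sum_mul]
    refine Finset.sum_congr rfl fun a _ => ?_
    rw [Matrix.smul_mul, diracGamma_mul_spinRep]
    simp only [Finset.mul_sum, Finset.smul_sum, Matrix.mul_smul, smul_smul, mul_comm]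
  clifford := isClifford_diracGamma
  commutant := hasScalarCommutant_diracGamma

/-- Cospinors are written as columns, so right multiplication becomes multiplication by the
transpose. The intertwining relation is the transpose of the one for spinors with the two indices
exchanged. -/
lemma isSpinBundle_codirac :
    IsSpinBundle S S.codiracBundle (fun a => -(diracGamma a).transpose)
      fun i j x => (spinRep (S.lift i j x)).transpose where
  baseSet_eq _ := rfl
  indexAt_eq _ := rfl
  coordChange_eq i j x v := (Matrix.mulVec_transpose (spinRep (S.lift i j x)) v).symm
  det_eq _ _ _ := by rw [Matrix.det_transpose, det_spinRep]
  intertwine i j x hx ξ := by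
    have h := congrArg Matrix.transpose
      ((isSpinBundle_dirac S).intertwine j i x ⟨hx.2, hx.1⟩ ξ)
    simp only [Matrix.transpose_mul, Matrix.transpose_sum, Matrix.transpose_smul] at h
    simp only [smul_neg, Finset.sum_neg_distrib, Matrix.mul_neg, Matrix.neg_mul, h]
  clifford := isClifford_diracGamma.neg_transpose
  commutant := hasScalarCommutant_diracGamma.neg_transpose

lemma isSpinConnection_spinConn : IsSpinConnection S S.diracBundle diracGamma S.spinConn := by
  intro φ hφ y hy ψ X
  rw [← connForm_eq hφ hy (S.mem_baseSet_at _)]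
  rfl

lemma isSpinConnection_cospinConn :
    IsSpinConnection S S.codiracBundle (fun a => -(diracGamma a).transpose) S.cospinConn := by
  intro φ hφ y hy ψ X
  have hi := S.mem_baseSet_at (φ.symm y)
  rw [spinForm_neg_transpose (spinCoeff_antisymm hφ hy hi _), ← connForm_eq hφ hy hi,
    Matrix.neg_mulVec, Matrix.mulVec_transpose, ← sub_eq_add_neg]
  rfl

lemma isDiracOperator_diracOp (m : ℝ) :
    IsDiracOperator S S.diracBundle diracGamma S.spinConn m (S.diracOp m) := fun _ _ => rfl

lemma isDiracOperator_codiracOp (m : ℝ) :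
    IsDiracOperator S S.codiracBundle (fun a => -(diracGamma a).transpose) S.cospinConn m
      (S.codiracOp m) := by
  intro ψ x
  simp only [Matrix.neg_mulVec, Matrix.mulVec_transpose, Finset.sum_neg_distrib, smul_neg, neg_smul,
    neg_neg]
  rfl

end SpinBundle

/-! ## Null bicharacteristics and null geodesics -/

section QuadraticForms

/-- The action of a matrix on `ℝ⁴`. -/
noncomputable def matVec (A : Matrix (Fin 4) (Fin 4) ℝ) (v : R4) : R4 := WithLp.toLp 2 (A.mulVec v)

lemma matVec_apply (A : Matrix (Fin 4) (Fin 4) ℝ) (v : R4) (μ : Fin 4) :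
    matVec A v μ = ∑ ν, A μ ν * v ν := rfl

lemma matVec_smul (A : Matrix (Fin 4) (Fin 4) ℝ) (c : ℝ) (v : R4) :
    matVec A (c • v) = c • matVec A v := by
  ext μ
  simp only [matVec_apply, PiLp.smul_apply, smul_eq_mul, Finset.mul_sum]
  exact Finset.sum_congr rfl fun _ _ => by ring

lemma matVec_matVec (A B : Matrix (Fin 4) (Fin 4) ℝ) (v : R4) :
    matVec A (matVec B v) = matVec (A * B) v := by
  simp [matVec, Matrix.mulVec_mulVec]

lemma matVec_one (v : R4) : matVec 1 v = v := by
  simp [matVec]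

lemma bil_eq_dotProduct (A : Matrix (Fin 4) (Fin 4) ℝ) (v w : R4) :
    bil A v w = v.ofLp ⬝ᵥ A.mulVec w.ofLp := by
  simp only [bil, dotProduct, Matrix.mulVec, Finset.mul_sum]
  exact Finset.sum_congr rfl fun _ _ => Finset.sum_congr rfl fun _ _ => by ring

lemma bil_stdVec_right {A : Matrix (Fin 4) (Fin 4) ℝ} (hA : ∀ μ ν, A μ ν = A ν μ) (v : R4)
    (μ : Fin 4) : bil A v (stdVec μ) = matVec A v μ := by
  rw [bil_comm hA, bil, matVec_apply]
  simp [stdVec_apply]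

lemma bil_inv {A : Matrix (Fin 4) (Fin 4) ℝ} (hA : ∀ μ ν, A μ ν = A ν μ)
    (B : Matrix (Fin 4) (Fin 4) ℝ) (v : R4) :
    bil (A⁻¹ * B * A⁻¹) v v = bil B (matVec A⁻¹ v) (matVec A⁻¹ v) := by
  have h1 : A⁻¹.transpose = A⁻¹ := by
    rw [Matrix.transpose_nonsing_inv]
    congr 1
    ext μ ν
    exact hA ν μ
  rw [bil_eq_dotProduct, bil_eq_dotProduct, ← Matrix.mulVec_mulVec, ← Matrix.mulVec_mulVec,
    Matrix.dotProduct_mulVec, ← Matrix.mulVec_transpose, h1]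
  rfl

/-- The gradient in `y` of the quadratic form of the matrix `G y`. -/
noncomputable def gradQuad (G : R4 → Matrix (Fin 4) (Fin 4) ℝ) (y v : R4) : R4 :=
  WithLp.toLp 2 fun ρ => bil (entryDeriv G y (stdVec ρ)) v v

lemma gradQuad_apply (G : R4 → Matrix (Fin 4) (Fin 4) ℝ) (y v : R4) (ρ : Fin 4) :
    gradQuad G y v ρ = bil (entryDeriv G y (stdVec ρ)) v v := rfl

lemma gradQuad_smul (G : R4 → Matrix (Fin 4) (Fin 4) ℝ) (c : ℝ) (y v : R4) :
    gradQuad G y (c • v) = (c * c) • gradQuad G y v := by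
  ext ρ
  simp only [gradQuad_apply, PiLp.smul_apply, smul_eq_mul, bil, Finset.mul_sum]
  exact Finset.sum_congr rfl fun _ _ => Finset.sum_congr rfl fun _ _ => by ring

variable {G : R4 → Matrix (Fin 4) (Fin 4) ℝ} {r : R4 → ℝ} {z : Phase}

lemma quadSymbol_eq (H : R4 → Matrix (Fin 4) (Fin 4) ℝ) (r : R4 → ℝ) (z : Phase) :
    quadSymbol H r z = r z.1 * bil (H z.1) z.2 z.2 := rfl

lemma hamVec_quadSymbol_fst (hG : EntrySmoothAt G z.1) (hu : IsUnit (G z.1).det)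
    (hs : ∀ μ ν, (G z.1)⁻¹ μ ν = (G z.1)⁻¹ ν μ) (hr : ContDiffAt ℝ ∞ r z.1) :
    (hamVec (quadSymbol (fun y => (G y)⁻¹) r) z).1 = (2 * r z.1) • matVec (G z.1)⁻¹ z.2 := by
  ext μ
  rw [hamVec]
  simp only
  rw [sum_smul_stdVec_apply, partXi_quadSymbol (hG.inv hu) hr hs]
  rfl

/-- On the null cone the derivative of `r` is multiplied by zero. The minus sign of Hamilton's
equation cancels the one in `∂(G⁻¹) = -G⁻¹ (∂G) G⁻¹`. -/
lemma hamVec_quadSymbol_snd (hG : EntrySmoothAt G z.1) (hu : IsUnit (G z.1).det)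
    (hs : ∀ μ ν, G z.1 μ ν = G z.1 ν μ) (hr : ContDiffAt ℝ ∞ r z.1)
    (hq : bil (G z.1)⁻¹ z.2 z.2 = 0) :
    (hamVec (quadSymbol (fun y => (G y)⁻¹) r) z).2 =
      r z.1 • gradQuad G z.1 (matVec (G z.1)⁻¹ z.2) := by
  have hH := hG.inv hu
  have hd : DifferentiableAt ℝ (fun y => bil (G y)⁻¹ z.2 z.2) z.1 :=
    (contDiffAt_bil hH contDiffAt_const contDiffAt_const).differentiableAt (by simp)
  ext ρ
  rw [hamVec]
  simp only
  rw [PiLp.neg_apply, sum_smul_stdVec_apply,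
    partX_eq ((contDiffAt_quadSymbol hH hr).differentiableAt (by simp))]
  simp only [quadSymbol_eq]
  rw [fderiv_fun_mul (hr.differentiableAt (by simp)) hd]
  simp only [_root_.add_apply, _root_.smul_apply, smul_eq_mul, hq, zero_mul, add_zero]
  rw [fderiv_bil hH.entryDiffAt (differentiableAt_const _) (differentiableAt_const _),
    entryDeriv_inv hG hu]
  have h0 (A : Matrix (Fin 4) (Fin 4) ℝ) (v : R4) : bil A 0 v = 0 := by simp [bil]
  have h0' (A : Matrix (Fin 4) (Fin 4) ℝ) (v : R4) : bil A v 0 = 0 := by simp [bil]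
  have hn (A : Matrix (Fin 4) (Fin 4) ℝ) (v : R4) : bil (-A) v v = -bil A v v := by
    simp [bil]
  rw [fderiv_fun_const, Pi.zero_apply, _root_.zero_apply, h0, h0', hn, bil_inv hs,
    PiLp.smul_apply, gradQuad_apply, smul_eq_mul]
  ring

lemma hasDerivAt_matVec {x v : ℝ → R4} {x' a : R4} {t : ℝ} (hG : EntryDiffAt G (x t))
    (hx : HasDerivAt x x' t) (hv : HasDerivAt v a t) :
    HasDerivAt (fun τ => matVec (G (x τ)) (v τ))
      (matVec (entryDeriv G (x t) x') (v t) + matVec (G (x t)) a) t := by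
  have hc {w : ℝ → R4} {w' : R4} (hw : HasDerivAt w w' t) (μ : Fin 4) :
      HasDerivAt (fun τ => w τ μ) (w' μ) t :=
    (EuclideanSpace.proj μ : R4 →L[ℝ] ℝ).hasFDerivAt.comp_hasDerivAt t hw
  have h1 (ρ ν : Fin 4) : HasDerivAt (fun τ => G (x τ) ρ ν) (entryDeriv G (x t) x' ρ ν) t :=
    (hG ρ ν).hasFDerivAt.comp_hasDerivAt t hx
  have h2 (ρ : Fin 4) : HasDerivAt (fun τ => matVec (G (x τ)) (v τ) ρ)
      ((matVec (entryDeriv G (x t) x') (v t) + matVec (G (x t)) a) ρ) t := by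
    rw [PiLp.add_apply, matVec_apply, matVec_apply, ← Finset.sum_add_distrib]
    exact HasDerivAt.fun_sum (u := Finset.univ) fun ν _ => (h1 ρ ν).mul (hc hv ν)
  have h3 := HasDerivAt.fun_sum (u := Finset.univ) fun ρ _ => (h2 ρ).smul_const (stdVec ρ)
  simp only [← eq_sum_smul_stdVec] at h3
  exact h3

/-- Bootstrapping: the derivative of an integral curve is the field along the curve, so each order
of regularity yields the next. -/
lemma contDiffOn_of_hasDerivAt {E : Type*} [NormedAddCommGroup E] [NormedSpace ℝ E] {X : E → E}
    {c : ℝ → E} {I : Set ℝ} (hI : IsOpen I) (hX : ∀ t ∈ I, ContDiffAt ℝ ∞ X (c t))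
    (hc : ∀ t ∈ I, HasDerivAt c (X (c t)) t) (n : ℕ) : ContDiffOn ℝ n c I := by
  induction n with
  | zero =>
    exact contDiffOn_zero.2 fun t ht => (hc t ht).continuousAt.continuousWithinAt
  | succ n ih =>
    rw [Nat.cast_add, Nat.cast_one, contDiffOn_succ_iff_deriv_of_isOpen hI]
    refine ⟨fun t ht => (hc t ht).differentiableAt.differentiableWithinAt, by simp, ?_⟩
    have h1 : ContDiffOn ℝ n (fun t => X (c t)) I := fun t ht =>
      ((hX t ht).of_le (by exact_mod_cast le_top)).comp_contDiffWithinAt t (ih t ht)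
    exact h1.congr fun t ht => (hc t ht).deriv

lemma contDiffAt_hamVec {q : Phase → ℝ} (hq : ContDiffAt ℝ ∞ q z) :
    ContDiffAt ℝ ∞ (hamVec q) z := by
  have h (v : Phase) : ContDiffAt ℝ ∞ (fun z => fderiv ℝ q z v) z :=
    (hq.fderiv_right (m := ∞) (by simp)).clm_apply contDiffAt_const
  exact (ContDiffAt.sum fun μ _ => (h _).smul contDiffAt_const).prodMk
    (ContDiffAt.sum fun μ _ => (h _).smul contDiffAt_const).neg

/-- A nowhere vanishing solution of `h' = -k h` on an open interval. -/
lemma exists_hasDerivAt_neg_mul {k : ℝ → ℝ} {I : Set ℝ} (hI : IsOpen I) (hI' : IsPreconnected I)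
    (hk : ContinuousOn k I) :
    ∃ h : ℝ → ℝ, (∀ t, h t ≠ 0) ∧ ∀ t ∈ I, HasDerivAt h (-(k t * h t)) t := by
  rcases I.eq_empty_or_nonempty with rfl | ⟨t₀, ht₀⟩
  · exact ⟨fun _ => 1, fun _ => one_ne_zero, by simp⟩
  refine ⟨fun t => Real.exp (-∫ s in t₀..t, k s), fun t => (Real.exp_pos _).ne', fun t ht => ?_⟩
  have hsub : Set.uIcc t₀ t ⊆ I := hI'.ordConnected.uIcc_subset ht₀ ht
  have h1 := intervalIntegral.integral_hasDerivAt_right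
    ((hk.mono hsub).intervalIntegrable)
    (hk.stronglyMeasurableAtFilter hI t ht) (hk.continuousAt (hI.mem_nhds ht))
  have h2 : HasDerivAt (fun u => -∫ s in t₀..u, k s) (-k t) t := h1.neg
  convert h2.exp using 1
  ring

end QuadraticForms

/-! ### Hamiltonian flow of the metric symbol and null geodesics. -/

section Geodesics

variable {M : Type*} [TopologicalSpace M] [ChartedSpace R4 M] [IsManifold (𝓡 4) ∞ M]
  {g : LorentzMetric M} (S : SpinStructure g) {φ : Chart M} {U : Set M} {I : Set ℝ} {y : R4}

/-- For velocity `v` and acceleration `a` the left side is the derivative of `g_{μν} ẋ^ν`. It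
differs from the lowered covariant acceleration by the force term `½ ∂_ρ g(ẋ, ẋ)` of Hamilton's
equations. -/
lemma matVec_christoffelVec (hu : IsUnit (metricMat g φ y).det) (v a : R4) :
    matVec (entryDeriv (metricMat g φ) y v) v + matVec (metricMat g φ y) a =
      matVec (metricMat g φ y) (a + christoffelVec g φ y v v)
        + (1 / 2 : ℝ) • gradQuad (metricMat g φ) y v := by
  have hs := metricMat_symm g (φ := φ) y
  ext ρ
  simp only [PiLp.add_apply, PiLp.smul_apply, smul_eq_mul, gradQuad_apply]
  rw [← bil_stdVec_right hs (a + christoffelVec g φ y v v), bil_add_left,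
    bil_christoffelVec g hu, bil_stdVec_right hs, christoffelForm,
    bil_stdVec_right (entryDeriv_metricMat_symm g φ y v)]
  ring

lemma metricMat_inv_symm (y : R4) (μ ν : Fin 4) :
    (metricMat g φ y)⁻¹ μ ν = (metricMat g φ y)⁻¹ ν μ := by
  have h1 : (metricMat g φ y).transpose = metricMat g φ y := by
    ext μ ν
    exact metricMat_symm g y ν μ
  have h2 := Matrix.transpose_nonsing_inv (metricMat g φ y)
  rw [h1] at h2
  exact congrFun (congrFun h2.symm μ) ν

lemma matVec_metricMat_inv (hu : IsUnit (metricMat g φ y).det) (v : R4) :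
    matVec (metricMat g φ y) (matVec (metricMat g φ y)⁻¹ v) = v := by
  rw [matVec_matVec, Matrix.mul_nonsing_inv _ hu, matVec_one]

lemma matVec_inv_metricMat (hu : IsUnit (metricMat g φ y).det) (v : R4) :
    matVec (metricMat g φ y)⁻¹ (matVec (metricMat g φ y) v) = v := by
  rw [matVec_matVec, Matrix.nonsing_inv_mul _ hu, matVec_one]

lemma bil_metricMat_matVec_inv (hu : IsUnit (metricMat g φ y).det) (v : R4) :
    bil (metricMat g φ y) (matVec (metricMat g φ y)⁻¹ v) (matVec (metricMat g φ y)⁻¹ v) =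
      bil (metricMat g φ y)⁻¹ v v := by
  rw [← bil_inv (metricMat_symm g y), Matrix.nonsing_inv_mul _ hu, Matrix.one_mul]

lemma bil_smul_self (A : Matrix (Fin 4) (Fin 4) ℝ) (c : ℝ) (v : R4) :
    bil A (c • v) (c • v) = c * c * bil A v v := by
  simp only [bil, PiLp.smul_apply, smul_eq_mul, Finset.mul_sum]
  exact Finset.sum_congr rfl fun _ _ => Finset.sum_congr rfl fun _ _ => by ring

variable (hφ : φ ∈ IsManifold.maximalAtlas (𝓡 4) ∞ M) (hU : U ⊆ φ.source)
include S hφ hU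

/-- The spin structure enters only through its orthonormal frames, which make the determinant of the
metric negative. -/
lemma metricMat_regular (hy : y ∈ φ '' U) :
    EntrySmoothAt (metricMat g φ) y ∧ IsUnit (metricMat g φ y).det ∧
      ContDiffAt ℝ ∞ (sqrtNegDet g φ) y ∧ 0 < sqrtNegDet g φ y := by
  have hyt : y ∈ φ.target := by
    obtain ⟨x, hx, rfl⟩ := hy
    exact φ.map_source (hU hx)
  have hd := det_metricMat_neg hφ hyt (S.mem_baseSet_at (φ.symm y))
  exact ⟨entrySmoothAt_metricMat hφ g hyt, isUnit_iff_ne_zero.2 hd.ne,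
    contDiffAt_sqrtNegDet g hφ hyt hd, Real.sqrt_pos.2 (neg_pos.2 hd)⟩

lemma hamVec_nullSymbol_fst {z : Phase} (hz : z.1 ∈ φ '' U) :
    (hamVec (nullSymbol g φ) z).1 =
      (2 * sqrtNegDet g φ z.1) • matVec (metricMat g φ z.1)⁻¹ z.2 := by
  obtain ⟨hG, hu, hr, -⟩ := metricMat_regular S hφ hU hz
  exact hamVec_quadSymbol_fst hG hu (metricMat_inv_symm z.1) hr

lemma hamVec_nullSymbol_snd {z : Phase} (hz : z.1 ∈ φ '' U)
    (hq : bil (metricMat g φ z.1)⁻¹ z.2 z.2 = 0) :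
    (hamVec (nullSymbol g φ) z).2 =
      sqrtNegDet g φ z.1 • gradQuad (metricMat g φ) z.1 (matVec (metricMat g φ z.1)⁻¹ z.2) := by
  obtain ⟨hG, hu, hr, -⟩ := metricMat_regular S hφ hU hz
  exact hamVec_quadSymbol_snd hG hu (metricMat_symm g z.1) hr hq

lemma nullSymbol_eq_zero_iff {z : Phase} (hz : z.1 ∈ φ '' U) :
    nullSymbol g φ z = 0 ↔ bil (metricMat g φ z.1)⁻¹ z.2 z.2 = 0 := by
  obtain ⟨-, -, -, hr⟩ := metricMat_regular S hφ hU hz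
  change sqrtNegDet g φ z.1 * bil (metricMat g φ z.1)⁻¹ z.2 z.2 = 0 ↔ _
  rw [mul_eq_zero, or_iff_right hr.ne']

lemma contDiffAt_nullSymbol {z : Phase} (hz : z.1 ∈ φ '' U) :
    ContDiffAt ℝ ∞ (nullSymbol g φ) z := by
  obtain ⟨hG, hu, hr, -⟩ := metricMat_regular S hφ hU hz
  exact contDiffAt_quadSymbol (H := fun y => (metricMat g φ y)⁻¹) (hG.inv hu) hr

/-- Null bicharacteristics of `√(-g) g^{μν} ξ_μ ξ_ν` project to null geodesics. -/
lemma isNullGeodesic_of_isNullBichar (hI : IsOpen I) {c : ℝ → Phase}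
    (hc : IsNullBichar (nullSymbol g φ) (φ '' U) (fun _ => 1) c I) :
    IsNullGeodesic g φ U (fun τ => (c τ).1) I ∧
      ∀ τ ∈ I, deriv (fun t => (c t).1) τ =
        (2 * sqrtNegDet g φ (c τ).1) • matVec (metricMat g φ (c τ).1)⁻¹ (c τ).2 := by
  have hcd (t : ℝ) (ht : t ∈ I) : HasDerivAt c (hamVec (nullSymbol g φ) (c t)) t := by
    simpa using hc.hasDerivAt t ht
  have hV (t : ℝ) (ht : t ∈ I) := metricMat_regular S hφ hU (hc.mem t ht).1
  have hq (t : ℝ) (ht : t ∈ I) :=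
    (nullSymbol_eq_zero_iff S hφ hU (hc.mem t ht).1).1 (hc.null t ht)
  have hx (t : ℝ) (ht : t ∈ I) : HasDerivAt (fun t => (c t).1)
      ((2 * sqrtNegDet g φ (c t).1) • matVec (metricMat g φ (c t).1)⁻¹ (c t).2) t := by
    rw [← hamVec_nullSymbol_fst S hφ hU (hc.mem t ht).1]
    exact (ContinuousLinearMap.fst ℝ R4 R4).hasFDerivAt.comp_hasDerivAt t (hcd t ht)
  have hξ (t : ℝ) (ht : t ∈ I) : HasDerivAt (fun t => (c t).2)
      (sqrtNegDet g φ (c t).1 • gradQuad (metricMat g φ) (c t).1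
        (matVec (metricMat g φ (c t).1)⁻¹ (c t).2)) t := by
    rw [← hamVec_nullSymbol_snd S hφ hU (hc.mem t ht).1 (hq t ht)]
    exact (ContinuousLinearMap.snd ℝ R4 R4).hasFDerivAt.comp_hasDerivAt t (hcd t ht)
  have hcC : ContDiffOn ℝ 2 c I := by
    have h2 := contDiffOn_of_hasDerivAt hI (fun t ht => contDiffAt_hamVec
      (contDiffAt_nullSymbol S hφ hU (hc.mem t ht).1)) hcd 2
    exact_mod_cast h2
  have hxC : ContDiffOn ℝ 2 (fun t => (c t).1) I := contDiff_fst.comp_contDiffOn hcC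
  have hxC' : DifferentiableOn ℝ (deriv fun t => (c t).1) I :=
    ((contDiffOn_succ_iff_deriv_of_isOpen (n := 1) hI).1 hxC).2.2.differentiableOn (by simp)
  have hp (t : ℝ) (ht : t ∈ I) : matVec (metricMat g φ (c t).1) (deriv (fun t => (c t).1) t) =
      (2 * sqrtNegDet g φ (c t).1) • (c t).2 := by
    rw [(hx t ht).deriv, matVec_smul, matVec_metricMat_inv (hV t ht).2.1]
  refine ⟨⟨hxC, fun t ht => (hc.mem t ht).1, fun t ht h0 => ?_, fun t ht => ?_, fun t ht => ?_⟩,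
    fun t ht => (hx t ht).deriv⟩
  · have h1 := hp t ht
    have h2 : matVec (metricMat g φ (c t).1) 0 = 0 := by
      simpa using matVec_smul (metricMat g φ (c t).1) 0 0
    rw [h0, h2, eq_comm, smul_eq_zero] at h1
    have h3 := (hV t ht).2.2.2
    exact h1.elim (by positivity) (hc.mem t ht).2
  · change bil (metricMat g φ (c t).1) (deriv (fun t => (c t).1) t)
      (deriv (fun t => (c t).1) t) = 0
    rw [(hx t ht).deriv, bil_smul_self, bil_metricMat_matVec_inv (hV t ht).2.1, hq t ht, mul_zero]
  · obtain ⟨hG, hu, hr, hr0⟩ := hV t ht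
    have ha := (hxC'.differentiableAt (hI.mem_nhds ht)).hasDerivAt
    have hxt := hx t ht
    rw [← hxt.deriv] at hxt
    have h1 := hasDerivAt_matVec hG.entryDiffAt hxt ha
    rw [matVec_christoffelVec hu] at h1
    set r' := fderiv ℝ (sqrtNegDet g φ) (c t).1 (deriv (fun t => (c t).1) t)
    have hrx : HasDerivAt (fun τ => sqrtNegDet g φ (c τ).1) r' t :=
      HasFDerivAt.comp_hasDerivAt (l := sqrtNegDet g φ) t
        (hr.differentiableAt (by simp)).hasFDerivAt hxt
    have h2 := ((hrx.const_mul 2).fun_smul (hξ t ht)).congr_of_eventuallyEq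
      (Filter.mem_of_superset (hI.mem_nhds ht) hp)
    have h3 := h1.unique h2
    -- The gradient is quadratic in the velocity `2 r G⁻¹ ξ`, and `½ (2r)² = 2r · r`. Hence the
    -- force term equals `2 r ξ̇` and cancels.
    have hgr : (1 / 2 : ℝ) • gradQuad (metricMat g φ) (c t).1 (deriv (fun t => (c t).1) t) =
        (2 * sqrtNegDet g φ (c t).1) • sqrtNegDet g φ (c t).1 •
          gradQuad (metricMat g φ) (c t).1 (matVec (metricMat g φ (c t).1)⁻¹ (c t).2) := by
      rw [(hx t ht).deriv, gradQuad_smul, smul_smul, smul_smul]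
      congr 1
      ring
    rw [hgr, add_comm, add_right_inj] at h3
    -- Since `2 ξ = G ẋ / r`, the remaining term is `(r'/r) G ẋ`; so the factor in the geodesic
    -- equation is `r'/r`, the logarithmic derivative of `√(-g)` along the curve.
    have h4 : (2 * r') • (c t).2 = matVec (metricMat g φ (c t).1)
        ((r' / sqrtNegDet g φ (c t).1) • deriv (fun t => (c t).1) t) := by
      rw [matVec_smul, hp t ht, smul_smul]
      congr 1
      field_simp
    rw [h4] at h3
    have h5 := congrArg (matVec (metricMat g φ (c t).1)⁻¹) h3
    rw [matVec_inv_metricMat hu, matVec_inv_metricMat hu] at h5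
    exact ⟨_, fun κ => congrArg (fun v : R4 => v κ) h5⟩

lemma contDiffAt_christoffel (hy : y ∈ φ '' U) (κ μ ν : Fin 4) :
    ContDiffAt ℝ ∞ (fun y => christoffel g φ y κ μ ν) y := by
  obtain ⟨hG, hu, -, -⟩ := metricMat_regular S hφ hU hy
  exact ContDiffAt.sum fun ρ _ => (((hG.inv hu) κ ρ).mul
    ((((hG.entryDeriv (stdVec μ)) ρ ν).add ((hG.entryDeriv (stdVec ν)) ρ μ)).sub
      ((hG.entryDeriv (stdVec ρ)) μ ν))).div_const 2

/-- Every null geodesic lifts to a reparametrized null bicharacteristic. -/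
lemma exists_isNullBichar_of_isNullGeodesic (hI : IsOpen I) (hI' : IsPreconnected I) {x : ℝ → R4}
    (hx : IsNullGeodesic g φ U x I) :
    ∃ (ξ : ℝ → R4) (f : ℝ → ℝ), (∀ τ ∈ I, f τ ≠ 0) ∧
      IsNullBichar (nullSymbol g φ) (φ '' U) f (fun τ => (x τ, ξ τ)) I := by
  obtain ⟨hxd, -, hxC'⟩ := (contDiffOn_succ_iff_deriv_of_isOpen (n := 1) hI).1 hx.contDiffOn
  obtain ⟨hxd', -, hxC''⟩ := (contDiffOn_succ_iff_deriv_of_isOpen (n := 0) hI).1 hxC'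
  have hV (t : ℝ) (ht : t ∈ I) := metricMat_regular S hφ hU (hx.mem t ht)
  have hd (t : ℝ) (ht : t ∈ I) := (hxd.differentiableAt (hI.mem_nhds ht)).hasDerivAt
  have hd' (t : ℝ) (ht : t ∈ I) := (hxd'.differentiableAt (hI.mem_nhds ht)).hasDerivAt
  set w : ℝ → R4 := fun t => deriv (deriv x) t + christoffelVec g φ (x t) (deriv x t) (deriv x t)
    with hw
  have hwc : ContinuousOn w I := by
    refine hxC''.continuousOn.add ((PiLp.continuous_toLp 2 _).comp_continuousOn
      (continuousOn_pi.2 fun κ => ?_))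
    have hcoord (μ : Fin 4) : ContinuousOn (fun t => deriv x t μ) I :=
      (contDiff_coord μ).continuous.comp_continuousOn hxC'.continuousOn
    refine continuousOn_finsetSum _ fun μ _ => continuousOn_finsetSum _ fun ν _ =>
      (ContinuousOn.mul ?_ (hcoord μ)).mul (hcoord ν)
    exact fun t ht => (ContinuousAt.comp (f := x)
      (contDiffAt_christoffel S hφ hU (hx.mem t ht) κ μ ν).continuousAt
      (hd t ht).continuousAt).continuousWithinAt
  have hne (t : ℝ) (ht : t ∈ I) : inner ℝ (deriv x t) (deriv x t) ≠ 0 :=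
    inner_self_ne_zero.2 (hx.ne_zero t ht)
  -- The geodesic equation supplies a factor at each time separately. The auxiliary Euclidean inner
  -- product, nonzero on the null velocity, expresses it by a formula that is continuous in `t`.
  set k : ℝ → ℝ := fun t => inner ℝ (deriv x t) (w t) / inner ℝ (deriv x t) (deriv x t) with hk
  have hkw (t : ℝ) (ht : t ∈ I) : w t = k t • deriv x t := by
    obtain ⟨k₀, h0⟩ := hx.geodesic t ht
    have h1 : w t = k₀ • deriv x t := by
      ext κ
      exact h0 κ
    have h2 : k t = k₀ := by
      simp only [hk]
      rw [h1, inner_smul_right]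
      exact mul_div_cancel_right₀ _ (hne t ht)
    rw [h2, h1]
  have hkc : ContinuousOn k I :=
    (hxC'.continuousOn.inner hwc).div (hxC'.continuousOn.inner hxC'.continuousOn) hne
  obtain ⟨h, h0, hh⟩ := exists_hasDerivAt_neg_mul hI hI' hkc
  have hsharp (t : ℝ) (ht : t ∈ I) : matVec (metricMat g φ (x t))⁻¹
      (h t • matVec (metricMat g φ (x t)) (deriv x t)) = h t • deriv x t := by
    rw [matVec_smul, matVec_inv_metricMat (hV t ht).2.1]
  have hq (t : ℝ) (ht : t ∈ I) : bil (metricMat g φ (x t))⁻¹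
      (h t • matVec (metricMat g φ (x t)) (deriv x t))
      (h t • matVec (metricMat g φ (x t)) (deriv x t)) = 0 := by
    rw [← bil_metricMat_matVec_inv (hV t ht).2.1, hsharp t ht, bil_smul_self]
    exact mul_eq_zero_of_right _ (hx.null t ht)
  -- The factor `h` absorbs the failure of affine parametrization. The speed is forced by the
  -- `x`-equation: `H_q` has `x`-part `2 r h ẋ`.
  refine ⟨fun t => h t • matVec (metricMat g φ (x t)) (deriv x t),
    fun t => 1 / (2 * sqrtNegDet g φ (x t) * h t), fun t ht => ?_,
    ⟨fun t ht => ⟨hx.mem t ht, fun h1 => ?_⟩, fun t ht => ?_, fun t ht => ?_⟩⟩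
  · have := (hV t ht).2.2.2.ne'
    have := h0 t
    positivity
  · have h2 := hsharp t ht
    simp only at h1
    have h3 : matVec (metricMat g φ (x t))⁻¹ 0 = 0 := by
      simpa using matVec_smul (metricMat g φ (x t))⁻¹ 0 0
    rw [h1, h3] at h2
    exact (smul_ne_zero (h0 t) (hx.ne_zero t ht)) h2.symm
  · exact (nullSymbol_eq_zero_iff S hφ hU (z := (x t, _)) (hx.mem t ht)).2 (hq t ht)
  · have hr := (hV t ht).2.2.2.ne'
    have hht := h0 t
    have h1 := hasDerivAt_matVec (hV t ht).1.entryDiffAt (hd t ht) (hd' t ht)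
    rw [matVec_christoffelVec (hV t ht).2.1] at h1
    change HasDerivAt _ (matVec _ (w t) + _) t at h1
    have h2 := (hd t ht).prodMk ((hh t ht).fun_smul h1)
    convert h2 using 1
    refine Prod.ext ?_ ?_
    · rw [Prod.smul_fst, hamVec_nullSymbol_fst S hφ hU (hx.mem t ht)]
      simp only
      rw [hsharp t ht, smul_smul, smul_smul]
      convert one_smul ℝ (deriv x t) using 2
      field_simp
    · rw [Prod.smul_snd, hamVec_nullSymbol_snd S hφ hU
        (z := (x t, h t • matVec (metricMat g φ (x t)) (deriv x t))) (hx.mem t ht) (hq t ht)]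
      simp only
      rw [hsharp t ht, gradQuad_smul, hkw t ht, matVec_smul]
      simp only [smul_smul, smul_add]
      rw [add_right_comm, ← add_smul]
      -- This is the purpose of `h' = -k h`: the acceleration along the curve cancels and only the
      -- force term of Hamilton's equation remains.
      have e1 : h t * k t + -(k t * h t) = 0 := by ring
      rw [e1, zero_smul, zero_add]
      congr 1
      field_simp

end Geodesics

/-! ## The Dirac operators -/

section Main

variable {M : Type*} [TopologicalSpace M] [ChartedSpace R4 M] [IsManifold (𝓡 4) ∞ M]
  {g : LorentzMetric M} {S : SpinStructure g}

namespace IsSpinBundle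

variable {Z : VectorBundleCore ℂ M Spinor S.ι} {C : Fin 4 → SpinMat}
  {R : S.ι → S.ι → M → SpinMat} {D : Sec Z → (x : M) → TangentSpace (𝓡 4) x → Z.Fiber x}
  {φ : Chart M} {s : SpinIdx → Sec Z} {U : Set M} (h : IsSpinBundle S Z C R)
  (hD : IsSpinConnection S Z C D) {P : ℝ → Sec Z → Sec Z}
  (hP : ∀ m, IsDiracOperator S Z C D m (P m))
include h hD hP

lemma isRealPrincipalType (m : ℝ) : IsRealPrincipalType (P m) := by
  intro φ hφ U hU s hs
  have ht := h.isDiracType hφ hs hD hU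
  refine ⟨_, _, h.hasLocalForm hφ hs hD (hP m) hU, fun z hz => ?_⟩
  rw [principalSymbol_slash]
  exact ⟨_, _, _, hz, ht.isRealPrincipalTypeVia⟩

variable (hφ : φ ∈ IsManifold.maximalAtlas (𝓡 4) ∞ M) (hs : IsFrameOn s U) (hU : U ⊆ φ.source)
include hφ hs hU

/-- The coefficients `a` are chosen before `m`, which enters only the zeroth order term.
Independence of Dencker's connection from `m` follows because for each mass it equals the same
lifted connection on the kernel. -/
lemma exists_localForm {p pt : Phase → SpinMat} (hp : p = slashSymbol (localGamma S C φ s))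
    (hpt : pt = fun z => ((sqrtNegDet g φ z.1 : ℝ) : ℂ) • p z) :
    ∃ (a : Fin 4 → R4 → SpinMat) (b : ℝ → R4 → SpinMat),
      (∀ m : ℝ, HasLocalForm (P m) φ s U a (b m)) ∧
      (∀ z ∈ coneOver (φ '' U), principalSymbol a z = p z) ∧
      (∀ z ∈ coneOver (φ '' U), (principalSymbol a z).det = 0 ↔ nullSymbol g φ z = 0) ∧
      IsRealPrincipalTypeVia (principalSymbol a) pt (nullSymbol g φ) (coneOver (φ '' U)) ∧
      (∀ m : ℝ, DenckerEqLift (principalSymbol a) pt (nullSymbol g φ)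
        (subprincipalSymbol a (b m)) (connMat D φ s) (φ '' U)) ∧
      (∀ (m m' : ℝ) (w : Phase → Spinor), ∀ z ∈ coneOver (φ '' U),
        (principalSymbol a z).mulVec (w z) = 0 →
        dencker (principalSymbol a) pt (nullSymbol g φ) (subprincipalSymbol a (b m)) w z =
        dencker (principalSymbol a) pt (nullSymbol g φ) (subprincipalSymbol a (b m')) w z) := by
  subst hpt hp
  have ht := h.isDiracType hφ hs hD hU
  refine ⟨fun μ y => -Complex.I • localGamma S C φ s μ y,
    diracLow (localGamma S C φ s) (connMat D φ s),
    fun m => h.hasLocalForm hφ hs hD (hP m) hU, ?_⟩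
  simp only [subprincipalSymbol, principalSymbol_slash]
  refine ⟨fun _ _ => trivial, fun z hz => ht.det_slash_eq_zero_iff hz.1, ht.isRealPrincipalTypeVia,
    fun m => ht.denckerEqLift m, fun m m' w z hz hw => ?_⟩
  exact (ht.dencker_eq m hz.1 hw).trans (ht.dencker_eq m' hz.1 hw).symm

end IsSpinBundle

lemma slashLocal_eq (φ : Chart M) (s : SpinIdx → Sec S.diracBundle) :
    slashLocal S φ s = slashSymbol (localGamma S diracGamma φ s) := rfl

/-- The sign of the dual symbol is the one built into the matrices `-(γ^a)ᵀ`; it passes through the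
contraction with the frame and the conjugation by the frame matrix. -/
lemma neg_coslashLocal_eq (φ : Chart M) (s : SpinIdx → Sec S.codiracBundle) :
    (fun z => -coslashLocal S φ s z) =
      slashSymbol (localGamma S (fun a => -(diracGamma a).transpose) φ s) := by
  funext z
  rw [coslashLocal, slashSymbol, ← Finset.sum_neg_distrib]
  refine Finset.sum_congr rfl fun μ _ => ?_
  rw [← smul_neg]
  congr 1
  have h1 : gammaField S (fun a => -(diracGamma a).transpose) φ (S.indexAt (φ.symm z.1)) μ z.1 =
      -(S.slash (S.indexAt (φ.symm z.1)) (φ.symm z.1)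
        (coordCovec φ μ (φ.symm z.1))).transpose := by
    simp only [gammaField, SpinStructure.slash, Matrix.transpose_sum, Matrix.transpose_smul,
      smul_neg, Finset.sum_neg_distrib]
    rfl
  rw [localGamma, h1, inFrame, inFrame, Matrix.mul_neg, Matrix.neg_mul]

end Main

theorem mainTheorem3 {M : Type*} [TopologicalSpace M] [ChartedSpace R4 M] [IsManifold (𝓡 4) ∞ M]
    (g : LorentzMetric M) (S : SpinStructure g) :
    -- the Dirac operators on the Dirac bundle and on its dual are of real principal type
    (∀ m : ℝ, IsRealPrincipalType (S.diracOp m)) ∧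
    (∀ m : ℝ, IsRealPrincipalType (S.codiracOp m)) ∧
    (∀ φ ∈ IsManifold.maximalAtlas (𝓡 4) ∞ M, ∀ (U : Set M), IsOpen U → U ⊆ φ.source →
      -- the null bicharacteristics of `q` project to null geodesics, with `ξ` tangent to the curve
      (∀ (I : Set ℝ) (c : ℝ → Phase), IsOpen I →
        IsNullBichar (nullSymbol g φ) (φ '' U) (fun _ => 1) c I →
          IsNullGeodesic g φ U (fun τ => (c τ).1) I ∧
          ∀ τ ∈ I, ∀ μ, deriv (fun t => (c t).1) τ μ = 2 * sqrtNegDet g φ (c τ).1 *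
            ∑ ν, (metricMat g φ (c τ).1)⁻¹ μ ν * (c τ).2 ν) ∧
      -- and every null geodesic arises in this way, up to reparametrization
      (∀ (I : Set ℝ) (x : ℝ → R4), IsOpen I → IsPreconnected I → IsNullGeodesic g φ U x I →
        ∃ (ξ : ℝ → R4) (f : ℝ → ℝ), (∀ τ ∈ I, f τ ≠ 0) ∧
          IsNullBichar (nullSymbol g φ) (φ '' U) f (fun τ => (x τ, ξ τ)) I) ∧
      -- Dencker's connection of `-i∇̸ + m`, with `p̃ = √(-g) ξ̸`, is the lifted spin connection
      (∀ s : SpinIdx → Sec S.diracBundle, IsFrameOn s U →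
        ∃ (a : Fin 4 → R4 → SpinMat) (b : ℝ → R4 → SpinMat),
          (∀ m : ℝ, HasLocalForm (S.diracOp m) φ s U a (b m)) ∧
          (∀ z ∈ coneOver (φ '' U), principalSymbol a z = slashLocal S φ s z) ∧
          (∀ z ∈ coneOver (φ '' U), (principalSymbol a z).det = 0 ↔ nullSymbol g φ z = 0) ∧
          IsRealPrincipalTypeVia (principalSymbol a)
            (fun z => (sqrtNegDet g φ z.1 : ℂ) • slashLocal S φ s z)
            (nullSymbol g φ) (coneOver (φ '' U)) ∧
          (∀ m : ℝ, DenckerEqLift (principalSymbol a)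
            (fun z => (sqrtNegDet g φ z.1 : ℂ) • slashLocal S φ s z)
            (nullSymbol g φ) (subprincipalSymbol a (b m)) (connMat S.spinConn φ s) (φ '' U)) ∧
          (∀ (m m' : ℝ) (w : Phase → Spinor), ∀ z ∈ coneOver (φ '' U),
            (principalSymbol a z).mulVec (w z) = 0 →
            dencker (principalSymbol a) (fun z => (sqrtNegDet g φ z.1 : ℂ) • slashLocal S φ s z)
              (nullSymbol g φ) (subprincipalSymbol a (b m)) w z =
            dencker (principalSymbol a) (fun z => (sqrtNegDet g φ z.1 : ℂ) • slashLocal S φ s z)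
              (nullSymbol g φ) (subprincipalSymbol a (b m')) w z)) ∧
      -- the same for `i∇̸ + m` on the dual bundle, with `p̃ = -√(-g) ξ̸` acting from the right
      (∀ s : SpinIdx → Sec S.codiracBundle, IsFrameOn s U →
        ∃ (a : Fin 4 → R4 → SpinMat) (b : ℝ → R4 → SpinMat),
          (∀ m : ℝ, HasLocalForm (S.codiracOp m) φ s U a (b m)) ∧
          (∀ z ∈ coneOver (φ '' U), principalSymbol a z = -coslashLocal S φ s z) ∧
          (∀ z ∈ coneOver (φ '' U), (principalSymbol a z).det = 0 ↔ nullSymbol g φ z = 0) ∧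
          IsRealPrincipalTypeVia (principalSymbol a)
            (fun z => -((sqrtNegDet g φ z.1 : ℂ) • coslashLocal S φ s z))
            (nullSymbol g φ) (coneOver (φ '' U)) ∧
          (∀ m : ℝ, DenckerEqLift (principalSymbol a)
            (fun z => -((sqrtNegDet g φ z.1 : ℂ) • coslashLocal S φ s z))
            (nullSymbol g φ) (subprincipalSymbol a (b m)) (connMat S.cospinConn φ s) (φ '' U)) ∧
          (∀ (m m' : ℝ) (w : Phase → Spinor), ∀ z ∈ coneOver (φ '' U),
            (principalSymbol a z).mulVec (w z) = 0 →
            dencker (principalSymbol a)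
              (fun z => -((sqrtNegDet g φ z.1 : ℂ) • coslashLocal S φ s z))
              (nullSymbol g φ) (subprincipalSymbol a (b m)) w z =
            dencker (principalSymbol a)
              (fun z => -((sqrtNegDet g φ z.1 : ℂ) • coslashLocal S φ s z))
              (nullSymbol g φ) (subprincipalSymbol a (b m')) w z))) := by
  have hS := isSpinBundle_dirac S
  have hS' := isSpinBundle_codirac S
  refine ⟨hS.isRealPrincipalType (isSpinConnection_spinConn S) (isDiracOperator_diracOp S),
    hS'.isRealPrincipalType (isSpinConnection_cospinConn S) (isDiracOperator_codiracOp S),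
    fun φ hφ U _ hU => ⟨fun I c hI hc => ?_, fun I x hI hI' hx =>
      exists_isNullBichar_of_isNullGeodesic S hφ hU hI hI' hx, fun s hs => ?_, fun s hs => ?_⟩⟩
  · obtain ⟨h1, h2⟩ := isNullGeodesic_of_isNullBichar S hφ hU hI hc
    exact ⟨h1, fun τ hτ μ => congrArg (fun v : R4 => v μ) (h2 τ hτ)⟩
  · exact hS.exists_localForm (isSpinConnection_spinConn S) (isDiracOperator_diracOp S) hφ hs hU
      (slashLocal_eq φ s) rfl
  · exact hS'.exists_localForm (isSpinConnection_cospinConn S) (isDiracOperator_codiracOp S) hφ hs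
      hU (neg_coslashLocal_eq φ s) (funext fun z => (smul_neg _ _).symm)
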